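/- **Setting.** Let $n,d\ge 1$ and consider $x_{t+1}=A_*x_t+B_*u_t+w_t=\Theta_*^\top z_t+w_t$, $x_0=0$, with state $x_t\in\mathbb R^n$, input $u_t\in\mathbb R^d$, $z_t=(x_t,u_t)$, $\Theta_*=[A_*\ B_*]^\top\in\mathbb R^{(n+d)\times n}$, a filtration $(\mathcal F_t)$ to which $x_t,u_t$ are adapted, and $w_t\mid\mathcal F_t\sim\mathcal N(0,\sigma_w^2I)$, $\sigma_w>0$. Let $Q,R\succ0$. For $\Theta=[A\ B]^\top$ let $P(\Theta)$ be the positive definite solution of the Riccati equation $P=A^\top PA+Q-A^\top PB(R+B^\top PB)^{-1}B^\top PA$, $K(\Theta)=-(R+B^\top PB)^{-1}B^\top PA$ the optimal controller, and $J(\Theta)=\sigma_w^2\operatorname{tr}P(\Theta)$ the optimal average cost ($J(\Theta)=\infty$ if there is no such $P$). Let $\kappa\ge1$, $0<\gamma\le1$, $S>0$, $\delta\in(0,1)$. Call $\Theta$ $(\kappa,\gamma)$-stabilizable if $\|K(\Theta)\|\le\kappa$ and $A+BK(\Theta)=HLH^{-1}$ with $H\succ0$, $\|L\|\le1-\gamma$,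 $\|H\|\|H^{-1}\|\le\kappa$. Let $\mathcal S$ be a measurable set of $(\kappa,\gamma)$-stabilizable $\Theta$ with $\|\Theta\|_F\le S$, and suppose that $\Theta_*$ is an interior point of $\mathcal S$. **Algorithm (TSAC), horizon $T$.** Let $\mu=\mu_T$ be a regularizer that is bounded below by a positive constant and is $O(\log T)$. Put $V_t=\mu I+\sum_{s<t}z_sz_s^\top$, $\hat\Theta_t=V_t^{-1}\sum_{s<t}z_sx_{s+1}^\top$, $\beta_t=\sigma_w\sqrt{2n\log\frac{\det(V_t)^{1/2}}{\delta\det(\mu I)^{1/2}}}+\sqrt\mu S$. Let $\mathcal F_t^{\rm cnt}=\sigma(\mathcal F_{t-1},x_t)$. At every time $t$, given $\mathcal F_t^{\rm cnt}$, a parameter $\tilde\Theta_t$ is drawn from the law of $\hat\Theta_t+\beta_tV_t^{-1/2}\eta$ ($\eta$ with i.i.d. standard normal entries) conditioned on lying in $\mathcal S$ (rejection sampling); those drawn at multiples of $\tau_0=\lceil2\gamma^{-1}\log(2\kappa\sqrt2)\rceil$ are deployed for $\tau_0$ steps. With $\tilde\Theta$ the deployed parameter, $u_t=K(\tilde\Theta)x_t+\nu_t$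 with fresh $\nu_t\sim\mathcal N(0,2\kappa^2\sigma_w^2I)$ for $t\le T_w$, and $u_t=K(\tilde\Theta)x_t$ for $t>T_w$. **Events.** Let $T_r=T_w+(n+d)\tau_0\log(n+d)$, $X_s=\frac{(12\kappa^2+2\kappa\sqrt2)\sigma_w}{\gamma}\sqrt{2n\log(n(T-T_w)/\delta)}$ and $\|M\|_V=\sqrt{\operatorname{tr}(M^\top VM)}$. Let $\hat E_t=\{\forall s\le t:\|\Theta_*-\hat\Theta_s\|_{V_s}\le\beta_s\}$, $\tilde E_t=\{\forall s\le t:\|\tilde\Theta_s-\hat\Theta_s\|_{V_s}\le\rho_T\beta_s\}$, $\bar E_T=\{\|x_t\|\le c'_T(n+d)^{n+d}\ \forall t\le T,\ t\le T_r;\ \|x_t\|\le X_s\ \forall T_r<t\le T\}$ and $E_T=\hat E_T\cap\tilde E_T\cap\bar E_T$, where $\rho_T$ is an arbitrary sequence (for instance the constant $n\sqrt{(n+d)\log(n(n+d)/\delta)}$) and $c'_T=O(T^a)$ for every $a>0$ (for instance a constant). Let $G_T$ be the event that the exploration is typical: $\|\nu_t\|\le\kappa\sigma_w\sqrt{8d\log(dT_w/\delta)}$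 for all $t\le T_w$, and $V_t\succeq(\mu+T_w\sigma_w^2/80)I$ for all $T_w<t\le T$. **Theorem (optimistic probability).** Let $A_{c,*}=A_*+B_*K(\Theta_*)$, let $Q(1)=\Pr\{\mathcal N(0,1)>1\}$, and $$\mathcal S^{\rm opt}=\{\Theta\in\mathbb R^{(n+d)\times n}: J(\Theta)\le J(\Theta_*)\},\qquad p_t^{\rm opt}=\Pr\{\tilde\Theta_t\in\mathcal S^{\rm opt}\mid\mathcal F_t^{\rm cnt},\hat E_t\}.$$ Suppose that $A_{c,*}\ne0$ and that $T_w=cn^2(\sqrt T\log T)^{1+o(1)}$ for a constant $c>0$, where the $o(1)$ is such that $T_w=\omega(\sqrt T\log T)$. Then there are deterministic sequences $\varepsilon_T\to0$ and $\eta_T\to0$, the same for all runs of the algorithm, such that for all large enough $T$: $\Pr(E_T\setminus G_T)\le\eta_T$, and almost surely on $E_T\cap G_T$, $$p_t^{\rm opt}\ \ge\ \frac{Q(1)}{1+\varepsilon_T}\qquad\text{for all } T_r<t\le T.$$ Furthermore, if $A_{c,*}$ is non-singular, the same holds when $T_w=c(\log T)^{1+o(1)}$ for a constant $c>0$, where the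 $o(1)$ is such that $T_w=\omega(\log T)$. -/

import Mathlib

open MeasureTheory ProbabilityTheory Filter Topology Asymptotics Matrix

universe u

noncomputable section

namespace TSAC

/-- The product (equivalently Borel) sigma-algebra on real matrices. -/
instance instMeasurableSpaceMatrix {p q : Type*} : MeasurableSpace (Matrix p q ℝ) :=
  inferInstanceAs (MeasurableSpace (p → q → ℝ))

/-- Euclidean norm of a vector. -/
def euclNorm {k : Type*} [Fintype k] (v : k → ℝ) : ℝ := √(v ⬝ᵥ v)

open scoped Matrix.Norms.L2Operator in
/-- Spectral norm of a matrix. -/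
def specNorm {p q : Type*} [Fintype p] [Fintype q] [DecidableEq q] (M : Matrix p q ℝ) : ℝ := ‖M‖

/-- Frobenius norm of a matrix. -/
def frobNorm {p q : Type*} [Fintype p] [Fintype q] (M : Matrix p q ℝ) : ℝ := √(Mᵀ * M).trace

/-- The weighted norm `‖M‖_V = ‖V^{1/2} M‖_F`, written as the root of `tr (Mᵀ V M)`. -/
def weightedNorm {p q : Type*} [Fintype p] [Fintype q] (V : Matrix p p ℝ) (M : Matrix p q ℝ) : ℝ :=
  √(Mᵀ * V * M).trace

open scoped MatrixOrder Matrix.Norms.L2Operator in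
/-- `V^{-1/2}` for a positive definite matrix `V`. -/
def invSqrt {p : Type*} [Fintype p] [DecidableEq p] (V : Matrix p p ℝ) : Matrix p p ℝ :=
  CFC.sqrt V⁻¹

/-- The centred Gaussian law with covariance `s ^ 2 I` on vectors of length `k`. -/
def isoGaussian (k : ℕ) (s : ℝ) : Measure (Fin k → ℝ) :=
  Measure.pi fun _ => gaussianReal 0 (s ^ 2).toNNReal

/-- The law of a matrix with independent standard normal entries. -/
def stdGaussianMatrix (p q : Type*) [Fintype p] [Fintype q] : Measure (Matrix p q ℝ) :=
  (Measure.pi fun _ : p => Measure.pi fun _ : q => gaussianReal 0 1 : Measure (p → q → ℝ))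

/-- The Gaussian `Q`-function `Q(x) = Pr (N(0,1) > x)`. -/
def gaussianQ (x : ℝ) : ℝ := (gaussianReal 0 1).real (Set.Ioi x)

/-- Given the sigma-algebra `m`, the random element `X` has conditional law `κ ω`. -/
def HasCondLaw {Ω E : Type*} (m : MeasurableSpace Ω) [mΩ : MeasurableSpace Ω] [MeasurableSpace E]
    (X : Ω → E) (κ : Ω → Measure E) (pr : Measure Ω) : Prop :=
  Measurable[mΩ] X ∧ ∀ B : Set E, MeasurableSet B →
    condExp m pr (Set.indicator (X ⁻¹' B) fun _ => (1 : ℝ)) =ᵐ[pr] fun ω => (κ ω).real B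

/-- A parameter `Θ`, with `Θᵀ = [A B]`, of a system with state dimension `n` and input
dimension `d`. -/
abbrev Param (n d : ℕ) : Type := Matrix (Fin n ⊕ Fin d) (Fin n) ℝ

/-- The data of an adaptive linear-quadratic control problem. -/
structure Setting (n d : ℕ) where
  /-- state cost -/
  Q : Matrix (Fin n) (Fin n) ℝ
  /-- input cost -/
  R : Matrix (Fin d) (Fin d) ℝ
  /-- standard deviation of the process noise -/
  σ : ℝ
  /-- stabilizability constants -/
  κ : ℝ
  γ : ℝ
  /-- bound on the Frobenius norm of the parameters -/
  S : ℝ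
  /-- the set in which the unknown parameter is known to lie -/
  params : Set (Param n d)
  /-- the true parameter -/
  Θs : Param n d
  /-- confidence level -/
  δ : ℝ

namespace Setting

variable {n d : ℕ} (P : Setting n d)

/-- The block `A` of `Θᵀ = [A B]`. -/
def matA (Θ : Param n d) : Matrix (Fin n) (Fin n) ℝ := Θ.toRows₁ᵀ

/-- The block `B` of `Θᵀ = [A B]`. -/
def matB (Θ : Param n d) : Matrix (Fin n) (Fin d) ℝ := Θ.toRows₂ᵀ

/-- `X` is a positive definite solution of the discrete algebraic Riccati equation of `Θ`. -/
def IsDARESol (Θ : Param n d) (X : Matrix (Fin n) (Fin n) ℝ) : Prop :=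
  X.PosDef ∧
    X = (matA Θ)ᵀ * X * matA Θ + P.Q -
      (matA Θ)ᵀ * X * matB Θ * (P.R + (matB Θ)ᵀ * X * matB Θ)⁻¹ * ((matB Θ)ᵀ * X * matA Θ)

open Classical in
/-- `P(Θ)`, the positive definite solution of the Riccati equation (`0` if there is none). -/
def riccati (Θ : Param n d) : Matrix (Fin n) (Fin n) ℝ :=
  if h : ∃ X, P.IsDARESol Θ X then h.choose else 0

/-- The optimal controller `K(Θ)`. -/
def gain (Θ : Param n d) : Matrix (Fin d) (Fin n) ℝ :=
  -((P.R + (matB Θ)ᵀ * P.riccati Θ * matB Θ)⁻¹ * ((matB Θ)ᵀ * P.riccati Θ * matA Θ))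

open Classical in
/-- The optimal average expected cost `J(Θ) = σ² tr P(Θ)`; it is infinite if the Riccati
equation has no positive definite solution, i.e. if `Θ` is not stabilizable. -/
def cost (Θ : Param n d) : ENNReal :=
  if ∃ X, P.IsDARESol Θ X then ENNReal.ofReal (P.σ ^ 2 * (P.riccati Θ).trace) else ⊤

/-- The optimistic set. -/
def optimisticSet : Set (Param n d) := {Θ | P.cost Θ ≤ P.cost P.Θs}

/-- `Θ` is `(κ, γ)`-stabilizable (by its optimal controller). -/
def IsStabilizable (Θ : Param n d) : Prop :=
  specNorm (P.gain Θ) ≤ P.κ ∧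
    ∃ L H : Matrix (Fin n) (Fin n) ℝ, H.PosDef ∧
      matA Θ + matB Θ * P.gain Θ = H * L * H⁻¹ ∧
      specNorm L ≤ 1 - P.γ ∧ specNorm H * specNorm H⁻¹ ≤ P.κ

/-- The closed-loop matrix `A_* + B_* K(Θ_*)` of the optimally controlled true system. -/
def closedLoop : Matrix (Fin n) (Fin n) ℝ := matA P.Θs + matB P.Θs * P.gain P.Θs

/-- The standing assumptions on the problem. -/
structure Standing : Prop where
  Q_posDef : P.Q.PosDef
  R_posDef : P.R.PosDef
  σ_pos : 0 < P.σ
  one_le_κ : 1 ≤ P.κ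
  γ_pos : 0 < P.γ
  γ_le_one : P.γ ≤ 1
  δ_pos : 0 < P.δ
  δ_lt_one : P.δ < 1
  measurableSet_params : MeasurableSet P.params
  params_subset : P.params ⊆ {Θ | P.IsStabilizable Θ ∧ frobNorm Θ ≤ P.S}
  mem_interior : P.Θs ∈ interior P.params

/-- Number of steps for which a sampled policy is kept. -/
def τ₀ : ℕ := ⌈2 * P.γ⁻¹ * Real.log (2 * P.κ * √2)⌉₊

/-- The end `T_r` of the settling period after an exploration phase of length `Tw`. -/
def Tr (Tw : ℝ) : ℝ := Tw + ((n : ℝ) + d) * P.τ₀ * Real.log ((n : ℝ) + d)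

/-- The state bound `X_s` after the settling period, for horizon `T`. -/
def Xs (Tw : ℝ) (T : ℕ) : ℝ :=
  (12 * P.κ ^ 2 + 2 * P.κ * √2) / P.γ * P.σ * √(2 * n * Real.log (n * (T - Tw) / P.δ))

end Setting

section Learning

variable {n d : ℕ}

/-- The regressor `z = (x, u)`. -/
def regressor (x : Fin n → ℝ) (a : Fin d → ℝ) : Fin n ⊕ Fin d → ℝ := Sum.elim x a

/-- `V_t = reg I + ∑_{s<t} z_s z_sᵀ`. -/
def design (reg : ℝ) (x : ℕ → Fin n → ℝ) (a : ℕ → Fin d → ℝ) (t : ℕ) :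
    Matrix (Fin n ⊕ Fin d) (Fin n ⊕ Fin d) ℝ :=
  reg • 1 + ∑ s ∈ Finset.range t,
    Matrix.vecMulVec (regressor (x s) (a s)) (regressor (x s) (a s))

/-- The regularized least squares estimate `V_t⁻¹ ∑_{s<t} z_s x_{s+1}ᵀ`. -/
def rls (reg : ℝ) (x : ℕ → Fin n → ℝ) (a : ℕ → Fin d → ℝ) (t : ℕ) : Param n d :=
  (design reg x a t)⁻¹ * ∑ s ∈ Finset.range t,
    Matrix.vecMulVec (regressor (x s) (a s)) (x (s + 1))

/-- The radius `β_t(δ)` of the confidence ellipsoid, as a function of `V = V_t`. -/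
def radius (P : Setting n d) (reg : ℝ) (V : Matrix (Fin n ⊕ Fin d) (Fin n ⊕ Fin d) ℝ) : ℝ :=
  P.σ * √(2 * n * Real.log (√V.det /
      (P.δ * √(reg • (1 : Matrix (Fin n ⊕ Fin d) (Fin n ⊕ Fin d) ℝ)).det))) + √reg * P.S

/-- The law of `Θhat + b V^{-1/2} η` conditioned on lying in the parameter set, where `η` has
independent standard normal entries: this is the law of the output of rejection sampling. -/
def samplingLaw (P : Setting n d) (Θhat : Param n d) (b : ℝ)
    (V : Matrix (Fin n ⊕ Fin d) (Fin n ⊕ Fin d) ℝ) : Measure (Param n d) :=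
  ProbabilityTheory.cond
    ((stdGaussianMatrix (Fin n ⊕ Fin d) (Fin n)).map fun η => Θhat + b • (invSqrt V * η))
    P.params

end Learning

/-- The information `σ(F_{t-1}, x_t)` of the controller at time `t`. -/
abbrev controllerInfo {Ω : Type u} {n : ℕ} [mΩ : MeasurableSpace Ω] (F : Filtration ℕ mΩ)
    (x : ℕ → Ω → Fin n → ℝ) (t : ℕ) : MeasurableSpace Ω :=
  (match t with
    | 0 => ⊥
    | s + 1 => F s) ⊔ MeasurableSpace.comap (x t) inferInstance

/-- A run of the algorithm with regularizer `reg` and exploration phase of length `Tw`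
on the probability space `(Ω, pr)`. At every time `t` a parameter `sample t` is drawn by Thompson
sampling; those drawn at the multiples of `τ₀` are deployed for `τ₀` steps. -/
structure Run {n d : ℕ} (P : Setting n d) (reg Tw : ℝ) (Ω : Type u) [mΩ : MeasurableSpace Ω]
    (pr : Measure Ω) where
  F : Filtration ℕ mΩ
  /-- state -/
  x : ℕ → Ω → Fin n → ℝ
  /-- input -/
  a : ℕ → Ω → Fin d → ℝ
  /-- process noise -/
  w : ℕ → Ω → Fin n → ℝ
  /-- exploration noise -/
  ν : ℕ → Ω → Fin d → ℝ
  sample : ℕ → Ω → Param n d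
  measurable_x : ∀ t, Measurable[F t] (x t)
  measurable_a : ∀ t, Measurable[F t] (a t)
  measurable_sample : ∀ t, Measurable[F t] (sample t)
  x_zero : ∀ ω, x 0 ω = 0
  x_succ : ∀ t ω, x (t + 1) ω = P.Θsᵀ *ᵥ regressor (x t ω) (a t ω) + w t ω
  a_explore : ∀ (t : ℕ) ω, (t : ℝ) ≤ Tw →
    a t ω = P.gain (sample (t / P.τ₀ * P.τ₀) ω) *ᵥ x t ω + ν t ω
  a_exploit : ∀ (t : ℕ) ω, Tw < (t : ℝ) → a t ω = P.gain (sample (t / P.τ₀ * P.τ₀) ω) *ᵥ x t ω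
  w_law : ∀ t, HasCondLaw (F t) (w t) (fun _ => isoGaussian n P.σ) pr
  sample_law : ∀ t, HasCondLaw (controllerInfo F x t) (sample t)
    (fun ω =>
      let V := design reg (fun s => x s ω) (fun s => a s ω) t
      samplingLaw P (rls reg (fun s => x s ω) (fun s => a s ω) t) (radius P reg V) V) pr
  ν_law : ∀ t, HasCondLaw
    (controllerInfo F x t ⊔ MeasurableSpace.comap (sample t) inferInstance) (ν t)
    (fun _ => isoGaussian d (√2 * P.κ * P.σ)) pr

namespace Run

variable {n d : ℕ} {P : Setting n d} {reg Tw : ℝ} {Ω : Type u} [mΩ : MeasurableSpace Ω]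
  {pr : Measure Ω} (r : Run P reg Tw Ω pr)

/-- `V_t` along the run. -/
def V (t : ℕ) (ω : Ω) : Matrix (Fin n ⊕ Fin d) (Fin n ⊕ Fin d) ℝ :=
  design reg (fun s => r.x s ω) (fun s => r.a s ω) t

/-- The least squares estimate along the run. -/
def Θhat (t : ℕ) (ω : Ω) : Param n d := rls reg (fun s => r.x s ω) (fun s => r.a s ω) t

/-- `β_t(δ)` along the run. -/
def β (t : ℕ) (ω : Ω) : ℝ := radius P reg (r.V t ω)

/-- The true parameter lies in all confidence ellipsoids up to time `t`. -/
def estimationEvent (t : ℕ) : Set Ω :=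
  {ω | ∀ s ≤ t, weightedNorm (r.V s ω) (P.Θs - r.Θhat s ω) ≤ r.β s ω}

/-- All samples up to time `t` lie in the sampling ellipsoids of radius `ρ β_s(δ)`. -/
def samplingEvent (ρ : ℝ) (t : ℕ) : Set Ω :=
  {ω | ∀ s ≤ t, weightedNorm (r.V s ω) (r.sample s ω - r.Θhat s ω) ≤ ρ * r.β s ω}

/-- The state is bounded by `c (n + d) ^ (n + d)` up to `T_r`, and by `X_s` from then on. -/
def stateEvent (c : ℝ) (T : ℕ) : Set Ω :=
  {ω | ∀ s ≤ T,
    ((s : ℝ) ≤ P.Tr Tw → euclNorm (r.x s ω) ≤ c * ((n : ℝ) + d) ^ (n + d)) ∧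
    (P.Tr Tw < (s : ℝ) → euclNorm (r.x s ω) ≤ P.Xs Tw T)}

/-- The good event `E_T`. -/
def goodEvent (ρ c : ℝ) (T : ℕ) : Set Ω :=
  r.estimationEvent T ∩ r.samplingEvent ρ T ∩ r.stateEvent c T

/-- The exploration is typical: the exploration noise is bounded and the design matrix is
well conditioned from below after the exploration phase. -/
def explorationEvent (T : ℕ) : Set Ω :=
  {ω | (∀ s : ℕ, (s : ℝ) ≤ Tw →
      euclNorm (r.ν s ω) ≤ P.κ * P.σ * √(8 * d * Real.log (d * Tw / P.δ))) ∧
    ∀ t ≤ T, Tw < (t : ℝ) →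
      (r.V t ω - (reg + Tw * P.σ ^ 2 / 80) •
        (1 : Matrix (Fin n ⊕ Fin d) (Fin n ⊕ Fin d) ℝ)).PosSemidef}

/-- The conditional probability, given the information of the controller at time `t` and the
event that the estimates are accurate up to time `t`, that the sampled parameter is optimistic. -/
def optimismProb (t : ℕ) : Ω → ℝ :=
  condExp (controllerInfo r.F r.x t) (ProbabilityTheory.cond pr (r.estimationEvent t))
    (Set.indicator (r.sample t ⁻¹' P.optimisticSet) fun _ => (1 : ℝ))

end Run

/-- For exploration lengths `Tw T`, regularizers `reg T`, sampling radii `ρ T` and state bounds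
`c T`, and uniformly over all runs of the algorithm: for large horizons `T`, the exploration is
typical on the good event up to a probability `η T = o(1)`, and on the good event with typical
exploration every sample drawn between `T_r` and `T` is optimistic with conditional probability
at least `Q(1) / (1 + ε T)`, with `ε T = o(1)`. -/
def OptimisticSampling {n d : ℕ} (P : Setting n d) (Tw reg ρ c : ℕ → ℝ) : Prop :=
  ∃ ε η : ℕ → ℝ, Tendsto ε atTop (𝓝 0) ∧ Tendsto η atTop (𝓝 0) ∧
    ∀ᶠ T : ℕ in atTop, ∀ (Ω : Type u) [MeasurableSpace Ω] (pr : Measure Ω) [IsProbabilityMeasure pr]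
      (r : Run P (reg T) (Tw T) Ω pr),
      pr (r.goodEvent (ρ T) (c T) T \ r.explorationEvent T) ≤ ENNReal.ofReal (η T) ∧
      ∀ᵐ ω ∂pr, ω ∈ r.goodEvent (ρ T) (c T) T ∩ r.explorationEvent T →
        ∀ t : ℕ, P.Tr (Tw T) < t → t ≤ T → gaussianQ 1 / (1 + ε T) ≤ r.optimismProb t ω

end TSAC

end

/-! Optimism near `P.Θs` is a half-space condition up to a quadratic error, and a Gaussian sample
centred inside the confidence ellipsoid satisfies a half-space condition with probability at least
about `Q(1)`.

Control side. Keep the feedback `K = P.gain P.Θs` for the parameter `P.Θs + D`. Its closed loop is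
`P.closedLoop + Dᵀ [I; K]`, and a supersolution `X + Y` of the perturbed Lyapunov inequality
dominates the Riccati solution at `P.Θs + D`, because the Riccati operator is a minimum over
feedbacks. The trace of `Y` is known to first order, so `P.Θs + D` is optimistic once `2 tr(Dᵀ [I;
K] M) + C ‖Dᵀ [I; K]‖² ≤ 0`, where `M = S A_cᵀ X`, `A_c` is the true closed loop, `X` its Riccati
solution and `S` its Gramian (`exists_optimism_criterion`). No derivative of the Riccati solution is
needed.

Sampling side. Write `D = V^{-1/2} (ξ + β η)`. The estimate is accurate, so `‖ξ‖ ≤ β`, and the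
linear term is at most `β g (1 - N)` with `N` standard normal and `g = ‖V^{-1/2} [I; K] M‖`. If `N >
1 + e`, the gain `β g e` has to pay for a quadratic error of order `β² h²`, `h = ‖V^{-1/2} [I; K]‖`
(`exists_samplingLaw_ge`). With `l ≤ V ≤ u` one has `h² ≲ 1/l` and `g ≳ 1/√u`, so it suffices that
`β √u ≪ l`. On the good event `β ~ √(log T)`, `u ~ T log T` and `l ~ T_w`, whence the condition `√T
log T ≪ T_w`. If the closed loop is invertible, so is `M`; then `h ≲ g`, and `β ≪ √l`, that is `log
T ≪ T_w`, is enough.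

Excitation. The lower bound on `V` comes from the Laplace transform of `∑ (v ⬝ z_i)²`: integrating
out both noises gives a factor below one at every step at which the deployed policy was drawn
earlier (`lintegral_exp_sum_le`). Markov's inequality and a union bound over a grid of directions
make the bound uniform (`measure_goodEvent_diff_le`). All bounds depend only on the horizon and the
constants, hence are the same for all runs. -/

set_option linter.unusedSectionVars false

noncomputable section

namespace TSAC

/-! ### Riccati operator: comparison, uniqueness and existence below a supersolution. -/

section Riccati

open scoped MatrixOrder

variable {m k : Type*} [Fintype m] [DecidableEq m] [Fintype k] [DecidableEq k]

/-- One step of the value recursion under the linear feedback `K`. -/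
def lqCost (A : Matrix m m ℝ) (B : Matrix m k ℝ) (Q : Matrix m m ℝ) (R : Matrix k k ℝ)
    (K : Matrix k m ℝ) (X : Matrix m m ℝ) : Matrix m m ℝ :=
  Q + Kᵀ * R * K + (A + B * K)ᵀ * X * (A + B * K)

/-- The Riccati operator. -/
def ricOp (A : Matrix m m ℝ) (B : Matrix m k ℝ) (Q : Matrix m m ℝ) (R : Matrix k k ℝ)
    (X : Matrix m m ℝ) : Matrix m m ℝ :=
  Aᵀ * X * A + Q - Aᵀ * X * B * (R + Bᵀ * X * B)⁻¹ * (Bᵀ * X * A)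

/-- The greedy feedback for the value matrix `X`. -/
def ricGain (A : Matrix m m ℝ) (B : Matrix m k ℝ) (R : Matrix k k ℝ)
    (X : Matrix m m ℝ) : Matrix k m ℝ :=
  -((R + Bᵀ * X * B)⁻¹ * (Bᵀ * X * A))

variable {A : Matrix m m ℝ} {B : Matrix m k ℝ} {Q : Matrix m m ℝ} {R : Matrix k k ℝ}
  {X Y : Matrix m m ℝ}

lemma PosSemidef.transpose_eq (hX : X.PosSemidef) : Xᵀ = X := by
  simpa using hX.isHermitian.eq

lemma PosSemidef.congr_transpose {j : Type*} [Fintype j] (hX : X.PosSemidef) (M : Matrix m j ℝ) :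
    (Mᵀ * X * M).PosSemidef := by
  simpa using hX.conjTranspose_mul_mul_same M

lemma transpose_mul_mul_mono {j : Type*} [Fintype j] (h : X ≤ Y) (M : Matrix m j ℝ) :
    Mᵀ * X * M ≤ Mᵀ * Y * M := by
  rw [Matrix.le_iff] at h ⊢
  have := PosSemidef.congr_transpose h M
  rwa [Matrix.mul_sub, Matrix.sub_mul] at this

lemma posDef_inputWeight (hR : R.PosDef) (hX : X.PosSemidef) : (R + Bᵀ * X * B).PosDef :=
  hR.add_posSemidef (PosSemidef.congr_transpose hX B)

/-- Completion of the square in the feedback. It exhibits the Riccati operator as the minimum of the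
policy costs, attained at the greedy gain; all order properties below follow from this. -/
lemma lqCost_eq_ricOp_add (hR : R.PosDef) (hX : X.PosSemidef) (K : Matrix k m ℝ) :
    lqCost A B Q R K X = ricOp A B Q R X +
      (K - ricGain A B R X)ᵀ * (R + Bᵀ * X * B) * (K - ricGain A B R X) := by
  have hS := posDef_inputWeight (B := B) hR hX
  have hXt := PosSemidef.transpose_eq hX
  have hSt := PosSemidef.transpose_eq hS.posSemidef
  have hu : IsUnit (R + Bᵀ * X * B).det := (Matrix.isUnit_iff_isUnit_det _).1 hS.isUnit
  unfold lqCost ricOp ricGain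
  generalize hSdef : R + Bᵀ * X * B = S at *
  have hR' : R = S - Bᵀ * X * B := by rw [← hSdef]; abel
  have h1 : S * S⁻¹ = 1 := Matrix.mul_nonsing_inv _ hu
  have h2 : S⁻¹ * S = 1 := Matrix.nonsing_inv_mul _ hu
  have hSi : (S⁻¹)ᵀ = S⁻¹ := by rw [Matrix.transpose_nonsing_inv, hSt]
  have e1 : (K - -(S⁻¹ * (Bᵀ * X * A)))ᵀ = Kᵀ + Aᵀ * X * B * S⁻¹ := by
    simp [Matrix.transpose_mul, hXt, hSi, Matrix.mul_assoc]
  have e2 : S * (K - -(S⁻¹ * (Bᵀ * X * A))) = S * K + Bᵀ * X * A := by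
    rw [sub_neg_eq_add, Matrix.mul_add, ← Matrix.mul_assoc S, h1, Matrix.one_mul]
  rw [Matrix.mul_assoc _ S, e2, e1, hR']
  have e3 : Aᵀ * X * B * S⁻¹ * (S * K) = Aᵀ * X * B * K := by
    rw [Matrix.mul_assoc _ S⁻¹, ← Matrix.mul_assoc S⁻¹, h2, Matrix.one_mul]
  simp only [Matrix.add_mul, Matrix.mul_add, e3, Matrix.transpose_add, Matrix.transpose_mul,
    Matrix.sub_mul, Matrix.mul_sub]
  simp only [Matrix.mul_assoc]
  abel

lemma ricOp_le_lqCost (hR : R.PosDef) (hX : X.PosSemidef) (K : Matrix k m ℝ) :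
    ricOp A B Q R X ≤ lqCost A B Q R K X := by
  rw [lqCost_eq_ricOp_add hR hX, Matrix.le_iff, add_sub_cancel_left]
  exact PosSemidef.congr_transpose (posDef_inputWeight hR hX).posSemidef _

lemma ricOp_eq_lqCost (hR : R.PosDef) (hX : X.PosSemidef) :
    ricOp A B Q R X = lqCost A B Q R (ricGain A B R X) X := by
  rw [lqCost_eq_ricOp_add hR hX]; simp

lemma lqCost_mono (h : X ≤ Y) (K : Matrix k m ℝ) :
    lqCost A B Q R K X ≤ lqCost A B Q R K Y := by
  unfold lqCost
  gcongr
  exact transpose_mul_mul_mono h _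

lemma ricOp_mono (hR : R.PosDef) (hX : X.PosSemidef) (h : X ≤ Y) :
    ricOp A B Q R X ≤ ricOp A B Q R Y := by
  have hY : Y.PosSemidef := by
    rw [← Matrix.nonneg_iff_posSemidef] at hX ⊢; exact hX.trans h
  rw [ricOp_eq_lqCost hR hY]
  exact (ricOp_le_lqCost hR hX _).trans (lqCost_mono h _)

/-- This bound replaces positive definiteness, an open condition, by the closed condition `Q ≤ X` in
the limit and compactness arguments. -/
lemma le_ricOp (hR : R.PosDef) (hX : X.PosSemidef) : Q ≤ ricOp A B Q R X := by
  rw [ricOp_eq_lqCost hR hX, lqCost, Matrix.le_iff, add_assoc, add_sub_cancel_left]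
  exact (PosSemidef.congr_transpose hR.posSemidef _).add (PosSemidef.congr_transpose hX _)

lemma posDef_of_le (hX : X.PosDef) (h : X ≤ Y) : Y.PosDef := by
  have := hX.add_posSemidef (Matrix.le_iff.1 h)
  simpa using this

lemma exists_smul_one_le_of_posDef (hX : X.PosDef) :
    ∃ c : ℝ, 0 < c ∧ c • (1 : Matrix m m ℝ) ≤ X := by
  rcases isEmpty_or_nonempty m with hm | hm
  · exact ⟨1, one_pos, (Subsingleton.elim _ _).le⟩
  have := (CFC.exists_pos_algebraMap_le_iff (A := Matrix m m ℝ) (a := X)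
    hX.isHermitian).2 (fun x hx => ?_)
  · obtain ⟨r, hr, h⟩ := this
    exact ⟨r, hr, by rwa [Algebra.algebraMap_eq_smul_one] at h⟩
  · rw [hX.isHermitian.spectrum_real_eq_range_eigenvalues] at hx
    obtain ⟨i, rfl⟩ := hx
    exact hX.eigenvalues_pos i

lemma le_trace_smul_one (hX : X.PosSemidef) : X ≤ X.trace • (1 : Matrix m m ℝ) := by
  have h := (le_algebraMap_iff_spectrum_le (R := ℝ) (A := Matrix m m ℝ) (a := X) (r := X.trace)
    hX.isHermitian).2 (fun x hx => ?_)
  · rwa [Algebra.algebraMap_eq_smul_one] at h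
  · rw [hX.isHermitian.spectrum_real_eq_range_eigenvalues] at hx
    obtain ⟨i, rfl⟩ := hx
    rw [hX.isHermitian.trace_eq_sum_eigenvalues]
    exact Finset.single_le_sum (f := fun i => hX.isHermitian.eigenvalues i)
      (fun j _ => hX.eigenvalues_nonneg j) (Finset.mem_univ i)

lemma smul_le_smul_matrix {c : ℝ} (hc : 0 ≤ c) (h : X ≤ Y) : c • X ≤ c • Y := by
  rw [Matrix.le_iff] at h ⊢
  rw [← smul_sub]
  exact h.smul hc

lemma smul_le_smul_matrix_right {c d : ℝ} (h : c ≤ d) (hX : X.PosSemidef) : c • X ≤ d • X := by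
  rw [Matrix.le_iff, ← sub_smul]
  exact hX.smul (sub_nonneg.2 h)

/-- A positive definite matrix dominates a multiple of any positive semidefinite one. -/
lemma exists_le_smul_of_posDef (hX : X.PosSemidef) (hY : Y.PosDef) :
    ∃ c : ℝ, 0 < c ∧ X ≤ c • Y := by
  obtain ⟨r, hr, h⟩ := exists_smul_one_le_of_posDef hY
  have ht : 0 ≤ X.trace := hX.trace_nonneg
  refine ⟨(X.trace + 1) / r, by positivity, (le_trace_smul_one hX).trans ?_⟩
  calc X.trace • (1 : Matrix m m ℝ) ≤ (X.trace + 1) • 1 :=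
        smul_le_smul_matrix_right (by linarith) PosSemidef.one
    _ = ((X.trace + 1) / r) • (r • (1 : Matrix m m ℝ)) := by
        rw [smul_smul]; congr 1; field_simp
    _ ≤ _ := smul_le_smul_matrix (by positivity) h

lemma dotProduct_mulVec_mono (h : X ≤ Y) (v : m → ℝ) : v ⬝ᵥ X *ᵥ v ≤ v ⬝ᵥ Y *ᵥ v := by
  have := (Matrix.le_iff.1 h).dotProduct_mulVec_nonneg v
  rw [Matrix.sub_mulVec, dotProduct_sub] at this
  simpa using this

lemma le_of_dotProduct_mulVec (hX : Xᵀ = X) (hY : Yᵀ = Y)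
    (h : ∀ v : m → ℝ, v ⬝ᵥ X *ᵥ v ≤ v ⬝ᵥ Y *ᵥ v) : X ≤ Y := by
  rw [Matrix.le_iff]
  refine PosSemidef.of_dotProduct_mulVec_nonneg ?_ fun v => ?_
  · simp [Matrix.IsHermitian, Matrix.conjTranspose_eq_transpose_of_trivial, hX, hY]
  · have := h v
    rw [Matrix.sub_mulVec, dotProduct_sub]
    simpa using this

lemma transpose_pow_mul_mul_pow_le {F : Matrix m m ℝ} {r : ℝ} (hr : 0 ≤ r)
    (h : Fᵀ * Y * F ≤ r • Y) (N : ℕ) : (F ^ N)ᵀ * Y * F ^ N ≤ r ^ N • Y := by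
  induction N with
  | zero => simp
  | succ N ih =>
    have e : (F ^ (N + 1))ᵀ * Y * F ^ (N + 1) = (F ^ N)ᵀ * (Fᵀ * Y * F) * F ^ N := by
      rw [pow_succ', Matrix.transpose_mul]; simp only [Matrix.mul_assoc]
    rw [e]
    refine (transpose_mul_mul_mono h _).trans ?_
    rw [Matrix.mul_smul, Matrix.smul_mul, pow_succ', mul_smul]
    exact smul_le_smul_matrix hr ih

/-- The closed loop of a positive definite solution of the Riccati equation is a contraction
in the corresponding quadratic form. -/
lemma exists_contraction (hQ : Q.PosDef) (hR : R.PosDef) (hY : Y.PosDef)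
    (hfix : Y = ricOp A B Q R Y) :
    ∃ r : ℝ, 0 ≤ r ∧ r < 1 ∧
      (A + B * ricGain A B R Y)ᵀ * Y * (A + B * ricGain A B R Y) ≤ r • Y := by
  obtain ⟨c, hc, hYQ⟩ := exists_le_smul_of_posDef hY.posSemidef hQ
  set F := A + B * ricGain A B R Y with hF
  set K := ricGain A B R Y with hK
  have e : Y = Q + Kᵀ * R * K + Fᵀ * Y * F := by
    conv_lhs => rw [hfix, ricOp_eq_lqCost hR hY.posSemidef, lqCost]
  have h1 : Fᵀ * Y * F ≤ Y - Q := by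
    have : Y - Q = Fᵀ * Y * F + Kᵀ * R * K := by
      nth_rewrite 1 [e]; abel
    rw [this]
    exact le_add_of_nonneg_right (PosSemidef.congr_transpose hR.posSemidef _).nonneg
  -- The maximum with `1` keeps the contraction rate `1 - (max 1 c)⁻¹` nonnegative.
  have hQ' : (max 1 c)⁻¹ • Y ≤ Q := by
    have hm : 0 < max 1 c := by positivity
    calc (max 1 c)⁻¹ • Y ≤ (max 1 c)⁻¹ • (max 1 c • Q) :=
          smul_le_smul_matrix (by positivity)
            (hYQ.trans (smul_le_smul_matrix_right (le_max_right _ _) hQ.posSemidef))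
      _ = Q := by rw [smul_smul, inv_mul_cancel₀ hm.ne', one_smul]
  have hm1 : (max 1 c)⁻¹ ≤ 1 := inv_le_one_of_one_le₀ (le_max_left _ _)
  refine ⟨1 - (max 1 c)⁻¹, by linarith, by
    have : 0 < (max 1 c)⁻¹ := by positivity
    linarith, h1.trans ?_⟩
  rw [sub_smul, one_smul]
  exact sub_le_sub_left hQ' _

/-- The gain of `Y` is suboptimal for `X`, so `X - Y ≤ Fᵀ (X - Y) F` with `F` the closed loop of
`Y`. Iterating, the right side is dominated by a geometrically small multiple of `Y`. -/
lemma riccati_le (hQ : Q.PosDef) (hR : R.PosDef) (hX : X.PosDef) (hY : Y.PosDef)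
    (hXfix : X = ricOp A B Q R X) (hYfix : Y = ricOp A B Q R Y) : X ≤ Y := by
  obtain ⟨r, hr0, hr1, hc⟩ := exists_contraction hQ hR hY hYfix
  obtain ⟨c, hc0, hXY⟩ := exists_le_smul_of_posDef hX.posSemidef hY
  set K := ricGain A B R Y with hK
  set F := A + B * K with hF
  have hstep : X - Y ≤ Fᵀ * (X - Y) * F := by
    have h1 : X ≤ lqCost A B Q R K X := by
      nth_rewrite 1 [hXfix]; exact ricOp_le_lqCost hR hX.posSemidef K
    have h2 : Y = lqCost A B Q R K Y := by
      nth_rewrite 1 [hYfix]; exact ricOp_eq_lqCost hR hY.posSemidef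
    have h3 : Fᵀ * (X - Y) * F = lqCost A B Q R K X - lqCost A B Q R K Y := by
      simp only [lqCost, ← hF, Matrix.mul_sub, Matrix.sub_mul]; abel
    rw [h3, ← h2]
    exact sub_le_sub_right h1 _
  have hiter : ∀ N : ℕ, X - Y ≤ (F ^ N)ᵀ * (X - Y) * F ^ N := by
    intro N
    induction N with
    | zero => simp
    | succ N ih =>
      refine ih.trans ?_
      have e : (F ^ (N + 1))ᵀ * (X - Y) * F ^ (N + 1) =
          (F ^ N)ᵀ * (Fᵀ * (X - Y) * F) * F ^ N := by
        rw [pow_succ', Matrix.transpose_mul]; simp only [Matrix.mul_assoc]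
      rw [e]
      exact transpose_mul_mul_mono hstep _
  have hbound : ∀ N : ℕ, X - Y ≤ (c * r ^ N) • Y := by
    intro N
    calc X - Y ≤ (F ^ N)ᵀ * (X - Y) * F ^ N := hiter N
      _ ≤ (F ^ N)ᵀ * (c • Y) * F ^ N := by
          refine transpose_mul_mul_mono (le_trans ?_ hXY) _
          exact sub_le_self _ hY.posSemidef.nonneg
      _ = c • ((F ^ N)ᵀ * Y * F ^ N) := by rw [Matrix.mul_smul, Matrix.smul_mul]
      _ ≤ c • (r ^ N • Y) :=
          smul_le_smul_matrix hc0.le (transpose_pow_mul_mul_pow_le hr0 hc N)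
      _ = _ := by rw [smul_smul]
  refine le_of_dotProduct_mulVec (PosSemidef.transpose_eq hX.posSemidef)
    (PosSemidef.transpose_eq hY.posSemidef) fun v => ?_
  have hlim : Tendsto (fun N : ℕ => v ⬝ᵥ Y *ᵥ v + (c * r ^ N) * (v ⬝ᵥ Y *ᵥ v)) atTop
      (𝓝 (v ⬝ᵥ Y *ᵥ v + (c * 0) * (v ⬝ᵥ Y *ᵥ v))) :=
    ((tendsto_pow_atTop_nhds_zero_of_lt_one hr0 hr1).const_mul c).mul_const _ |>.const_add _
  simp only [mul_zero, zero_mul, add_zero] at hlim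
  refine ge_of_tendsto' hlim fun N => ?_
  have := dotProduct_mulVec_mono (hbound N) v
  rw [Matrix.sub_mulVec, dotProduct_sub, Matrix.smul_mulVec, dotProduct_smul, smul_eq_mul] at this
  linarith

lemma riccati_unique (hQ : Q.PosDef) (hR : R.PosDef) (hX : X.PosDef) (hY : Y.PosDef)
    (hXfix : X = ricOp A B Q R X) (hYfix : Y = ricOp A B Q R Y) : X = Y :=
  le_antisymm (riccati_le hQ hR hX hY hXfix hYfix) (riccati_le hQ hR hY hX hYfix hXfix)

/-- Testing on `e_i ± e_j` gives `2 |X i j| ≤ X i i + X j j`. This makes trace-bounded sets of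
solutions relatively compact. -/
lemma abs_apply_le_trace (hX : X.PosSemidef) (i j : m) : |X i j| ≤ X.trace := by
  have hd : ∀ l, X l l ≤ X.trace := fun l =>
    Finset.single_le_sum (f := fun l => X l l) (fun l _ => hX.diag_nonneg) (Finset.mem_univ l)
  have hs : X j i = X i j := by
    have := congrFun (congrFun (PosSemidef.transpose_eq hX) i) j
    simpa using this
  have h1 := hX.dotProduct_mulVec_nonneg (Pi.single i 1 + Pi.single j 1)
  have h2 := hX.dotProduct_mulVec_nonneg (Pi.single i 1 - Pi.single j 1)
  simp [Matrix.mulVec_add, Matrix.mulVec_sub, add_dotProduct, sub_dotProduct, hs] at h1 h2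
  have := hd i
  have := hd j
  rw [abs_le]; constructor <;> linarith

lemma continuousAt_ricOp (hR : R.PosDef) (hX : X.PosSemidef) :
    ContinuousAt (ricOp A B Q R) X := by
  have hu := (posDef_inputWeight (B := B) hR hX).det_pos.ne'
  have h1 : ContinuousAt (fun X => (R + Bᵀ * X * B)⁻¹) X := by
    have : ContinuousAt (fun M : Matrix k k ℝ => M⁻¹) (R + Bᵀ * X * B) := by
      refine continuousAt_matrix_inv _ ?_
      simpa using NormedRing.inverse_continuousAt (Units.mk0 _ hu)
    exact ContinuousAt.comp (f := fun X => R + Bᵀ * X * B) this (by fun_prop)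
  unfold ricOp
  fun_prop

/-- Each quadratic form is monotone and bounded, hence convergent; polarization recovers the
entries. -/
lemma exists_tendsto_of_monotone {P : ℕ → Matrix m m ℝ} (hs : ∀ N, (P N)ᵀ = P N)
    (hmono : Monotone P) (hb : ∀ N, P N ≤ X) : ∃ L, Tendsto P atTop (𝓝 L) := by
  have hq : ∀ v : m → ℝ, ∃ l, Tendsto (fun N => v ⬝ᵥ P N *ᵥ v) atTop (𝓝 l) := fun v =>
    ⟨_, tendsto_atTop_ciSup (fun a b h => dotProduct_mulVec_mono (hmono h) v)
      ⟨v ⬝ᵥ X *ᵥ v, by rintro _ ⟨N, rfl⟩; exact dotProduct_mulVec_mono (hb N) v⟩⟩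
  choose l hl using hq
  refine ⟨Matrix.of fun i j =>
    (l (Pi.single i 1 + Pi.single j 1) - l (Pi.single i 1) - l (Pi.single j 1)) / 2, ?_⟩
  refine tendsto_pi_nhds.2 fun i => tendsto_pi_nhds.2 fun j => ?_
  refine Tendsto.congr (fun N => ?_) ((((hl (Pi.single i 1 + Pi.single j 1)).sub
    (hl (Pi.single i 1))).sub (hl (Pi.single j 1))).div_const 2)
  have hs' : P N j i = P N i j := by
    have := congrFun (congrFun (hs N) i) j
    simpa using this
  simp [Matrix.mulVec_add, add_dotProduct, hs']
  ring

/-- A supersolution of the Lyapunov equation of some feedback dominates a solution of the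
Riccati equation. -/
theorem exists_riccati_of_supersolution (hQ : Q.PosDef) (hR : R.PosDef) (hX : X.PosSemidef)
    (K : Matrix k m ℝ) (hsup : lqCost A B Q R K X ≤ X) :
    ∃ Y, Y.PosDef ∧ Y = ricOp A B Q R Y ∧ Y ≤ X := by
  -- Value iteration from zero increases and stays below the supersolution; its limit is the
  -- solution sought.
  set P : ℕ → Matrix m m ℝ := fun N => (ricOp A B Q R)^[N] 0 with hP
  have hsucc : ∀ N, P (N + 1) = ricOp A B Q R (P N) := fun N =>
    Function.iterate_succ_apply' _ _ _
  have hpsd : ∀ N, (P N).PosSemidef := by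
    intro N
    induction N with
    | zero => exact PosSemidef.zero
    | succ N ih =>
      rw [hsucc]
      exact (posDef_of_le hQ (le_ricOp hR ih)).posSemidef
  have hle : ∀ N, P N ≤ X := by
    intro N
    induction N with
    | zero => exact hX.nonneg
    | succ N ih =>
      rw [hsucc]
      exact (ricOp_le_lqCost hR (hpsd N) K).trans ((lqCost_mono ih K).trans hsup)
  have hmono : Monotone P := by
    refine monotone_nat_of_le_succ fun N => ?_
    induction N with
    | zero => exact (hpsd 1).nonneg
    | succ N ih =>
      rw [hsucc, hsucc]
      exact ricOp_mono hR (hpsd N) ih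
  obtain ⟨L, hL⟩ := exists_tendsto_of_monotone (fun N => PosSemidef.transpose_eq (hpsd N)) hmono hle
  have hLt : Lᵀ = L := by
    refine tendsto_nhds_unique (((continuous_id.matrix_transpose).tendsto L).comp hL) ?_
    refine hL.congr fun N => (PosSemidef.transpose_eq (hpsd N)).symm
  have hq : ∀ v : m → ℝ, Tendsto (fun N => v ⬝ᵥ P N *ᵥ v) atTop (𝓝 (v ⬝ᵥ L *ᵥ v)) := by
    intro v
    have : Continuous fun M : Matrix m m ℝ => v ⬝ᵥ M *ᵥ v := by fun_prop
    exact (this.tendsto L).comp hL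
  have hLpsd : L.PosSemidef := by
    rw [← Matrix.nonneg_iff_posSemidef]
    refine le_of_dotProduct_mulVec (by simp) hLt fun v => ?_
    refine ge_of_tendsto' (hq v) fun N => dotProduct_mulVec_mono (hpsd N).nonneg v
  have hfix : L = ricOp A B Q R L := by
    refine tendsto_nhds_unique ((tendsto_add_atTop_iff_nat 1).2 hL) ?_
    simp only [hsucc]
    exact (continuousAt_ricOp hR hLpsd).tendsto.comp hL
  refine ⟨L, posDef_of_le hQ ?_, hfix, ?_⟩
  · rw [hfix]; exact le_ricOp hR hLpsd
  · exact le_of_dotProduct_mulVec hLt (PosSemidef.transpose_eq hX) fun v =>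
      le_of_tendsto' (hq v) fun N => dotProduct_mulVec_mono (hle N) v

end Riccati

/-! ### Measurability of matrix operations, of the Riccati solution and of the gain. -/

instance {p q : Type*} [Finite p] [Finite q] : BorelSpace (Matrix p q ℝ) :=
  inferInstanceAs (BorelSpace (p → q → ℝ))

instance {p q : Type*} [Countable p] [Countable q] :
    SecondCountableTopology (Matrix p q ℝ) :=
  inferInstanceAs (SecondCountableTopology (p → q → ℝ))

lemma _root_.Measurable.matrix_mul {α p q r : Type*} {m : MeasurableSpace α} [Finite p] [Fintype q]
    [Finite r] {f : α → Matrix p q ℝ} {g : α → Matrix q r ℝ} (hf : Measurable f)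
    (hg : Measurable g) : Measurable fun a => f a * g a := by
  have : Continuous fun x : Matrix p q ℝ × Matrix q r ℝ => x.1 * x.2 := by fun_prop
  exact this.measurable.comp (hf.prodMk hg)

lemma measurable_matrix_inv {p : Type*} [Fintype p] [DecidableEq p] :
    Measurable fun M : Matrix p p ℝ => M⁻¹ := by
  have h1 : Measurable fun M : Matrix p p ℝ => M.det := (continuous_id.matrix_det).measurable
  have h2 : Measurable fun M : Matrix p p ℝ => M.adjugate :=
    (continuous_id.matrix_adjugate).measurable
  have h3 : Continuous fun q : ℝ × Matrix p p ℝ => q.1 • q.2 := by fun_prop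
  simp_rw [Matrix.inv_def, Ring.inverse_eq_inv']
  exact h3.measurable.comp (h1.inv.prodMk h2)

lemma isClosed_posSemidef {m : Type*} [Fintype m] : IsClosed {X : Matrix m m ℝ | X.PosSemidef} := by
  have : {X : Matrix m m ℝ | X.PosSemidef} =
      {X | Xᵀ = X} ∩ ⋂ v : m → ℝ, {X | 0 ≤ v ⬝ᵥ X *ᵥ v} := by
    ext X
    simp only [Set.mem_ofPred_eq, Set.mem_inter_iff, Set.mem_iInter,
      Matrix.posSemidef_iff_dotProduct_mulVec]
    simp [Matrix.IsHermitian, Matrix.conjTranspose_eq_transpose_of_trivial]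
  rw [this]
  refine IsClosed.inter (isClosed_eq (by fun_prop) continuous_id) (isClosed_iInter fun v => ?_)
  exact isClosed_le continuous_const (by fun_prop)

namespace Setting

variable {n d : ℕ} {P : Setting n d} {Θ : Param n d} {X : Matrix (Fin n) (Fin n) ℝ}

lemma isDARESol_iff :
    P.IsDARESol Θ X ↔ X.PosDef ∧ X = ricOp (matA Θ) (matB Θ) P.Q P.R X := Iff.rfl

lemma riccati_eq (hP : P.Standing) (h : P.IsDARESol Θ X) : P.riccati Θ = X := by
  have hex : ∃ X, P.IsDARESol Θ X := ⟨X, h⟩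
  rw [riccati, dif_pos hex]
  exact riccati_unique hP.Q_posDef hP.R_posDef hex.choose_spec.1 h.1 hex.choose_spec.2 h.2

lemma cost_eq (hP : P.Standing) (h : P.IsDARESol Θ X) :
    P.cost Θ = ENNReal.ofReal (P.σ ^ 2 * X.trace) := by
  rw [cost, if_pos ⟨X, h⟩, riccati_eq hP h]

lemma gain_eq_ricGain : P.gain Θ = ricGain (matA Θ) (matB Θ) P.R (P.riccati Θ) := rfl

@[fun_prop]
lemma continuous_matA : Continuous (matA : Param n d → _) := by
  unfold matA Matrix.toRows₁; fun_prop

@[fun_prop]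
lemma continuous_matB : Continuous (matB : Param n d → _) := by
  unfold matB Matrix.toRows₂; fun_prop

/-- Sublevel sets of the trace of the Riccati solution are closed. -/
lemma isClosed_exists_isDARESol (hP : P.Standing) {C : Set (Matrix (Fin n) (Fin n) ℝ)}
    (hC : IsClosed C) (c : ℝ) :
    IsClosed {Θ : Param n d | ∃ X ∈ C, P.IsDARESol Θ X ∧ X.trace ≤ c} := by
  -- The trace bounds all entries, so solutions range over a compact box, and projection along a
  -- compact factor is a closed map.
  set K : Set (Matrix (Fin n) (Fin n) ℝ) :=
    Set.pi Set.univ fun _ => Set.pi Set.univ fun _ => Set.Icc (-c) c with hK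
  have hKc : IsCompact K := isCompact_univ_pi fun _ => isCompact_univ_pi fun _ => isCompact_Icc
  have : CompactSpace K := isCompact_iff_compactSpace.1 hKc
  -- Every solution satisfies `Q ≤ X`, and on this closed set the inverse in the Riccati operator is
  -- continuous.
  set D : Set (Param n d × Matrix (Fin n) (Fin n) ℝ) :=
    {p | (p.2 - P.Q).PosSemidef ∧ p.2 ∈ C ∧ p.2.trace ≤ c} with hD
  have hDc : IsClosed D := by
    refine IsClosed.inter (isClosed_posSemidef.preimage (by fun_prop))
      (IsClosed.inter (hC.preimage continuous_snd) ?_)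
    exact isClosed_le (continuous_snd.matrix_trace) continuous_const
  have hDpsd : ∀ p ∈ D, p.2.PosDef := fun p hp => posDef_of_le hP.Q_posDef hp.1
  have hcont : ContinuousOn (fun p : Param n d × Matrix (Fin n) (Fin n) ℝ =>
      p.2 - ricOp (matA p.1) (matB p.1) P.Q P.R p.2) D := by
    intro p hp
    refine ContinuousAt.continuousWithinAt ?_
    have hu := (posDef_inputWeight (B := matB p.1) hP.R_posDef
      (hDpsd p hp).posSemidef).det_pos.ne'
    have h1 : ContinuousAt (fun p : Param n d × Matrix (Fin n) (Fin n) ℝ =>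
        (P.R + (matB p.1)ᵀ * p.2 * matB p.1)⁻¹) p := by
      have : ContinuousAt (fun M : Matrix (Fin d) (Fin d) ℝ => M⁻¹)
          (P.R + (matB p.1)ᵀ * p.2 * matB p.1) := by
        refine continuousAt_matrix_inv _ ?_
        simpa using NormedRing.inverse_continuousAt (Units.mk0 _ hu)
      exact ContinuousAt.comp (f := fun p : Param n d × Matrix (Fin n) (Fin n) ℝ =>
        P.R + (matB p.1)ᵀ * p.2 * matB p.1) this (by fun_prop)
    unfold ricOp
    fun_prop
  have hG := hcont.preimage_isClosed_of_isClosed hDc (isClosed_singleton (x := 0))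
  have hG' : IsClosed ((fun p : Param n d × K => ((p.1, (p.2 : Matrix (Fin n) (Fin n) ℝ)) :
      Param n d × Matrix (Fin n) (Fin n) ℝ)) ⁻¹' (D ∩ (fun p =>
      p.2 - ricOp (matA p.1) (matB p.1) P.Q P.R p.2) ⁻¹' {0})) :=
    hG.preimage (by fun_prop)
  convert isClosedMap_fst_of_compactSpace _ hG' using 1
  ext Θ
  constructor
  · rintro ⟨X, hXC, hX, hXt⟩
    have hXQ : (X - P.Q).PosSemidef := by
      have := le_ricOp (A := matA Θ) (B := matB Θ) (Q := P.Q) hP.R_posDef hX.1.posSemidef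
      rw [← (isDARESol_iff.1 hX).2, Matrix.le_iff] at this
      exact this
    refine ⟨(Θ, ⟨X, ?_⟩), ⟨⟨hXQ, hXC, hXt⟩, ?_⟩, rfl⟩
    · intro i _ j _
      have := abs_apply_le_trace hX.1.posSemidef i j
      exact abs_le.1 (this.trans hXt)
    · simpa [sub_eq_zero] using (isDARESol_iff.1 hX).2
  · rintro ⟨⟨Θ', X⟩, ⟨⟨h1, h2, h3⟩, h4⟩, rfl⟩
    refine ⟨X, h2, ⟨posDef_of_le hP.Q_posDef h1, ?_⟩, h3⟩
    exact sub_eq_zero.1 h4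

/-- By uniqueness of the Riccati solution, optimism is a sublevel condition on its trace. If the
cost of `P.Θs` were infinite, every parameter would be optimistic. -/
lemma isClosed_optimisticSet (hP : P.Standing) : IsClosed P.optimisticSet := by
  by_cases hs : ∃ X, P.IsDARESol P.Θs X
  · obtain ⟨Y, hY⟩ := hs
    convert isClosed_exists_isDARESol hP isClosed_univ Y.trace using 1
    ext Θ
    simp only [optimisticSet, Set.mem_ofPred_eq, cost_eq hP hY, Set.mem_univ, true_and]
    have hYt := hY.1.posSemidef.trace_nonneg
    have hσ := hP.σ_pos
    constructor
    · intro h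
      by_cases hΘ : ∃ X, P.IsDARESol Θ X
      · obtain ⟨X, hX⟩ := hΘ
        rw [cost_eq hP hX, ENNReal.ofReal_le_ofReal_iff (by positivity)] at h
        exact ⟨X, hX, le_of_mul_le_mul_left h (by positivity)⟩
      · simp [cost, hΘ] at h
    · rintro ⟨X, hX, hXt⟩
      rw [cost_eq hP hX]
      gcongr
  · convert isClosed_univ
    ext Θ
    simp [optimisticSet, cost, hs]

/-- The preimage of a closed set is a countable union of closed sets, one for each bound on the
trace, together with the unsolvable parameters if the set contains the default value `0`. -/
lemma measurable_riccati (hP : P.Standing) : Measurable P.riccati := by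
  refine measurable_of_isClosed fun C hC => ?_
  have hex : ∀ {C : Set (Matrix (Fin n) (Fin n) ℝ)}, IsClosed C →
      MeasurableSet {Θ : Param n d | ∃ X ∈ C, P.IsDARESol Θ X} := by
    intro C hC
    have : {Θ : Param n d | ∃ X ∈ C, P.IsDARESol Θ X} =
        ⋃ N : ℕ, {Θ : Param n d | ∃ X ∈ C, P.IsDARESol Θ X ∧ X.trace ≤ N} := by
      ext Θ
      simp only [Set.mem_ofPred_eq, Set.mem_iUnion]
      constructor
      · rintro ⟨X, h1, h2⟩
        obtain ⟨N, hN⟩ := exists_nat_ge X.trace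
        exact ⟨N, X, h1, h2, hN⟩
      · rintro ⟨N, X, h1, h2, _⟩
        exact ⟨X, h1, h2⟩
    rw [this]
    exact .iUnion fun N => (isClosed_exists_isDARESol hP hC N).measurableSet
  have : P.riccati ⁻¹' C = {Θ : Param n d | ∃ X ∈ C, P.IsDARESol Θ X} ∪
      ({Θ : Param n d | ∃ X ∈ Set.univ, P.IsDARESol Θ X}ᶜ ∩ {_Θ | 0 ∈ C}) := by
    ext Θ
    by_cases h : ∃ X, P.IsDARESol Θ X
    · obtain ⟨X, hX⟩ := h
      simp only [Set.mem_preimage, riccati_eq hP hX, Set.mem_union, Set.mem_ofPred_eq,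
        Set.mem_univ, true_and, Set.mem_inter_iff, Set.mem_compl_iff]
      constructor
      · intro h; exact Or.inl ⟨X, h, hX⟩
      · rintro (⟨Y, h, hY⟩ | ⟨h, _⟩)
        · rwa [← riccati_eq hP hX, riccati_eq hP hY]
        · exact absurd ⟨X, hX⟩ h
    · have h' : ∀ X, ¬ P.IsDARESol Θ X := not_exists.1 h
      simp [riccati, h']
  rw [this]
  exact (hex hC).union ((hex isClosed_univ).compl.inter (.const _))

lemma measurable_gain (hP : P.Standing) : Measurable P.gain := by
  have hr := measurable_riccati hP
  have hA : Measurable (matA : Param n d → _) := continuous_matA.measurable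
  have hB : Measurable (matB : Param n d → _) := continuous_matB.measurable
  have hBt : Measurable fun Θ : Param n d => (matB Θ)ᵀ :=
    continuous_matB.matrix_transpose.measurable
  have hBX : Measurable fun Θ : Param n d => (matB Θ)ᵀ * P.riccati Θ := hBt.matrix_mul hr
  have hS : Measurable fun Θ : Param n d => P.R + (matB Θ)ᵀ * P.riccati Θ * matB Θ :=
    (continuous_const.add continuous_id).measurable.comp (hBX.matrix_mul hB)
  have hN : Measurable fun Θ : Param n d => (matB Θ)ᵀ * P.riccati Θ * matA Θ := hBX.matrix_mul hA
  exact continuous_neg.measurable.comp ((measurable_matrix_inv.comp hS).matrix_mul hN)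

end Setting

/-! ### Frobenius and Euclidean norm inequalities. -/

section Frobenius

variable {p q r : Type*} [Fintype p] [Fintype q] [Fintype r]

lemma trace_transpose_mul_eq_sum (M N : Matrix p q ℝ) :
    (Mᵀ * N).trace = ∑ ij : p × q, M ij.1 ij.2 * N ij.1 ij.2 := by
  rw [Fintype.sum_prod_type, Finset.sum_comm]
  simp [Matrix.trace, Matrix.mul_apply]

lemma trace_transpose_mul_self_nonneg (M : Matrix p q ℝ) : 0 ≤ (Mᵀ * M).trace := by
  rw [trace_transpose_mul_eq_sum]
  exact Finset.sum_nonneg fun _ _ => mul_self_nonneg _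

lemma frobNorm_nonneg (M : Matrix p q ℝ) : 0 ≤ frobNorm M := Real.sqrt_nonneg _

lemma frobNorm_sq (M : Matrix p q ℝ) : frobNorm M ^ 2 = (Mᵀ * M).trace :=
  Real.sq_sqrt (trace_transpose_mul_self_nonneg M)

open scoped Matrix.Norms.Frobenius in
lemma frobNorm_eq_norm (M : Matrix p q ℝ) : frobNorm M = ‖M‖ := by
  rw [frobNorm, Matrix.frobenius_norm_def, Real.sqrt_eq_rpow, trace_transpose_mul_eq_sum,
    Fintype.sum_prod_type]
  simp [sq]

open scoped Matrix.Norms.Frobenius in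
lemma frobNorm_add_le (M N : Matrix p q ℝ) : frobNorm (M + N) ≤ frobNorm M + frobNorm N := by
  simp only [frobNorm_eq_norm]; exact norm_add_le _ _

open scoped Matrix.Norms.Frobenius in
lemma frobNorm_sum_le {ι : Type*} (s : Finset ι) (f : ι → Matrix p q ℝ) :
    frobNorm (∑ i ∈ s, f i) ≤ ∑ i ∈ s, frobNorm (f i) := by
  simp only [frobNorm_eq_norm]; exact norm_sum_le _ _

open scoped Matrix.Norms.Frobenius in
lemma frobNorm_mul_le (M : Matrix p q ℝ) (N : Matrix q r ℝ) :
    frobNorm (M * N) ≤ frobNorm M * frobNorm N := by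
  simp only [frobNorm_eq_norm]; exact Matrix.frobenius_norm_mul _ _

open scoped Matrix.Norms.Frobenius in
lemma frobNorm_transpose (M : Matrix p q ℝ) : frobNorm Mᵀ = frobNorm M := by
  simp only [frobNorm_eq_norm]; exact Matrix.frobenius_norm_transpose _

open scoped Matrix.Norms.Frobenius in
lemma frobNorm_smul (c : ℝ) (M : Matrix p q ℝ) : frobNorm (c • M) = |c| * frobNorm M := by
  simp only [frobNorm_eq_norm]; rw [norm_smul, Real.norm_eq_abs]

open scoped Matrix.Norms.Frobenius in
lemma frobNorm_neg (M : Matrix p q ℝ) : frobNorm (-M) = frobNorm M := by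
  simp only [frobNorm_eq_norm]; exact norm_neg _

open scoped Matrix.Norms.Frobenius in
lemma frobNorm_pos {M : Matrix p q ℝ} (h : M ≠ 0) : 0 < frobNorm M := by
  simp only [frobNorm_eq_norm]; exact norm_pos_iff.2 h

lemma abs_apply_le_frobNorm (M : Matrix p q ℝ) (i : p) (j : q) : |M i j| ≤ frobNorm M := by
  refine Real.abs_le_sqrt ?_
  rw [trace_transpose_mul_eq_sum, sq]
  exact Finset.single_le_sum (f := fun ij : p × q => M ij.1 ij.2 * M ij.1 ij.2)
    (fun _ _ => mul_self_nonneg _) (Finset.mem_univ (i, j))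

lemma abs_trace_transpose_mul_le (M N : Matrix p q ℝ) :
    |(Mᵀ * N).trace| ≤ frobNorm M * frobNorm N := by
  refine abs_le_of_sq_le_sq ?_ (mul_nonneg (frobNorm_nonneg _) (frobNorm_nonneg _))
  rw [mul_pow, frobNorm_sq, frobNorm_sq]
  simp only [trace_transpose_mul_eq_sum, ← sq]
  exact Finset.sum_mul_sq_le_sq_mul_sq _ _ _

lemma frobNorm_replicateCol (v : p → ℝ) : frobNorm (Matrix.replicateCol Unit v) = euclNorm v := by
  simp [frobNorm, euclNorm, Matrix.trace, Matrix.mul_apply, dotProduct]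

lemma euclNorm_nonneg (v : p → ℝ) : 0 ≤ euclNorm v := Real.sqrt_nonneg _

lemma dotProduct_self_nonneg' (v : p → ℝ) : 0 ≤ v ⬝ᵥ v :=
  Finset.sum_nonneg fun _ _ => mul_self_nonneg _

lemma euclNorm_sq (v : p → ℝ) : euclNorm v ^ 2 = v ⬝ᵥ v :=
  Real.sq_sqrt (dotProduct_self_nonneg' v)

lemma euclNorm_mulVec_le (M : Matrix p q ℝ) (v : q → ℝ) :
    euclNorm (M *ᵥ v) ≤ frobNorm M * euclNorm v := by
  rw [← frobNorm_replicateCol, ← frobNorm_replicateCol, Matrix.replicateCol_mulVec]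
  exact frobNorm_mul_le _ _

lemma abs_dotProduct_le (v w : p → ℝ) : |v ⬝ᵥ w| ≤ euclNorm v * euclNorm w := by
  refine abs_le_of_sq_le_sq ?_ (mul_nonneg (euclNorm_nonneg _) (euclNorm_nonneg _))
  rw [mul_pow, euclNorm_sq, euclNorm_sq]
  simp only [dotProduct, ← sq]
  exact Finset.sum_mul_sq_le_sq_mul_sq _ _ _

open scoped MatrixOrder in
lemma le_frobNorm_smul_one [DecidableEq p] {M : Matrix p p ℝ} (hM : Mᵀ = M) :
    M ≤ frobNorm M • (1 : Matrix p p ℝ) := by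
  refine le_of_dotProduct_mulVec hM (by simp) fun v => ?_
  calc v ⬝ᵥ M *ᵥ v ≤ euclNorm v * euclNorm (M *ᵥ v) := (le_abs_self _).trans (abs_dotProduct_le _ _)
    _ ≤ euclNorm v * (frobNorm M * euclNorm v) :=
        mul_le_mul_of_nonneg_left (euclNorm_mulVec_le _ _) (euclNorm_nonneg _)
    _ = frobNorm M * (v ⬝ᵥ v) := by rw [← euclNorm_sq]; ring
    _ = _ := by simp [Matrix.smul_mulVec]

lemma exists_frobNorm_le_of_linear [DecidableEq p] [DecidableEq q]
    (L : Matrix p q ℝ →ₗ[ℝ] Matrix p q ℝ) :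
    ∃ C : ℝ, 0 ≤ C ∧ ∀ W, frobNorm (L W) ≤ C * frobNorm W := by
  refine ⟨∑ i, ∑ j, frobNorm (L (Matrix.single i j 1)),
    Finset.sum_nonneg fun _ _ => Finset.sum_nonneg fun _ _ => frobNorm_nonneg _, fun W => ?_⟩
  have h : L W = ∑ i, ∑ j, W i j • L (Matrix.single i j 1) := by
    conv_lhs => rw [Matrix.matrix_eq_sum_single W]
    simp only [map_sum]
    refine Finset.sum_congr rfl fun i _ => Finset.sum_congr rfl fun j _ => ?_
    rw [← map_smul, Matrix.smul_single, smul_eq_mul, mul_one]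
  rw [h, Finset.sum_mul]
  refine (frobNorm_sum_le _ _).trans (Finset.sum_le_sum fun i _ => ?_)
  rw [Finset.sum_mul]
  refine (frobNorm_sum_le _ _).trans (Finset.sum_le_sum fun j _ => ?_)
  rw [frobNorm_smul, mul_comm]
  exact mul_le_mul_of_nonneg_left (abs_apply_le_frobNorm _ _ _) (frobNorm_nonneg _)

end Frobenius

/-! ### Lyapunov equation of a stable matrix and its perturbation. -/

section Lyapunov

open scoped MatrixOrder

variable {m : Type*} [Fintype m] [DecidableEq m]

/-- The discrete Lyapunov operator. -/
def lyapunovMap (F : Matrix m m ℝ) : Matrix m m ℝ →ₗ[ℝ] Matrix m m ℝ where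
  toFun Y := Y - Fᵀ * Y * F
  map_add' X Y := by simp only [Matrix.mul_add, Matrix.add_mul]; abel
  map_smul' c Y := by
    simp only [Matrix.mul_smul, Matrix.smul_mul, smul_sub, RingHom.id_apply]

lemma lyapunovMap_apply (F Y : Matrix m m ℝ) : lyapunovMap F Y = Y - Fᵀ * Y * F := rfl

lemma tendsto_pow_conj {F : Matrix m m ℝ} (hF : Tendsto (fun N : ℕ => F ^ N) atTop (𝓝 0))
    (Y : Matrix m m ℝ) : Tendsto (fun N : ℕ => (F ^ N)ᵀ * Y * F ^ N) atTop (𝓝 0) := by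
  have : Continuous fun G : Matrix m m ℝ => Gᵀ * Y * G := by fun_prop
  have h := (this.tendsto 0).comp hF
  rwa [Matrix.mul_zero] at h

lemma lyapunovMap_injective {F : Matrix m m ℝ}
    (hF : Tendsto (fun N : ℕ => F ^ N) atTop (𝓝 0)) : Function.Injective (lyapunovMap F) := by
  rw [← LinearMap.ker_eq_bot, LinearMap.ker_eq_bot']
  intro Y hY
  rw [lyapunovMap_apply, sub_eq_zero] at hY
  have h : ∀ N : ℕ, (F ^ N)ᵀ * Y * F ^ N = Y := by
    intro N
    induction N with
    | zero => simp
    | succ N ih =>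
      have e : (F ^ (N + 1))ᵀ * Y * F ^ (N + 1) = (F ^ N)ᵀ * (Fᵀ * Y * F) * F ^ N := by
        rw [pow_succ', Matrix.transpose_mul]; simp only [Matrix.mul_assoc]
      rw [e, ← hY, ih]
  have := tendsto_pow_conj hF Y
  simp only [h] at this
  exact tendsto_nhds_unique tendsto_const_nhds this

/-- The inverse of the Lyapunov operator of a stable matrix. -/
lemma exists_lyapunov_inverse {F : Matrix m m ℝ}
    (hF : Tendsto (fun N : ℕ => F ^ N) atTop (𝓝 0)) :
    ∃ L : Matrix m m ℝ →ₗ[ℝ] Matrix m m ℝ, (∀ W, L W - Fᵀ * L W * F = W) ∧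
      ∀ W, Wᵀ = W → (L W)ᵀ = L W := by
  have hinj := lyapunovMap_injective hF
  set e := LinearEquiv.ofInjectiveEndo (lyapunovMap F) hinj with he
  have h1 : ∀ W, lyapunovMap F (e.symm W) = W := fun W => by
    have := e.apply_symm_apply W
    rwa [he, LinearEquiv.coe_ofInjectiveEndo, ← he] at this
  refine ⟨e.symm, fun W => h1 W, fun W hW => hinj ?_⟩
  have h2 := h1 W
  have h3 := congrArg Matrix.transpose h2
  rw [lyapunovMap_apply] at h2 h3 ⊢
  rw [hW] at h3
  rw [lyapunovMap_apply]
  simp only [Matrix.transpose_sub, Matrix.transpose_mul, Matrix.transpose_transpose,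
    LinearEquiv.coe_coe] at h2 h3 ⊢
  rw [h2, Matrix.mul_assoc, h3]

/-- The controllability Gramian of a stable matrix. -/
lemma exists_gramian {F : Matrix m m ℝ} (hF : Tendsto (fun N : ℕ => F ^ N) atTop (𝓝 0)) :
    ∃ S : Matrix m m ℝ, Sᵀ = S ∧ IsUnit S ∧ S - F * S * Fᵀ = 1 := by
  have hFt : Tendsto (fun N : ℕ => Fᵀ ^ N) atTop (𝓝 0) := by
    have : Continuous fun G : Matrix m m ℝ => Gᵀ := by fun_prop
    have h := (this.tendsto 0).comp hF
    rw [Matrix.transpose_zero] at h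
    exact h.congr fun N => Matrix.transpose_pow _ _
  obtain ⟨L, hL, hLs⟩ := exists_lyapunov_inverse hFt
  have hS := hL 1
  have hSt := hLs 1 (by simp)
  set S := L 1
  rw [Matrix.transpose_transpose] at hS
  refine ⟨S, hSt, ?_, hS⟩
  -- The right side is the partial sum `∑_{j<N} F^j (F^j)ᵀ`, whose first term is already `1`. The
  -- limit `N → ∞` gives `1 ≤ S`, so `S` is invertible.
  have hge : ∀ N : ℕ, 0 < N → (1 : Matrix m m ℝ) ≤ S - ((Fᵀ) ^ N)ᵀ * S * (Fᵀ) ^ N := by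
    intro N hN
    induction N, hN using Nat.le_induction with
    | base => simp [hS]
    | succ N _ ih =>
      have e : (Fᵀ ^ (N + 1))ᵀ * S * Fᵀ ^ (N + 1) =
          (Fᵀ ^ N)ᵀ * S * Fᵀ ^ N - (Fᵀ ^ N)ᵀ * Fᵀ ^ N := by
        have : F * S * Fᵀ = S - 1 := by rw [← hS]; abel
        calc _ = (Fᵀ ^ N)ᵀ * (F * S * Fᵀ) * Fᵀ ^ N := by
              rw [pow_succ', Matrix.transpose_mul]
              simp only [Matrix.mul_assoc, Matrix.transpose_transpose]
          _ = _ := by rw [this]; simp only [Matrix.mul_sub, Matrix.sub_mul, Matrix.mul_one]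
      rw [e, sub_sub_eq_add_sub, add_sub_right_comm]
      refine ih.trans (le_add_of_nonneg_right ?_)
      have := PosSemidef.congr_transpose (PosSemidef.one (n := m) (R := ℝ)) (Fᵀ ^ N)
      rw [Matrix.mul_one] at this
      exact this.nonneg
  have h1 : (1 : Matrix m m ℝ) ≤ S := by
    refine le_of_dotProduct_mulVec (by simp) hSt fun v => ?_
    have hc : Continuous fun M : Matrix m m ℝ => v ⬝ᵥ (S - M) *ᵥ v := by fun_prop
    have := (hc.tendsto 0).comp (tendsto_pow_conj hFt S)
    rw [sub_zero] at this
    refine ge_of_tendsto this ?_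
    filter_upwards [eventually_gt_atTop 0] with N hN
    exact dotProduct_mulVec_mono (hge N hN) v
  exact (posDef_of_le PosDef.one h1).isUnit

/-- Duality: the Lyapunov operators of `F` and `Fᵀ` are adjoint for the trace pairing, so `S`
represents the functional that sends a right side to the trace of its solution. -/
lemma trace_mul_gramian {F S Y W : Matrix m m ℝ} (hS : S - F * S * Fᵀ = 1)
    (hY : Y - Fᵀ * Y * F = W) : Y.trace = (W * S).trace := by
  have h1 : (Fᵀ * Y * F * S).trace = (Y * (F * S * Fᵀ)).trace := by
    rw [Matrix.mul_assoc, Matrix.mul_assoc, Matrix.trace_mul_comm]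
    simp only [Matrix.mul_assoc]
  rw [← hY, Matrix.sub_mul, Matrix.trace_sub, h1, ← Matrix.trace_sub, ← Matrix.mul_sub, hS,
    Matrix.mul_one]

/-- A supersolution of the perturbed Lyapunov equation whose trace is known to first order. -/
lemma exists_lyapunov_supersolution {F P₀ : Matrix m m ℝ}
    (hF : Tendsto (fun N : ℕ => F ^ N) atTop (𝓝 0)) (hP : P₀.PosDef) :
    ∃ S : Matrix m m ℝ, IsUnit S ∧ ∃ C : ℝ, 0 ≤ C ∧ ∃ r : ℝ, 0 < r ∧
      ∀ E : Matrix m m ℝ, frobNorm E ≤ r → ∃ Y : Matrix m m ℝ, (P₀ + Y).PosSemidef ∧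
        (F + E)ᵀ * (P₀ + Y) * (F + E) - Fᵀ * P₀ * F ≤ Y ∧
        Y.trace ≤ 2 * (S * Fᵀ * P₀ * E).trace + C * frobNorm E ^ 2 := by
  obtain ⟨S, hSt, hSu, hS⟩ := exists_gramian hF
  obtain ⟨L, hL, hLs⟩ := exists_lyapunov_inverse hF
  obtain ⟨l, hl0, hl⟩ := exists_frobNorm_le_of_linear L
  obtain ⟨c, hc0, hc⟩ := exists_smul_one_le_of_posDef hP
  have hPt := PosSemidef.transpose_eq hP.posSemidef
  set f := frobNorm F with hf
  set p := frobNorm P₀ with hp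
  set y := frobNorm (L 1) with hy
  have hf0 : 0 ≤ f := frobNorm_nonneg _
  have hp0 : 0 ≤ p := frobNorm_nonneg _
  have hy0 : 0 ≤ y := frobNorm_nonneg _
  -- `g` is a Lipschitz constant for the correction, `‖Y‖ ≤ g ‖E‖`: the first summand comes from the
  -- linear part, the `1` from the quadratic one. `C₀` then bounds all terms of second order in `E`.
  set g := l * (2 * f * p) + 1 with hg
  have hg0 : 0 < g := by positivity
  set C₀ := p + 2 * f * g + g with hC₀
  have hC0 : 0 ≤ C₀ := by positivity
  -- The three radii respectively bound cubic terms by quadratic ones, keep the quadratic correction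
  -- below `‖E‖`, and keep `P₀ + Y` positive semidefinite.
  refine ⟨S, hSu, C₀ * |(L 1).trace|, by positivity, min 1 (min (1 / (C₀ * y + 1)) (c / g)),
    by positivity, fun E hE => ?_⟩
  set e := frobNorm E with he
  have he0 : 0 ≤ e := frobNorm_nonneg _
  have he1 : e ≤ 1 := hE.trans (min_le_left _ _)
  have he2 : C₀ * e * y ≤ 1 := by
    have h : e ≤ 1 / (C₀ * y + 1) := hE.trans ((min_le_right _ _).trans (min_le_left _ _))
    rw [le_div_iff₀ (by positivity)] at h
    nlinarith
  have he3 : g * e ≤ c := by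
    have h : e ≤ c / g := hE.trans ((min_le_right _ _).trans (min_le_right _ _))
    rw [le_div_iff₀ hg0] at h
    linarith
  set W := Fᵀ * P₀ * E + Eᵀ * P₀ * F with hW
  have hWt : Wᵀ = W := by
    simp only [hW, Matrix.transpose_add, Matrix.transpose_mul, Matrix.transpose_transpose, hPt,
      Matrix.mul_assoc]
    abel
  have hWn : frobNorm W ≤ 2 * f * p * e := by
    have h1 : frobNorm (Fᵀ * P₀ * E) ≤ f * p * e := by
      refine (frobNorm_mul_le _ _).trans (mul_le_mul_of_nonneg_right ?_ he0)
      refine (frobNorm_mul_le _ _).trans ?_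
      rw [frobNorm_transpose]
    have h2 : frobNorm (Eᵀ * P₀ * F) ≤ f * p * e := by
      have : (Fᵀ * P₀ * E)ᵀ = Eᵀ * P₀ * F := by
        simp only [Matrix.transpose_mul, Matrix.transpose_transpose, hPt, Matrix.mul_assoc]
      rw [← this, frobNorm_transpose]; exact h1
    exact (frobNorm_add_le _ _).trans (by linarith)
  -- `L W` solves the linearized equation; the multiple of `L 1` creates the slack `C₀ e² I` that
  -- absorbs the remainder `Z`.
  set Y := L W + (C₀ * e ^ 2) • L 1 with hY
  have hYt : Yᵀ = Y := by
    rw [hY, Matrix.transpose_add, Matrix.transpose_smul, hLs W hWt, hLs 1 (by simp)]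
  have hYn : frobNorm Y ≤ g * e := by
    have h1 : frobNorm (L W) ≤ l * (2 * f * p * e) :=
      (hl W).trans (mul_le_mul_of_nonneg_left hWn hl0)
    have h2 : frobNorm ((C₀ * e ^ 2) • L 1) = C₀ * e * y * e := by
      rw [frobNorm_smul, abs_of_nonneg (by positivity)]; ring
    have h3 : C₀ * e * y * e ≤ 1 * e := mul_le_mul_of_nonneg_right he2 he0
    refine (frobNorm_add_le _ _).trans ?_
    rw [h2, hg]
    linarith
  have hYL : Y - Fᵀ * Y * F = W + (C₀ * e ^ 2) • 1 := by
    have h1 := hL W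
    have h2 := hL 1
    calc Y - Fᵀ * Y * F = (L W - Fᵀ * L W * F) + (C₀ * e ^ 2) • (L 1 - Fᵀ * L 1 * F) := by
          rw [hY]
          simp only [Matrix.mul_add, Matrix.add_mul, Matrix.mul_smul, Matrix.smul_mul, smul_sub]
          abel
      _ = _ := by rw [h1, h2]
  refine ⟨Y, ?_, ?_, ?_⟩
  · rw [← Matrix.nonneg_iff_posSemidef]
    have h1 : -Y ≤ P₀ := by
      refine (le_frobNorm_smul_one (by rw [Matrix.transpose_neg, hYt])).trans (le_trans ?_ hc)
      rw [frobNorm_neg]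
      exact smul_le_smul_matrix_right (hYn.trans he3) PosSemidef.one
    have := add_le_add_left h1 Y
    rwa [neg_add_cancel] at this
  · set Z := Eᵀ * P₀ * E + Fᵀ * Y * E + Eᵀ * Y * F + Eᵀ * Y * E with hZ
    have hZt : Zᵀ = Z := by
      simp only [hZ, Matrix.transpose_add, Matrix.transpose_mul, Matrix.transpose_transpose, hPt,
        hYt, Matrix.mul_assoc]
      abel
    have hn3 : ∀ A B C : Matrix m m ℝ, ∀ a b c : ℝ, frobNorm A ≤ a → frobNorm B ≤ b →
        frobNorm C ≤ c → frobNorm (Aᵀ * B * C) ≤ a * b * c := by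
      intro A B C a b c ha hb hc
      have ha0 := (frobNorm_nonneg A).trans ha
      have hb0 := (frobNorm_nonneg B).trans hb
      refine (frobNorm_mul_le _ _).trans
        (mul_le_mul ?_ hc (frobNorm_nonneg _) (mul_nonneg ha0 hb0))
      refine (frobNorm_mul_le _ _).trans ?_
      rw [frobNorm_transpose]
      exact mul_le_mul ha hb (frobNorm_nonneg _) ha0
    have hZn : frobNorm Z ≤ C₀ * e ^ 2 := by
      have h1 := hn3 E P₀ E e p e le_rfl le_rfl le_rfl
      have h2 := hn3 F Y E f (g * e) e le_rfl hYn le_rfl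
      have h3 := hn3 E Y F e (g * e) f le_rfl hYn le_rfl
      have h4 := hn3 E Y E e (g * e) e le_rfl hYn le_rfl
      have h5 : e * (g * e) * e ≤ g * e ^ 2 * 1 := by
        calc e * (g * e) * e = g * e ^ 2 * e := by ring
          _ ≤ _ := mul_le_mul_of_nonneg_left he1 (by positivity)
      have h6 := frobNorm_add_le (Eᵀ * P₀ * E + Fᵀ * Y * E + Eᵀ * Y * F) (Eᵀ * Y * E)
      have h7 := frobNorm_add_le (Eᵀ * P₀ * E + Fᵀ * Y * E) (Eᵀ * Y * F)
      have h8 := frobNorm_add_le (Eᵀ * P₀ * E) (Fᵀ * Y * E)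
      rw [hC₀]
      nlinarith
    have hZle : Z ≤ (C₀ * e ^ 2) • 1 :=
      (le_frobNorm_smul_one hZt).trans (smul_le_smul_matrix_right hZn PosSemidef.one)
    have e1 : (F + E)ᵀ * (P₀ + Y) * (F + E) - Fᵀ * P₀ * F = Fᵀ * Y * F + W + Z := by
      simp only [hW, hZ, Matrix.transpose_add, Matrix.add_mul, Matrix.mul_add]
      abel
    have e2 : Y = Fᵀ * Y * F + W + (C₀ * e ^ 2) • 1 := by
      rw [add_assoc, ← hYL]; abel
    rw [e1]
    nth_rewrite 2 [e2]
    exact add_le_add_right hZle _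
  · have h1 : (L W).trace = 2 * (S * Fᵀ * P₀ * E).trace := by
      rw [trace_mul_gramian hS (hL W), hW, Matrix.add_mul, Matrix.trace_add]
      have a1 : (Fᵀ * P₀ * E * S).trace = (S * Fᵀ * P₀ * E).trace := by
        rw [Matrix.trace_mul_comm]; simp only [Matrix.mul_assoc]
      have a2 : (Eᵀ * P₀ * F * S).trace = (S * Fᵀ * P₀ * E).trace := by
        rw [← Matrix.trace_transpose]
        simp only [Matrix.transpose_mul, Matrix.transpose_transpose, hPt, hSt, Matrix.mul_assoc]
      rw [a1, a2]; ring
    rw [hY, Matrix.trace_add, h1, Matrix.trace_smul, smul_eq_mul]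
    have : C₀ * e ^ 2 * (L 1).trace ≤ C₀ * e ^ 2 * |(L 1).trace| :=
      mul_le_mul_of_nonneg_left (le_abs_self _) (by positivity)
    linarith

end Lyapunov

/-! ### First-order criterion for optimism near the true parameter. -/

open scoped Matrix.Norms.L2Operator in
/-- Powers of a matrix of spectral norm below one tend to zero. -/
lemma tendsto_pow_of_specNorm_lt_one {p : Type*} [Fintype p] [DecidableEq p] {L : Matrix p p ℝ}
    (h : specNorm L < 1) : Tendsto (fun N : ℕ => L ^ N) atTop (𝓝 0) :=
  tendsto_pow_atTop_nhds_zero_of_norm_lt_one h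

lemma euclNorm_eq_norm {p : Type*} [Fintype p] (w : p → ℝ) : euclNorm w = ‖WithLp.toLp 2 w‖ := by
  rw [EuclideanSpace.norm_eq, euclNorm]
  simp [dotProduct, sq]

open scoped Matrix.Norms.L2Operator in
lemma euclNorm_mulVec_le_specNorm {p q : Type*} [Fintype p] [Fintype q] [DecidableEq q]
    (M : Matrix p q ℝ) (v : q → ℝ) : euclNorm (M *ᵥ v) ≤ specNorm M * euclNorm v := by
  have h := Matrix.l2_opNorm_mulVec M (WithLp.toLp 2 v)
  rw [euclNorm_eq_norm, euclNorm_eq_norm]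
  exact h

namespace Setting

variable {n d : ℕ} {P : Setting n d} {Θ : Param n d}

lemma IsStabilizable.tendsto_pow (hP : P.Standing) (h : P.IsStabilizable Θ) :
    Tendsto (fun N : ℕ => (matA Θ + matB Θ * P.gain Θ) ^ N) atTop (𝓝 0) := by
  obtain ⟨-, L, H, hH, hc, hL, -⟩ := h
  have hL1 : specNorm L < 1 := hL.trans_lt (by linarith [hP.γ_pos])
  have hu : IsUnit H.det := (Matrix.isUnit_iff_isUnit_det _).1 hH.isUnit
  have hpow : ∀ N : ℕ, (matA Θ + matB Θ * P.gain Θ) ^ N = H * L ^ N * H⁻¹ := by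
    intro N
    rw [hc]
    induction N with
    | zero => simp [Matrix.mul_nonsing_inv _ hu]
    | succ N ih =>
      rw [pow_succ, ih, pow_succ]
      simp only [Matrix.mul_assoc]
      rw [← Matrix.mul_assoc H⁻¹ H, Matrix.nonsing_inv_mul _ hu, Matrix.one_mul]
  simp only [hpow]
  have : Continuous fun G : Matrix (Fin n) (Fin n) ℝ => H * G * H⁻¹ := by fun_prop
  have h := (this.tendsto 0).comp (tendsto_pow_of_specNorm_lt_one hL1)
  rwa [Matrix.mul_zero, Matrix.zero_mul] at h

lemma Standing.isStabilizable (hP : P.Standing) : P.IsStabilizable P.Θs :=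
  (hP.params_subset (interior_subset hP.mem_interior)).1

/-- The matrix `[I; K]` that maps a state to the regressor under the optimal feedback. -/
def augment (P : Setting n d) : Matrix (Fin n ⊕ Fin d) (Fin n) ℝ :=
  Matrix.fromRows 1 (P.gain P.Θs)

lemma matA_add_matB_mul (Θ : Param n d) (K : Matrix (Fin d) (Fin n) ℝ) :
    matA Θ + matB Θ * K =
      Θᵀ * (Matrix.fromRows 1 K : Matrix (Fin n ⊕ Fin d) (Fin n) ℝ) := by
  conv_rhs => rw [← Matrix.fromRows_toRows Θ, Matrix.transpose_fromRows,
    Matrix.fromCols_mul_fromRows, Matrix.mul_one]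
  rfl

open scoped MatrixOrder in
/-- A first-order sufficient condition for a parameter near the true one to be optimistic. -/
theorem exists_optimism_criterion (hP : P.Standing) (hs : ∃ X, P.IsDARESol P.Θs X) :
    ∃ M : Matrix (Fin n) (Fin n) ℝ, (P.closedLoop ≠ 0 → M ≠ 0) ∧
      (IsUnit P.closedLoop → IsUnit M) ∧ ∃ C : ℝ, 0 ≤ C ∧ ∃ r : ℝ, 0 < r ∧
      ∀ D : Param n d, frobNorm (Dᵀ * P.augment) ≤ r →
        2 * (Dᵀ * (P.augment * M)).trace + C * frobNorm (Dᵀ * P.augment) ^ 2 ≤ 0 →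
        P.Θs + D ∈ P.optimisticSet := by
  obtain ⟨X, hX⟩ := hs
  obtain ⟨hXpd, hXfix⟩ := isDARESol_iff.1 hX
  have hric := riccati_eq hP hX
  set K := P.gain P.Θs with hK
  have hKX : K = ricGain (matA P.Θs) (matB P.Θs) P.R X := by rw [hK, gain_eq_ricGain, hric]
  have hF : Tendsto (fun N : ℕ => P.closedLoop ^ N) atTop (𝓝 0) :=
    hP.isStabilizable.tendsto_pow hP
  obtain ⟨S, hSu, C, hC, r, hr, hsup⟩ := exists_lyapunov_supersolution hF hXpd
  have hXu := hXpd.isUnit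
  -- Both `S` and `X` are invertible, so `M` is nonzero or invertible whenever the closed loop is.
  refine ⟨S * P.closedLoopᵀ * X, fun hne h0 => hne ?_, fun hu => ?_, C, hC, r, hr,
    fun D hD htr => ?_⟩
  · have h1 : S * P.closedLoopᵀ = 0 := by
      have := hXu.mul_left_eq_zero.1 h0
      exact this
    have h2 := hSu.mul_right_eq_zero.1 h1
    simpa using h2
  · refine (hSu.mul ?_).mul hXu
    exact (Matrix.isUnit_transpose _).2 hu
  · obtain ⟨Y, hYpsd, hY, hYt⟩ := hsup (Dᵀ * P.augment) hD
    have hcl : matA (P.Θs + D) + matB (P.Θs + D) * K = P.closedLoop + Dᵀ * P.augment := by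
      rw [matA_add_matB_mul, closedLoop, matA_add_matB_mul, Matrix.transpose_add, Matrix.add_mul]
      rfl
    have hX' : X = P.Q + Kᵀ * P.R * K + P.closedLoopᵀ * X * P.closedLoop := by
      nth_rewrite 1 [hXfix]
      rw [ricOp_eq_lqCost hP.R_posDef hXpd.posSemidef, ← hKX]
      rfl
    -- The old feedback is retained for the perturbed system: any supersolution for it bounds the
    -- new optimal value.
    have hle : lqCost (matA (P.Θs + D)) (matB (P.Θs + D)) P.Q P.R K (X + Y) ≤ X + Y := by
      rw [lqCost, hcl]
      nth_rewrite 2 [hX']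
      rw [add_assoc _ _ Y]
      refine add_le_add_right ?_ _
      rw [← sub_le_iff_le_add']
      exact hY
    obtain ⟨Z, hZpd, hZfix, hZle⟩ :=
      exists_riccati_of_supersolution hP.Q_posDef hP.R_posDef hYpsd K hle
    have hZ : P.IsDARESol (P.Θs + D) Z := isDARESol_iff.2 ⟨hZpd, hZfix⟩
    change P.cost _ ≤ P.cost _
    rw [cost_eq hP hX, cost_eq hP hZ]
    refine ENNReal.ofReal_le_ofReal (mul_le_mul_of_nonneg_left ?_ (sq_nonneg _))
    have h1 := (Matrix.le_iff.1 hZle).trace_nonneg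
    rw [Matrix.trace_sub, Matrix.trace_add] at h1
    have h2 : (S * P.closedLoopᵀ * X * (Dᵀ * P.augment)).trace =
        (Dᵀ * (P.augment * (S * P.closedLoopᵀ * X))).trace := by
      rw [Matrix.trace_mul_comm, Matrix.mul_assoc]
    rw [h2] at hYt
    linarith

end Setting

/-! ### Linear forms, tightness and tails of Gaussian matrices. -/

section GaussianForms

variable {ι : Type*} [Fintype ι]

/-- A sum of independent centred Gaussian variables is Gaussian. -/
lemma map_sum_pi_gaussianReal (v : ι → NNReal) :
    (Measure.pi fun i => gaussianReal 0 (v i)).map (fun x => ∑ i, x i) =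
      gaussianReal 0 (∑ i, v i) := by
  have hm : Measurable fun x : ι → ℝ => ∑ i, x i := by fun_prop
  have := Measure.isProbabilityMeasure_map (μ := Measure.pi fun i => gaussianReal 0 (v i))
    hm.aemeasurable
  apply Measure.ext_of_charFun
  ext t
  rw [charFun_gaussianReal, charFun_apply_real, integral_map hm.aemeasurable (by fun_prop)]
  have h1 : ∀ x : ι → ℝ, Complex.exp (t * (∑ i, x i : ℝ) * Complex.I) =
      ∏ i, Complex.exp (t * (x i : ℝ) * Complex.I) := by
    intro x
    rw [← Complex.exp_sum]
    push_cast
    rw [Finset.mul_sum, Finset.sum_mul]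
  simp_rw [h1]
  rw [integral_fintype_prod_eq_prod (fun i (y : ℝ) => Complex.exp (t * (y : ℝ) * Complex.I))]
  simp_rw [← charFun_apply_real, charFun_gaussianReal]
  rw [← Complex.exp_sum]
  congr 1
  push_cast
  simp [Finset.sum_mul, Finset.sum_div]

/-- The law of a linear form of independent centred Gaussian variables. -/
lemma map_dotProduct_pi_gaussianReal (a : ι → ℝ) (v : NNReal) :
    (Measure.pi fun _ : ι => gaussianReal 0 v).map (fun x => a ⬝ᵥ x) =
      gaussianReal 0 ((a ⬝ᵥ a).toNNReal * v) := by
  have h1 : (fun x : ι → ℝ => a ⬝ᵥ x) = (fun x => ∑ i, x i) ∘ fun x i => a i * x i := rfl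
  rw [h1, ← Measure.map_map (by fun_prop) (by fun_prop),
    Measure.pi_map_pi (μ := fun _ : ι => gaussianReal 0 v) (f := fun i y => a i * y)
      (fun i => (measurable_const_mul _).aemeasurable)]
  simp_rw [gaussianReal_map_const_mul, mul_zero]
  rw [map_sum_pi_gaussianReal]
  congr 1
  ext
  push_cast
  rw [Real.coe_toNNReal _ (dotProduct_self_nonneg' a), dotProduct, Finset.sum_mul]
  simp [sq]

end GaussianForms

section GaussianMatrix

variable {p q : Type*} [Fintype p] [Fintype q]

instance : IsProbabilityMeasure (stdGaussianMatrix p q) :=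
  inferInstanceAs (IsProbabilityMeasure
    (Measure.pi fun _ : p => Measure.pi fun _ : q => gaussianReal 0 1))

lemma map_trace_stdGaussianMatrix (M : Matrix p q ℝ) :
    (stdGaussianMatrix p q).map (fun η => (Mᵀ * η).trace) =
      gaussianReal 0 (frobNorm M ^ 2).toNNReal := by
  have h1 : (fun η : Matrix p q ℝ => (Mᵀ * η).trace) =
      (fun x => ∑ i, x i) ∘ fun (η : Matrix p q ℝ) i => M i ⬝ᵥ η i := by
    ext η
    rw [trace_transpose_mul_eq_sum, Fintype.sum_prod_type]
    rfl
  have hm : ∀ i, Measurable fun y : q → ℝ => M i ⬝ᵥ y := fun i =>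
    (by fun_prop : Continuous fun y : q → ℝ => M i ⬝ᵥ y).measurable
  have : ∀ i, IsProbabilityMeasure
      ((Measure.pi fun _ : q => gaussianReal 0 1).map fun y => M i ⬝ᵥ y) :=
    fun i => Measure.isProbabilityMeasure_map (hm i).aemeasurable
  have h2 : (stdGaussianMatrix p q).map (fun (η : Matrix p q ℝ) i => M i ⬝ᵥ η i) =
      Measure.pi fun i => (Measure.pi fun _ : q => gaussianReal 0 1).map fun y => M i ⬝ᵥ y :=
    Measure.pi_map_pi (μ := fun _ : p => Measure.pi fun _ : q => gaussianReal 0 1)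
      (f := fun i y => M i ⬝ᵥ y) (fun i => (hm i).aemeasurable)
  have hm2 : Measurable fun (η : Matrix p q ℝ) i => M i ⬝ᵥ η i :=
    measurable_pi_lambda _ fun i => (hm i).comp (measurable_pi_apply i)
  rw [h1, ← Measure.map_map (by fun_prop) hm2, h2]
  simp_rw [map_dotProduct_pi_gaussianReal]
  rw [map_sum_pi_gaussianReal]
  congr 1
  ext
  rw [frobNorm_sq, Real.coe_toNNReal _ (trace_transpose_mul_self_nonneg M),
    trace_transpose_mul_eq_sum, Fintype.sum_prod_type]
  push_cast
  refine Finset.sum_congr rfl fun i _ => ?_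
  rw [Real.coe_toNNReal _ (dotProduct_self_nonneg' _), mul_one]
  rfl

lemma continuous_frobNorm : Continuous (frobNorm : Matrix p q ℝ → ℝ) := by
  unfold frobNorm; fun_prop

/-- The standard Gaussian matrix is tight. -/
lemma exists_frobNorm_bound (ε : ℝ) (hε : 0 < ε) :
    ∃ R : ℝ, 0 ≤ R ∧ (stdGaussianMatrix p q).real {η | R < frobNorm η} ≤ ε := by
  have hmono : Monotone fun k : ℕ => {η : Matrix p q ℝ | frobNorm η ≤ k} := by
    intro a b h η hη
    have h' : (a : ℝ) ≤ b := by exact_mod_cast h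
    exact le_trans (show frobNorm η ≤ a from hη) h'
  have h := tendsto_measure_iUnion_atTop (μ := stdGaussianMatrix p q) hmono
  have hU : ⋃ k : ℕ, {η : Matrix p q ℝ | frobNorm η ≤ k} = Set.univ := by
    ext η; simpa using exists_nat_ge (frobNorm η)
  rw [hU, measure_univ] at h
  have h' := (ENNReal.tendsto_toReal ENNReal.one_ne_top).comp h
  rw [ENNReal.toReal_one] at h'
  obtain ⟨k, hk⟩ := (h'.eventually_const_lt (show 1 - ε < 1 by linarith)).exists
  refine ⟨k, by positivity, ?_⟩
  have hms : MeasurableSet {η : Matrix p q ℝ | frobNorm η ≤ k} :=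
    (isClosed_le continuous_frobNorm continuous_const).measurableSet
  have hc : {η : Matrix p q ℝ | (k : ℝ) < frobNorm η} = {η | frobNorm η ≤ k}ᶜ := by
    ext η; simp
  rw [hc, probReal_compl_eq_one_sub hms]
  have hk' : 1 - ε < (stdGaussianMatrix p q).real {η | frobNorm η ≤ k} := hk
  linarith

end GaussianMatrix

/-- Right continuity of the tail. The margin `e` above the threshold `1` is what later pays for the
second-order error. -/
lemma exists_gaussianQ_ge (ε : ℝ) (hε : 0 < ε) :
    ∃ e : ℝ, 0 < e ∧ gaussianQ 1 - ε ≤ gaussianQ (1 + e) := by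
  have hmono : Monotone fun k : ℕ => Set.Ioi (1 + 1 / ((k : ℝ) + 1)) := by
    intro a b h
    refine Set.Ioi_subset_Ioi ?_
    gcongr
  have h := tendsto_measure_iUnion_atTop (μ := gaussianReal 0 1) hmono
  have hU : ⋃ k : ℕ, Set.Ioi (1 + 1 / ((k : ℝ) + 1)) = Set.Ioi 1 := by
    ext x
    simp only [Set.mem_iUnion, Set.mem_Ioi]
    constructor
    · rintro ⟨k, hk⟩
      have : (0 : ℝ) < 1 / ((k : ℝ) + 1) := by positivity
      linarith
    · intro hx
      obtain ⟨k, hk⟩ := exists_nat_one_div_lt (sub_pos.2 hx)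
      exact ⟨k, by linarith⟩
  rw [hU] at h
  have h' := (ENNReal.tendsto_toReal (measure_ne_top _ _)).comp h
  have hlt : gaussianQ 1 - ε < gaussianQ 1 := by linarith
  obtain ⟨k, hk⟩ := (h'.eventually_const_lt hlt).exists
  exact ⟨1 / ((k : ℝ) + 1), by positivity, le_of_lt hk⟩

/-! ### The factor `V^{-1/2}` and its norm bounds. -/

section InvSqrt

open scoped MatrixOrder Matrix.Norms.L2Operator

variable {p : Type*} [Fintype p] [DecidableEq p] {V : Matrix p p ℝ}

lemma invSqrt_posSemidef (V : Matrix p p ℝ) : (invSqrt V).PosSemidef :=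
  Matrix.nonneg_iff_posSemidef.1 (CFC.sqrt_nonneg _)

lemma invSqrt_mul_invSqrt (hV : V.PosDef) : invSqrt V * invSqrt V = V⁻¹ :=
  CFC.sqrt_mul_sqrt_self _ hV.inv.posSemidef.nonneg

end InvSqrt

section InvSqrtBounds

variable {p q : Type*} [Fintype p] [DecidableEq p] [Fintype q] {V : Matrix p p ℝ}

lemma invSqrt_transpose (V : Matrix p p ℝ) : (invSqrt V)ᵀ = invSqrt V :=
  PosSemidef.transpose_eq (invSqrt_posSemidef V)

lemma isUnit_invSqrt (hV : V.PosDef) : IsUnit (invSqrt V) := by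
  have h : IsUnit (invSqrt V * invSqrt V) := by
    rw [invSqrt_mul_invSqrt hV]; exact hV.inv.isUnit
  exact ((Commute.refl _).isUnit_mul_iff.1 h).1

lemma isUnit_det_invSqrt (hV : V.PosDef) : IsUnit (invSqrt V).det :=
  (Matrix.isUnit_iff_isUnit_det _).1 (isUnit_invSqrt hV)

lemma inv_invSqrt_mul_self (hV : V.PosDef) : (invSqrt V)⁻¹ * (invSqrt V)⁻¹ = V := by
  rw [← Matrix.mul_inv_rev, invSqrt_mul_invSqrt hV,
    Matrix.nonsing_inv_nonsing_inv _ ((Matrix.isUnit_iff_isUnit_det _).1 hV.isUnit)]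

lemma invSqrt_mul_mul_invSqrt (hV : V.PosDef) : invSqrt V * V * invSqrt V = 1 := by
  have hu := isUnit_det_invSqrt hV
  have hW := inv_invSqrt_mul_self hV
  generalize invSqrt V = W at *
  rw [← hW, ← Matrix.mul_assoc W, Matrix.mul_nonsing_inv _ hu, Matrix.one_mul,
    Matrix.nonsing_inv_mul _ hu]

lemma weightedNorm_eq_frobNorm (hV : V.PosDef) (D : Matrix p q ℝ) :
    weightedNorm V D = frobNorm ((invSqrt V)⁻¹ * D) := by
  rw [weightedNorm, frobNorm, Matrix.transpose_mul, Matrix.transpose_nonsing_inv,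
    invSqrt_transpose]
  nth_rewrite 1 [← inv_invSqrt_mul_self hV]
  simp only [Matrix.mul_assoc]

/-- Evaluated at `V^{-1/2} X`, the form of `V` becomes the plain Frobenius norm, so bounds `l ≤ V ≤
u` turn into two-sided bounds on `‖V^{-1/2} X‖`. -/
lemma trace_invSqrt_conj (hV : V.PosDef) (X : Matrix p q ℝ) :
    ((invSqrt V * X)ᵀ * V * (invSqrt V * X)).trace = frobNorm X ^ 2 := by
  rw [frobNorm_sq, Matrix.transpose_mul, invSqrt_transpose]
  congr 1
  calc _ = Xᵀ * (invSqrt V * V * invSqrt V) * X := by simp only [Matrix.mul_assoc]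
    _ = _ := by rw [invSqrt_mul_mul_invSqrt hV, Matrix.mul_one]

lemma mul_frobNorm_invSqrt_sq_le (hV : V.PosDef) {l : ℝ}
    (hl : (V - l • (1 : Matrix p p ℝ)).PosSemidef) (X : Matrix p q ℝ) :
    l * frobNorm (invSqrt V * X) ^ 2 ≤ frobNorm X ^ 2 := by
  have h := (PosSemidef.congr_transpose hl (invSqrt V * X)).trace_nonneg
  rw [Matrix.mul_sub, Matrix.sub_mul, Matrix.trace_sub, trace_invSqrt_conj hV, Matrix.mul_smul,
    Matrix.mul_one, Matrix.smul_mul, Matrix.trace_smul, smul_eq_mul, ← frobNorm_sq] at h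
  linarith

lemma frobNorm_sq_le_mul_invSqrt (hV : V.PosDef) {l : ℝ}
    (hl : (l • (1 : Matrix p p ℝ) - V).PosSemidef) (X : Matrix p q ℝ) :
    frobNorm X ^ 2 ≤ l * frobNorm (invSqrt V * X) ^ 2 := by
  have h := (PosSemidef.congr_transpose hl (invSqrt V * X)).trace_nonneg
  rw [Matrix.mul_sub, Matrix.sub_mul, Matrix.trace_sub, trace_invSqrt_conj hV, Matrix.mul_smul,
    Matrix.mul_one, Matrix.smul_mul, Matrix.trace_smul, smul_eq_mul, ← frobNorm_sq] at h
  linarith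

end InvSqrtBounds

/-! ### Probability that a well-conditioned sample is optimistic. -/

section Sampling

open scoped MatrixOrder

variable {n d : ℕ} {P : Setting n d}

/-- `P.gain P.Θs` is a stabilizing feedback, even if it were computed from the default value of
`riccati`. Its policy cost solves a Lyapunov equation and is therefore a supersolution. -/
lemma Setting.Standing.exists_isDARESol (hP : P.Standing) : ∃ X, P.IsDARESol P.Θs X := by
  have hF : Tendsto (fun N : ℕ => P.closedLoop ^ N) atTop (𝓝 0) :=
    hP.isStabilizable.tendsto_pow hP
  obtain ⟨L, hL, hLs⟩ := exists_lyapunov_inverse hF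
  set K := P.gain P.Θs
  set W := P.Q + Kᵀ * P.R * K with hW
  have hWp : W.PosSemidef := hP.Q_posDef.posSemidef.add
    (PosSemidef.congr_transpose hP.R_posDef.posSemidef _)
  have hY := hL W
  have hYt := hLs W (PosSemidef.transpose_eq hWp)
  set Y := L W
  have hYp : Y.PosSemidef := by
    have hiter : ∀ N : ℕ, (P.closedLoop ^ N)ᵀ * Y * P.closedLoop ^ N ≤ Y := by
      intro N
      induction N with
      | zero => simp
      | succ N ih =>
        have e : (P.closedLoop ^ (N + 1))ᵀ * Y * P.closedLoop ^ (N + 1) =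
            (P.closedLoop ^ N)ᵀ * (P.closedLoopᵀ * Y * P.closedLoop) * P.closedLoop ^ N := by
          rw [pow_succ', Matrix.transpose_mul]; simp only [Matrix.mul_assoc]
        rw [e]
        refine (transpose_mul_mul_mono ?_ _).trans ih
        rw [Matrix.le_iff, hY]
        exact hWp
    rw [← Matrix.nonneg_iff_posSemidef]
    refine le_of_dotProduct_mulVec (by simp) hYt fun v => ?_
    have hc : Continuous fun M : Matrix (Fin n) (Fin n) ℝ => v ⬝ᵥ M *ᵥ v := by fun_prop
    exact le_of_tendsto' ((hc.tendsto 0).comp (tendsto_pow_conj hF Y)) fun N =>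
      dotProduct_mulVec_mono (hiter N) v
  obtain ⟨Z, hZ, hZfix, -⟩ := exists_riccati_of_supersolution (A := Setting.matA P.Θs)
    (B := Setting.matB P.Θs) hP.Q_posDef hP.R_posDef hYp K (by
      have : lqCost (Setting.matA P.Θs) (Setting.matB P.Θs) P.Q P.R K Y =
        W + P.closedLoopᵀ * Y * P.closedLoop := rfl
      rw [this, ← hY]; simp)
  exact ⟨Z, Setting.isDARESol_iff.2 ⟨hZ, hZfix⟩⟩

lemma augment_mul_ne_zero (M : Matrix (Fin n) (Fin n) ℝ) (h : M ≠ 0) :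
    P.augment * M ≠ 0 := by
  intro h0
  apply h
  ext i j
  have := congrFun (congrFun h0 (Sum.inl i)) j
  simpa [Setting.augment, Matrix.fromRows_mul] using this

lemma exists_frobNorm_ball (hP : P.Standing) :
    ∃ r : ℝ, 0 < r ∧ ∀ D : Param n d, frobNorm D ≤ r → P.Θs + D ∈ P.params := by
  have h1 := mem_interior_iff_mem_nhds.1 hP.mem_interior
  obtain ⟨r, hr, hball⟩ := (@Metric.mem_nhds_iff (Fin n ⊕ Fin d → Fin n → ℝ) _ P.Θs P.params).1 h1
  refine ⟨r / 2, by positivity, fun D hD => hball ?_⟩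
  refine (dist_pi_lt_iff hr).2 fun i => (dist_pi_lt_iff hr).2 fun j => ?_
  have := abs_apply_le_frobNorm D i j
  rw [Real.dist_eq, Matrix.add_apply, add_sub_cancel_left]
  linarith

lemma measurable_sample_map (Θhat : Param n d) (b : ℝ)
    (W : Matrix (Fin n ⊕ Fin d) (Fin n ⊕ Fin d) ℝ) :
    Measurable fun η : Param n d => Θhat + b • (W * η) :=
  (by fun_prop : Continuous fun η : Param n d => Θhat + b • (W * η)).measurable

/-- Conditioning divides by an acceptance probability of at most one, so rejection can only raise
the mass of subsets of the parameter set. -/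
lemma le_samplingLaw_real (hP : P.Standing) (Θhat : Param n d) (b : ℝ)
    (V : Matrix (Fin n ⊕ Fin d) (Fin n ⊕ Fin d) ℝ) {B : Set (Param n d)} (hB : MeasurableSet B) :
    (stdGaussianMatrix (Fin n ⊕ Fin d) (Fin n)).real
      ((fun η : Param n d => Θhat + b • (invSqrt V * η)) ⁻¹' (P.params ∩ B)) ≤
      (samplingLaw P Θhat b V).real B := by
  have hmap := measurable_sample_map Θhat b (invSqrt V)
  have := Measure.isProbabilityMeasure_map
    (μ := stdGaussianMatrix (Fin n ⊕ Fin d) (Fin n)) hmap.aemeasurable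
  rw [measureReal_def, ← Measure.map_apply hmap (hP.measurableSet_params.inter hB), samplingLaw,
    measureReal_def, cond_apply hP.measurableSet_params]
  refine ENNReal.toReal_mono ?_ ?_
  · rw [← cond_apply hP.measurableSet_params]; exact measure_ne_top _ _
  · refine le_mul_of_one_le_left zero_le ?_
    rw [ENNReal.one_le_inv]
    exact prob_le_one

/-- Well-conditioned Thompson sampling is optimistic with probability almost `Q(1)`. -/
theorem exists_samplingLaw_ge (hP : P.Standing) (hne : P.closedLoop ≠ 0) {ε : ℝ} (hε : 0 < ε) :
    ∃ ζ : ℝ, 0 < ζ ∧ ∀ (V : Matrix (Fin n ⊕ Fin d) (Fin n ⊕ Fin d) ℝ) (Θhat : Param n d)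
      (b l u : ℝ), 0 < l → (V - l • (1 : Matrix (Fin n ⊕ Fin d) (Fin n ⊕ Fin d) ℝ)).PosSemidef →
      (u • (1 : Matrix (Fin n ⊕ Fin d) (Fin n ⊕ Fin d) ℝ) - V).PosSemidef → 0 ≤ b →
      weightedNorm V (P.Θs - Θhat) ≤ b → b ≤ ζ * √l →
      (b * √u ≤ ζ * l ∨ IsUnit P.closedLoop) →
      gaussianQ 1 - ε ≤ (samplingLaw P Θhat b V).real P.optimisticSet := by
  obtain ⟨M, hM0, hMu, C, hC, r, hr, hcrit⟩ :=
    Setting.exists_optimism_criterion hP hP.exists_isDARESol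
  obtain ⟨r₁, hr₁, hball⟩ := exists_frobNorm_ball hP
  obtain ⟨e, he, hQ⟩ := exists_gaussianQ_ge (ε / 2) (by positivity)
  obtain ⟨R, hR, htight⟩ := exists_frobNorm_bound (p := Fin n ⊕ Fin d) (q := Fin n) (ε / 2)
    (by positivity)
  set H := P.augment with hH
  set g₀ := frobNorm (H * M) with hg₀
  have hg₀pos : 0 < g₀ := frobNorm_pos (augment_mul_ne_zero M (hM0 hne))
  have hHn := frobNorm_nonneg H
  have hMn := frobNorm_nonneg M⁻¹
  have hsmall : ∀ a b : ℝ, 0 < b → ∀ᶠ ζ : ℝ in 𝓝[>] 0, a * ζ ≤ b := by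
    intro a b hb
    have : Tendsto (fun ζ : ℝ => a * ζ) (𝓝[>] 0) (𝓝 (a * 0)) :=
      (tendsto_id.const_mul a).mono_left nhdsWithin_le_nhds
    rw [mul_zero] at this
    filter_upwards [this.eventually_lt_const hb] with ζ h using h.le
  -- The conditions on `ζ`: the sample stays in the parameter set, it stays where the criterion
  -- applies, and the quadratic error is below the margin in each of the two cases.
  obtain ⟨ζ, ⟨⟨⟨⟨hζ1, hζ2⟩, hζ3⟩, hζ4⟩, hζ⟩⟩ := ((((hsmall (1 + R) r₁ hr₁).and
    (hsmall (frobNorm H * (1 + R)) r hr)).and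
    (hsmall (C * frobNorm H ^ 2 * (1 + R) ^ 2) (2 * e * g₀) (by positivity))).and
    (hsmall (C * frobNorm M⁻¹ * frobNorm H * (1 + R) ^ 2) (2 * e) (by positivity))).and
    self_mem_nhdsWithin |>.exists
  have hζ0 : 0 < ζ := hζ
  refine ⟨ζ, hζ0, fun V Θhat b l u hl hVl hVu hb hw hbl hbu => ?_⟩
  have hV : V.PosDef := by
    have := (PosDef.one (n := Fin n ⊕ Fin d) (R := ℝ)).smul hl
    exact posDef_of_le this hVl
  have hWu := isUnit_det_invSqrt hV
  have hWt := invSqrt_transpose V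
  set W := invSqrt V with hW
  set G := H * M with hG
  set g := frobNorm (W * G) with hg
  set h := frobNorm (W * H) with hh
  have hh0 : 0 ≤ h := frobNorm_nonneg _
  have hsl : 0 < √l := Real.sqrt_pos.2 hl
  have hWX : ∀ X : Param n d, √l * frobNorm (W * X) ≤ frobNorm X := by
    intro X
    refine abs_le_of_sq_le_sq' ?_ (frobNorm_nonneg _) |>.2
    rw [mul_pow, Real.sq_sqrt hl.le]
    exact mul_frobNorm_invSqrt_sq_le hV hVl X
  have hhl : √l * h ≤ frobNorm H := hWX H
  have hug : g₀ ≤ √u * g := by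
    have h1 : g₀ ^ 2 ≤ u * g ^ 2 := frobNorm_sq_le_mul_invSqrt hV hVu G
    have hgsq : 0 ≤ g ^ 2 := sq_nonneg _
    have hu0 : 0 < u := by
      by_contra hu
      have : u * g ^ 2 ≤ 0 := mul_nonpos_of_nonpos_of_nonneg (not_lt.1 hu) hgsq
      have : 0 < g₀ ^ 2 := by positivity
      linarith
    refine abs_le_of_sq_le_sq' ?_ (mul_nonneg (Real.sqrt_nonneg _) (frobNorm_nonneg _)) |>.2
    rw [mul_pow, Real.sq_sqrt hu0.le]
    exact h1
  have hgpos : 0 < g := by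
    have h1 : 0 < √u * g := hg₀pos.trans_le hug
    exact pos_of_mul_pos_right h1 (Real.sqrt_nonneg _)
  -- Quadratic error against linear gain, after division by `b`. The general case uses `h² ≤ ‖H‖² /
  -- l` and `g ≥ g₀ / √u`. For invertible `M`, `W H = W G M⁻¹` bounds `h` by a multiple of `g`
  -- itself, and no upper bound on `V` enters.
  have hkey : C * h ^ 2 * b * (1 + R) ^ 2 ≤ 2 * g * e := by
    rcases hbu with hbu | hu
    · have h1 : l * h ^ 2 ≤ frobNorm H ^ 2 := mul_frobNorm_invSqrt_sq_le hV hVl H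
      have h2 : (C * (1 + R) ^ 2 * b) * (l * h ^ 2) ≤ (C * (1 + R) ^ 2 * b) * frobNorm H ^ 2 :=
        mul_le_mul_of_nonneg_left h1 (by positivity)
      have hupos : 0 < √u := by
        by_contra hu
        have : √u * g ≤ 0 := mul_nonpos_of_nonpos_of_nonneg (not_lt.1 hu) hgpos.le
        linarith
      have h3 : (C * (1 + R) ^ 2 * frobNorm H ^ 2) * (b * √u) ≤
          (C * (1 + R) ^ 2 * frobNorm H ^ 2) * (ζ * l) :=
        mul_le_mul_of_nonneg_left hbu (by positivity)
      have h4 : C * frobNorm H ^ 2 * (1 + R) ^ 2 * ζ * l ≤ 2 * e * g₀ * l :=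
        mul_le_mul_of_nonneg_right hζ3 hl.le
      have h5 : 2 * e * g₀ * l ≤ 2 * e * l * (√u * g) := by
        have := mul_le_mul_of_nonneg_left hug (show 0 ≤ 2 * e * l by positivity)
        linarith
      have h6 := mul_le_mul_of_nonneg_left h2 hupos.le
      refine le_of_mul_le_mul_left ?_ (show 0 < √u * l by positivity)
      linarith
    · have hMi : IsUnit M.det := (Matrix.isUnit_iff_isUnit_det _).1 (hMu hu)
      have h1 : h ≤ g * frobNorm M⁻¹ := by
        have e1 : W * H = W * G * M⁻¹ := by
          rw [hG, Matrix.mul_assoc, Matrix.mul_assoc, Matrix.mul_nonsing_inv _ hMi, Matrix.mul_one]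
        rw [hh, e1]
        exact frobNorm_mul_le _ _
      have h2 : h * b ≤ frobNorm H * ζ := by
        have h3 := mul_le_mul_of_nonneg_left hbl hh0
        have h4 := mul_le_mul_of_nonneg_right hhl hζ0.le
        linarith
      have h3 : h * (h * b) ≤ (g * frobNorm M⁻¹) * (frobNorm H * ζ) :=
        mul_le_mul h1 h2 (by positivity) (by positivity)
      have h4 := mul_le_mul_of_nonneg_left h3 (show 0 ≤ C * (1 + R) ^ 2 by positivity)
      have h5 := mul_le_mul_of_nonneg_left hζ4 hgpos.le
      linarith
  set ξ := W⁻¹ * (Θhat - P.Θs) with hξ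
  have hξb : frobNorm ξ ≤ b := by
    rw [weightedNorm_eq_frobNorm hV] at hw
    have : ξ = -(W⁻¹ * (P.Θs - Θhat)) := by rw [hξ, ← Matrix.mul_neg, neg_sub]
    rw [this, frobNorm_neg]
    exact hw
  -- Scaled to unit variance, with the sign for which a large `N` lowers the cost. The estimation
  -- error `ξ` raises the linear term by at most `b g`, which is the origin of the threshold `1`.
  set N : Param n d → ℝ := fun η => ((-(g⁻¹ • (W * G)))ᵀ * η).trace with hN
  have hopt : ∀ η : Param n d, frobNorm η ≤ R → 1 + e < N η →
      Θhat + b • (W * η) ∈ P.params ∩ P.optimisticSet := by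
    intro η hη hNη
    set y := ξ + b • η with hy
    have hyn : frobNorm y ≤ b * (1 + R) := by
      refine (frobNorm_add_le _ _).trans ?_
      rw [frobNorm_smul, abs_of_nonneg hb]
      have := mul_le_mul_of_nonneg_left hη hb
      linarith
    set D : Param n d := W * y with hD
    have heq : Θhat + b • (W * η) = P.Θs + D := by
      rw [hD, hy, hξ, Matrix.mul_add, ← Matrix.mul_assoc, Matrix.mul_nonsing_inv _ hWu,
        Matrix.one_mul, Matrix.mul_smul]
      abel
    have hbR : b * (1 + R) ≤ ζ * √l * (1 + R) := mul_le_mul_of_nonneg_right hbl (by positivity)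
    have hDH : frobNorm (Dᵀ * H) ≤ h * (b * (1 + R)) := by
      have : Dᵀ * H = yᵀ * (W * H) := by
        rw [hD, Matrix.transpose_mul, hWt, Matrix.mul_assoc]
      rw [this, mul_comm h]
      refine (frobNorm_mul_le _ _).trans (mul_le_mul_of_nonneg_right ?_ hh0)
      rw [frobNorm_transpose]
      exact hyn
    rw [heq]
    refine ⟨hball D ?_, hcrit D ?_ ?_⟩
    · have h1 := hWX y
      refine le_of_mul_le_mul_left (h1.trans (hyn.trans ?_)) hsl
      have := mul_le_mul_of_nonneg_left hζ1 hsl.le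
      linarith
    · refine hDH.trans (le_trans ?_ hζ2)
      have h1 := mul_le_mul_of_nonneg_left hbR hh0
      have h2 := mul_le_mul_of_nonneg_right hhl (show 0 ≤ ζ * (1 + R) by positivity)
      linarith
    · have h1 : (Dᵀ * (H * M)).trace = (ξᵀ * (W * G)).trace + b * (ηᵀ * (W * G)).trace := by
        rw [hD, Matrix.transpose_mul, hWt, Matrix.mul_assoc, hy, Matrix.transpose_add,
          Matrix.add_mul, Matrix.trace_add, Matrix.transpose_smul, Matrix.smul_mul,
          Matrix.trace_smul, smul_eq_mul]
      have h2 : (ηᵀ * (W * G)).trace = -(g * N η) := by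
        have : N η = -(g⁻¹ * (ηᵀ * (W * G)).trace) := by
          simp only [hN]
          rw [Matrix.transpose_neg, Matrix.neg_mul, Matrix.trace_neg, Matrix.transpose_smul,
            Matrix.smul_mul, Matrix.trace_smul, smul_eq_mul, ← Matrix.trace_transpose,
            Matrix.transpose_mul, Matrix.transpose_transpose]
        rw [this]
        field_simp
      have h3 : (ξᵀ * (W * G)).trace ≤ b * g :=
        (le_abs_self _).trans ((abs_trace_transpose_mul_le _ _).trans
          (mul_le_mul_of_nonneg_right hξb hgpos.le))
      have h4 : b * g * (1 + e) ≤ b * g * N η :=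
        mul_le_mul_of_nonneg_left hNη.le (by positivity)
      have h5 : frobNorm (Dᵀ * H) ^ 2 ≤ (h * (b * (1 + R))) ^ 2 :=
        pow_le_pow_left₀ (frobNorm_nonneg _) hDH 2
      have h6 := mul_le_mul_of_nonneg_left h5 hC
      have h7 := mul_le_mul_of_nonneg_left hkey hb
      have h8 : C * (h * (b * (1 + R))) ^ 2 = b * (C * h ^ 2 * b * (1 + R) ^ 2) := by ring
      rw [h1, h2]
      linarith
  have hNlaw : (stdGaussianMatrix (Fin n ⊕ Fin d) (Fin n)).map N = gaussianReal 0 1 := by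
    rw [hN, map_trace_stdGaussianMatrix, frobNorm_neg, frobNorm_smul, ← hg,
      abs_of_pos (inv_pos.2 hgpos), inv_mul_cancel₀ hgpos.ne']
    simp
  have hNm : Measurable N :=
    (by fun_prop : Continuous fun η : Param n d => ((-(g⁻¹ • (W * G)))ᵀ * η).trace).measurable
  set μ := stdGaussianMatrix (Fin n ⊕ Fin d) (Fin n) with hμ
  have hA : gaussianQ 1 - ε ≤ μ.real {η | frobNorm η ≤ R ∧ 1 + e < N η} := by
    have h1 : μ.real (N ⁻¹' Set.Ioi (1 + e)) = gaussianQ (1 + e) := by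
      rw [gaussianQ, ← hNlaw, measureReal_def, measureReal_def,
        Measure.map_apply hNm measurableSet_Ioi]
    have h2 : N ⁻¹' Set.Ioi (1 + e) ⊆
        {η | frobNorm η ≤ R ∧ 1 + e < N η} ∪ {η | R < frobNorm η} := by
      intro η hη
      rcases le_or_gt (frobNorm η) R with h | h
      · exact Or.inl ⟨h, hη⟩
      · exact Or.inr h
    have h3 := (measureReal_mono (μ := μ) h2).trans (measureReal_union_le _ _)
    rw [h1] at h3
    linarith
  exact hA.trans ((measureReal_mono fun η hη => hopt η hη.1 hη.2).trans
    (le_samplingLaw_real hP Θhat b V (Setting.isClosed_optimisticSet hP).measurableSet))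

end Sampling

/-! ### Constant conditional laws: independence and Fubini. -/

section CondLaw

variable {Ω E E' : Type*} {m : MeasurableSpace Ω} [mΩ : MeasurableSpace Ω] [MeasurableSpace E]
  [MeasurableSpace E'] {pr : Measure Ω} {X : Ω → E}

lemma HasCondLaw.integral_indicator_eq {κ : Ω → Measure E} [IsProbabilityMeasure pr]
    (h : HasCondLaw m X κ pr) (hm : m ≤ mΩ) {s : Set Ω} (hs : MeasurableSet[m] s) {B : Set E}
    (hB : MeasurableSet B) : pr.real (s ∩ X ⁻¹' B) = ∫ ω in s, (κ ω).real B ∂pr := by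
  have hXB : MeasurableSet (X ⁻¹' B) := h.1 hB
  have h1 := setIntegral_condExp (μ := pr) hm
    (f := (X ⁻¹' B).indicator fun _ => (1 : ℝ)) ((integrable_const 1).indicator hXB) hs
  rw [setIntegral_congr_ae (hm _ hs) ((h.2 B hB).mono fun ω hω _ => hω)] at h1
  rw [h1, setIntegral_indicator hXB, setIntegral_const, smul_eq_mul, mul_one]

lemma HasCondLaw.map_eq {μ₀ : Measure E} [IsProbabilityMeasure μ₀] [IsProbabilityMeasure pr]
    (h : HasCondLaw m X (fun _ => μ₀) pr) (hm : m ≤ mΩ) : pr.map X = μ₀ := by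
  have hX : Measurable X := h.1
  have := Measure.isProbabilityMeasure_map (μ := pr) hX.aemeasurable
  refine Measure.ext fun B hB => ?_
  rw [Measure.map_apply hX hB, ← measureReal_eq_measureReal_iff]
  have := h.integral_indicator_eq hm (s := Set.univ) MeasurableSet.univ hB
  simpa using this

lemma HasCondLaw.indep {μ₀ : Measure E} [IsProbabilityMeasure μ₀] [IsProbabilityMeasure pr]
    (h : HasCondLaw m X (fun _ => μ₀) pr) (hm : m ≤ mΩ) :
    Indep m (MeasurableSpace.comap X inferInstance) pr := by
  rw [Indep_iff]
  rintro s _ hs ⟨B, hB, rfl⟩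
  have h1 := h.integral_indicator_eq hm hs hB
  have h2 := h.map_eq hm
  have hX : Measurable X := h.1
  rw [← Measure.map_apply hX hB, h2, ← ENNReal.toReal_eq_toReal_iff' (measure_ne_top _ _)
    (ENNReal.mul_ne_top (measure_ne_top _ _) (measure_ne_top _ _)), ENNReal.toReal_mul]
  rwa [setIntegral_const, smul_eq_mul] at h1

/-- Integration of a variable with constant conditional law (Fubini). -/
lemma HasCondLaw.lintegral_comp {μ₀ : Measure E} [IsProbabilityMeasure μ₀]
    [IsProbabilityMeasure pr] (h : HasCondLaw m X (fun _ => μ₀) pr) (hm : m ≤ mΩ) {U : Ω → E'}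
    (hU : Measurable[m] U) {φ : E' × E → ENNReal} (hφ : Measurable φ) :
    ∫⁻ ω, φ (U ω, X ω) ∂pr = ∫⁻ ω, ∫⁻ x, φ (U ω, x) ∂μ₀ ∂pr := by
  have hX : Measurable X := h.1
  have hU' : Measurable U := hU.mono hm le_rfl
  have hind : IndepFun U X pr := by
    have := h.indep hm
    exact indep_of_indep_of_le_left this (by rintro _ ⟨B, hB, rfl⟩; exact hU hB)
  have hmap := (indepFun_iff_map_prod_eq_prod_map_map hU'.aemeasurable hX.aemeasurable).1 hind
  calc ∫⁻ ω, φ (U ω, X ω) ∂pr = ∫⁻ z, φ z ∂(pr.map fun ω => (U ω, X ω)) :=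
        (lintegral_map hφ (hU'.prodMk hX)).symm
    _ = ∫⁻ u, ∫⁻ x, φ (u, x) ∂μ₀ ∂(pr.map U) := by
        rw [hmap, h.map_eq hm, lintegral_prod _ hφ.aemeasurable]
    _ = _ := lintegral_map (Measurable.lintegral_prod_right' hφ) hU'

end CondLaw

/-! ### Laplace transforms and tails of Gaussian vectors. -/

section GaussianIntegral

/-- With `a = 1 + 2 l v`, completing the square turns the integrand into a constant times the
Gaussian density of mean `-2 l v y / a` and variance `v / a`. Variance zero is separate, a Dirac
mass having no density. -/
lemma lintegral_exp_neg_mul_sq_gaussianReal (l y : ℝ) (hl : 0 ≤ l) (v : NNReal) :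
    ∫⁻ x, ENNReal.ofReal (Real.exp (-l * (y + x) ^ 2)) ∂(gaussianReal 0 v) =
      ENNReal.ofReal ((√(1 + 2 * l * v))⁻¹) *
        ENNReal.ofReal (Real.exp (-(l / (1 + 2 * l * v)) * y ^ 2)) := by
  by_cases hv : v = 0
  · subst hv
    rw [gaussianReal_zero_var, lintegral_dirac' _ (by fun_prop)]
    simp
  have hv0 : (0 : ℝ) < v := by positivity
  set a : ℝ := 1 + 2 * l * v with ha
  have ha0 : 0 < a := by positivity
  set v' : NNReal := ⟨v / a, by positivity⟩ with hv'
  have hv'0 : v' ≠ 0 := by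
    intro h
    have : (v : ℝ) / a = 0 := congrArg NNReal.toReal h
    exact absurd this (by positivity)
  have hv'c : (v' : ℝ) = v / a := rfl
  rw [gaussianReal_of_var_ne_zero _ hv, lintegral_withDensity_eq_lintegral_mul _
    (measurable_gaussianPDF 0 v) (by fun_prop)]
  have key : ∀ x : ℝ, (gaussianPDF 0 v * fun x => ENNReal.ofReal (Real.exp (-l * (y + x) ^ 2))) x =
      (ENNReal.ofReal ((√a)⁻¹) * ENNReal.ofReal (Real.exp (-(l / a) * y ^ 2))) *
        gaussianPDF (-(2 * l * v * y / a)) v' x := by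
    intro x
    simp only [Pi.mul_apply, gaussianPDF]
    rw [← ENNReal.ofReal_mul (gaussianPDFReal_nonneg _ _ _), ← ENNReal.ofReal_mul (by positivity),
      ← ENNReal.ofReal_mul (by positivity)]
    congr 1
    simp only [gaussianPDFReal, hv'c]
    have h1 : √(2 * Real.pi * (v / a)) = √(2 * Real.pi * v) / √a := by
      rw [← Real.sqrt_div' _ ha0.le]; congr 1; ring
    have hs : 0 < √a := Real.sqrt_pos.2 ha0
    have hs' : 0 < √(2 * Real.pi * v) := Real.sqrt_pos.2 (by positivity)
    rw [h1]
    have h2 : -(x - 0) ^ 2 / (2 * v) + -l * (y + x) ^ 2 =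
        -(l / a) * y ^ 2 + -(x - -(2 * l * v * y / a)) ^ 2 / (2 * (v / a)) := by
      field_simp
      rw [ha]; ring
    rw [mul_assoc, ← Real.exp_add, h2, Real.exp_add]
    field_simp
  simp_rw [key]
  rw [lintegral_const_mul _ (measurable_gaussianPDF _ _), lintegral_gaussianPDF_eq_one _ hv'0,
    mul_one]

lemma lintegral_exp_neg_mul_sq_isoGaussian {k : ℕ} (l y s : ℝ) (hl : 0 ≤ l) (a : Fin k → ℝ) :
    ∫⁻ x, ENNReal.ofReal (Real.exp (-l * (y + a ⬝ᵥ x) ^ 2)) ∂(isoGaussian k s) =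
      ENNReal.ofReal ((√(1 + 2 * l * ((a ⬝ᵥ a) * s ^ 2)))⁻¹) *
        ENNReal.ofReal (Real.exp (-(l / (1 + 2 * l * ((a ⬝ᵥ a) * s ^ 2))) * y ^ 2)) := by
  have h := lintegral_exp_neg_mul_sq_gaussianReal l y hl ((a ⬝ᵥ a).toNNReal * (s ^ 2).toNNReal)
  rw [← map_dotProduct_pi_gaussianReal a, lintegral_map (by fun_prop) (by fun_prop)] at h
  rw [isoGaussian, h]
  push_cast
  rw [Real.coe_toNNReal _ (dotProduct_self_nonneg' a), Real.coe_toNNReal _ (sq_nonneg s)]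

instance (k : ℕ) (s : ℝ) : IsProbabilityMeasure (isoGaussian k s) := by
  unfold isoGaussian; infer_instance

lemma hasSubgaussianMGF_gaussianReal (v : NNReal) : HasSubgaussianMGF id v (gaussianReal 0 v) where
  integrable_exp_mul t := integrable_exp_mul_gaussianReal t
  mgf_le t := by
    rw [mgf_gaussianReal (by simp : (gaussianReal 0 v).map id = gaussianReal 0 v)]
    simp

/-- A coordinatewise tail bound for the norm of a Gaussian vector. -/
lemma isoGaussian_tail {k : ℕ} (s c : ℝ) (hc : 0 ≤ c) :
    (isoGaussian k s).real {x | c * √k < euclNorm x} ≤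
      k * (2 * Real.exp (-c ^ 2 / (2 * s ^ 2))) := by
  set g := gaussianReal 0 (s ^ 2).toNNReal with hg
  have hsub : {x : Fin k → ℝ | c * √k < euclNorm x} ⊆
      ⋃ i ∈ (Finset.univ : Finset (Fin k)), (fun x : Fin k → ℝ => x i) ⁻¹' {y | c ≤ |y|} := by
    intro x hx
    by_contra hno
    simp only [Finset.mem_univ, Set.iUnion_true, Set.mem_iUnion, Set.mem_preimage,
      not_exists] at hno
    have h1 : euclNorm x ≤ √(k * c ^ 2) := by
      refine Real.sqrt_le_sqrt ?_
      calc x ⬝ᵥ x = ∑ i, x i ^ 2 := by simp [dotProduct, sq]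
        _ ≤ ∑ _i : Fin k, c ^ 2 := Finset.sum_le_sum fun i _ => by
            have : |x i| < c := lt_of_not_ge (hno i)
            exact sq_le_sq' (by linarith [(abs_lt.1 this).1]) (abs_lt.1 this).2.le
        _ = k * c ^ 2 := by simp
    rw [Real.sqrt_mul (by positivity), Real.sqrt_sq hc, mul_comm] at h1
    exact absurd hx (not_lt.2 h1)
  have hms : MeasurableSet {y : ℝ | c ≤ |y|} :=
    (isClosed_le continuous_const continuous_abs).measurableSet
  have htail : g.real {y | c ≤ |y|} ≤ 2 * Real.exp (-c ^ 2 / (2 * s ^ 2)) := by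
    have h1 := (hasSubgaussianMGF_gaussianReal (s ^ 2).toNNReal)
    have h2 := h1.measure_ge_le hc
    have h3 := h1.neg.measure_ge_le hc
    rw [Real.coe_toNNReal _ (sq_nonneg s)] at h2 h3
    have h4 : {y : ℝ | c ≤ |y|} ⊆ {y | c ≤ id y} ∪ {y | c ≤ (-id) y} := by
      intro y hy
      exact le_abs.1 (show c ≤ |y| from hy)
    have h5 := (measureReal_mono (μ := g) h4).trans (measureReal_union_le _ _)
    linarith
  refine (measureReal_mono hsub (measure_ne_top _ _)).trans
    ((measureReal_biUnion_finset_le _ _).trans ?_)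
  calc _ ≤ ∑ _i : Fin k, 2 * Real.exp (-c ^ 2 / (2 * s ^ 2)) := Finset.sum_le_sum fun i _ => by
        have h1 := (measurePreserving_eval (fun _ : Fin k => g) i).measure_preimage
          hms.nullMeasurableSet
        have : (isoGaussian k s).real ((fun x : Fin k → ℝ => x i) ⁻¹' {y | c ≤ |y|}) =
            g.real {y | c ≤ |y|} := congrArg ENNReal.toReal h1
        rw [this]
        exact htail
    _ = _ := by simp

end GaussianIntegral

/-! ### Excitation of the regressor along a fixed direction. -/

open scoped Matrix.Norms.L2Operator in
lemma specNorm_transpose {p q : Type*} [Fintype p] [Fintype q] [DecidableEq p] [DecidableEq q]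
    (M : Matrix p q ℝ) : specNorm Mᵀ = specNorm M := by
  have := Matrix.l2_opNorm_conjTranspose M
  rwa [Matrix.conjTranspose_eq_transpose_of_trivial] at this

lemma dotProduct_regressor {n d : ℕ} (v : Fin n ⊕ Fin d → ℝ) (x : Fin n → ℝ) (a : Fin d → ℝ) :
    v ⬝ᵥ regressor x a = (v ∘ Sum.inl) ⬝ᵥ x + (v ∘ Sum.inr) ⬝ᵥ a := by
  simp [dotProduct, regressor, Fintype.sum_sum_type]

/-- `2 κ √2 > e` forces `τ₀ > 2`, so at most about one third of the steps redraw the policy. -/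
lemma Setting.three_le_tau {n d : ℕ} {P : Setting n d} (hP : P.Standing) : 3 ≤ P.τ₀ := by
  have h1 : (1 : ℝ) ≤ P.γ⁻¹ := (one_le_inv₀ hP.γ_pos).2 hP.γ_le_one
  have hs : (1.4 : ℝ) < √2 := by
    rw [Real.lt_sqrt (by norm_num)]; norm_num
  have hκ := hP.one_le_κ
  have h2 : Real.exp 1 < 2 * P.κ * √2 := by
    have := Real.exp_one_lt_d9
    nlinarith
  have h3 : (1 : ℝ) < Real.log (2 * P.κ * √2) := by
    rwa [Real.lt_log_iff_exp_lt (by positivity)]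
  have h4 : (2 : ℝ) < 2 * P.γ⁻¹ * Real.log (2 * P.κ * √2) := by nlinarith
  have h5 : 2 < P.τ₀ := by
    have : ((2 : ℕ) : ℝ) < (P.τ₀ : ℝ) := by
      push_cast
      exact h4.trans_le (Nat.le_ceil _)
    exact_mod_cast this
  exact h5

/-- Excitation of the regressor: the variance of its component along `v`. -/
lemma excitation_ge {n d : ℕ} {κ : ℝ} (hκ : 1 ≤ κ) (v₁ : Fin n → ℝ) (v₂ : Fin d → ℝ)
    (K : Matrix (Fin d) (Fin n) ℝ) (hK : specNorm K ≤ κ) :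
    v₁ ⬝ᵥ v₁ + v₂ ⬝ᵥ v₂ ≤
      2 * ((v₁ + v₂ ᵥ* K) ⬝ᵥ (v₁ + v₂ ᵥ* K) + 2 * κ ^ 2 * (v₂ ⬝ᵥ v₂)) := by
  set y := v₂ ᵥ* K with hy
  have h1 : y ⬝ᵥ y ≤ κ ^ 2 * (v₂ ⬝ᵥ v₂) := by
    rw [← euclNorm_sq, ← euclNorm_sq, ← mul_pow]
    refine pow_le_pow_left₀ (euclNorm_nonneg _) ?_ 2
    rw [hy, ← Matrix.mulVec_transpose]
    refine (euclNorm_mulVec_le_specNorm _ _).trans ?_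
    rw [specNorm_transpose]
    exact mul_le_mul_of_nonneg_right hK (euclNorm_nonneg _)
  have h2 := dotProduct_self_nonneg' v₂
  -- This is the parallelogram bound `|v₁|² ≤ 2 |v₁ + y|² + 2 |y|²`; the difference of the two sides
  -- is `|v₁ + 2 y|²`.
  have h3 := dotProduct_self_nonneg' (v₁ + y + y)
  have h4 : v₂ ⬝ᵥ v₂ ≤ κ ^ 2 * (v₂ ⬝ᵥ v₂) := by
    refine le_mul_of_one_le_left h2 ?_
    nlinarith
  simp only [dotProduct_add, add_dotProduct] at h3 ⊢
  have h5 := dotProduct_comm v₁ y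
  linarith

namespace Run

variable {n d : ℕ} {P : Setting n d} {reg Tw : ℝ} {Ω : Type u} [mΩ : MeasurableSpace Ω]
  {pr : Measure Ω} (r : Run P reg Tw Ω pr)

lemma controllerInfo_le (t : ℕ) : controllerInfo r.F r.x t ≤ mΩ := by
  refine sup_le ?_ ?_
  · cases t with
    | zero => exact bot_le
    | succ s => exact r.F.le s
  · exact ((r.measurable_x t).mono (r.F.le t) le_rfl).comap_le

lemma filtration_le_controllerInfo (s : ℕ) : r.F s ≤ controllerInfo r.F r.x (s + 1) := le_sup_left

lemma measurable_state_controllerInfo (t : ℕ) : Measurable[controllerInfo r.F r.x t] (r.x t) :=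
  (comap_measurable (r.x t)).mono le_sup_right le_rfl

/-- Almost surely all samples lie in the parameter set. -/
lemma ae_sample_mem [IsProbabilityMeasure pr] (hP : P.Standing) :
    ∀ᵐ ω ∂pr, ∀ t, r.sample t ω ∈ P.params := by
  rw [ae_all_iff]
  intro t
  have hs := r.sample_law t
  have h1 := hs.integral_indicator_eq (r.controllerInfo_le t) (s := Set.univ) MeasurableSet.univ
    hP.measurableSet_params
  have h2 := hs.integral_indicator_eq (r.controllerInfo_le t) (s := Set.univ) MeasurableSet.univ
    MeasurableSet.univ
  -- The parameter set and the whole space have equal mass under the sampling law, so the sample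
  -- lies in both with the same probability, namely one. The acceptance probability need not be
  -- known to be positive.
  have h3 : ∀ (Θhat : Param n d) (b : ℝ) (V : Matrix (Fin n ⊕ Fin d) (Fin n ⊕ Fin d) ℝ),
      (samplingLaw P Θhat b V).real P.params = (samplingLaw P Θhat b V).real Set.univ := by
    intro Θhat b V
    rw [samplingLaw, measureReal_def, measureReal_def, cond_apply hP.measurableSet_params,
      cond_apply hP.measurableSet_params, Set.inter_self, Set.inter_univ]
  simp only [h3] at h1
  rw [← h2] at h1
  simp only [Set.univ_inter, Set.preimage_univ, probReal_univ] at h1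
  have hms : MeasurableSet (r.sample t ⁻¹' P.params) := hs.1 hP.measurableSet_params
  have h4 : pr.real (r.sample t ⁻¹' P.params)ᶜ = 0 := by
    rw [probReal_compl_eq_one_sub hms, h1, sub_self]
  exact (measureReal_eq_zero_iff).1 h4

lemma measurable_linear_regressor (v : Fin n ⊕ Fin d → ℝ) (s : ℕ) :
    Measurable[r.F s] fun ω => v ⬝ᵥ regressor (r.x s ω) (r.a s ω) := by
  simp_rw [dotProduct_regressor]
  have h1 : Measurable fun y : Fin n → ℝ => (v ∘ Sum.inl) ⬝ᵥ y :=
    (by fun_prop : Continuous fun y : Fin n → ℝ => (v ∘ Sum.inl) ⬝ᵥ y).measurable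
  have h2 : Measurable fun y : Fin d → ℝ => (v ∘ Sum.inr) ⬝ᵥ y :=
    (by fun_prop : Continuous fun y : Fin d → ℝ => (v ∘ Sum.inr) ⬝ᵥ y).measurable
  exact (h1.comp (r.measurable_x s)).add (h2.comp (r.measurable_a s))

/-- One step of the exponential supermartingale that controls the excitation along `v`. -/
lemma lintegral_exp_step [IsProbabilityMeasure pr] (hP : P.Standing) (v : Fin n ⊕ Fin d → ℝ)
    {l : ℝ} (hl : 0 ≤ l) {s : ℕ} (hs : ((s + 1 : ℕ) : ℝ) ≤ Tw) (hdvd : ¬ P.τ₀ ∣ s + 1)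
    {Z : Ω → ENNReal} (hZ : Measurable[r.F s] Z) :
    ∫⁻ ω, Z ω * ENNReal.ofReal
      (Real.exp (-l * (v ⬝ᵥ regressor (r.x (s + 1) ω) (r.a (s + 1) ω)) ^ 2)) ∂pr ≤
      ENNReal.ofReal (√(1 + l * (P.σ ^ 2 * (v ⬝ᵥ v))))⁻¹ * ∫⁻ ω, Z ω ∂pr := by
  set j := (s + 1) / P.τ₀ * P.τ₀ with hj
  -- At a non-multiple of `τ₀` the deployed policy was drawn by time `s`, so the gain is known
  -- before `w s`. At a multiple, the fresh sample depends on `x (s + 1)`, and the noise could not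
  -- be integrated out this way.
  have hjs : j ≤ s := by
    have h1 : j ≤ s + 1 := Nat.div_mul_le_self _ _
    have h2 : j ≠ s + 1 := fun h => hdvd ⟨(s + 1) / P.τ₀, by rw [mul_comm]; exact h.symm⟩
    omega
  set v₁ := v ∘ Sum.inl with hv₁
  set v₂ := v ∘ Sum.inr with hv₂
  set k : Ω → Fin n → ℝ := fun ω => v₁ + v₂ ᵥ* P.gain (r.sample j ω) with hk
  have hkm : Measurable[r.F s] k := by
    have h1 : Measurable[r.F s] (r.sample j) :=
      (r.measurable_sample j).mono (r.F.mono hjs) le_rfl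
    have h2 : Measurable fun K : Matrix (Fin d) (Fin n) ℝ => v₁ + v₂ ᵥ* K :=
      (by fun_prop : Continuous fun K : Matrix (Fin d) (Fin n) ℝ => v₁ + v₂ ᵥ* K).measurable
    exact h2.comp ((Setting.measurable_gain hP).comp h1)
  have hY : ∀ ω, v ⬝ᵥ regressor (r.x (s + 1) ω) (r.a (s + 1) ω) =
      k ω ⬝ᵥ r.x (s + 1) ω + v₂ ⬝ᵥ r.ν (s + 1) ω := by
    intro ω
    rw [dotProduct_regressor, r.a_explore _ ω hs, dotProduct_add, Matrix.dotProduct_mulVec, hk,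
      add_dotProduct]
    ring
  have hdot : Measurable fun q : (Fin n → ℝ) × (Fin n → ℝ) => q.1 ⬝ᵥ q.2 :=
    (by fun_prop : Continuous fun q : (Fin n → ℝ) × (Fin n → ℝ) => q.1 ⬝ᵥ q.2).measurable
  have hdot2 : Measurable fun q : Fin d → ℝ => v₂ ⬝ᵥ q :=
    (by fun_prop : Continuous fun q : Fin d → ℝ => v₂ ⬝ᵥ q).measurable
  set s₂ := √2 * P.κ * P.σ with hs₂
  set c₁ := 1 + 2 * l * ((v₂ ⬝ᵥ v₂) * s₂ ^ 2) with hc₁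
  have hvv := dotProduct_self_nonneg' v₂
  have hc₁pos : 0 < c₁ := by positivity
  -- integrate out the exploration noise
  have step1 : ∫⁻ ω, Z ω * ENNReal.ofReal
      (Real.exp (-l * (v ⬝ᵥ regressor (r.x (s + 1) ω) (r.a (s + 1) ω)) ^ 2)) ∂pr =
      ∫⁻ ω, Z ω * (ENNReal.ofReal (√c₁)⁻¹ *
        ENNReal.ofReal (Real.exp (-(l / c₁) * (k ω ⬝ᵥ r.x (s + 1) ω) ^ 2))) ∂pr := by
    have hm'le : controllerInfo r.F r.x (s + 1) ⊔
        MeasurableSpace.comap (r.sample (s + 1)) inferInstance ≤ mΩ :=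
      sup_le (r.controllerInfo_le _)
      ((r.measurable_sample (s + 1)).mono (r.F.le _) le_rfl).comap_le
    have hF : r.F s ≤ controllerInfo r.F r.x (s + 1) ⊔
        MeasurableSpace.comap (r.sample (s + 1)) inferInstance :=
      (r.filtration_le_controllerInfo s).trans le_sup_left
    have hU : Measurable[controllerInfo r.F r.x (s + 1) ⊔
        MeasurableSpace.comap (r.sample (s + 1)) inferInstance] fun ω =>
      (Z ω, k ω ⬝ᵥ r.x (s + 1) ω) := by
      refine Measurable.prodMk (hZ.mono hF le_rfl) (hdot.comp (Measurable.prodMk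
        (hkm.mono hF le_rfl) ?_))
      exact (r.measurable_state_controllerInfo (s + 1)).mono le_sup_left le_rfl
    have hφ : Measurable fun q : (ENNReal × ℝ) × (Fin d → ℝ) =>
        q.1.1 * ENNReal.ofReal (Real.exp (-l * (q.1.2 + v₂ ⬝ᵥ q.2) ^ 2)) := by
      have : Measurable fun q : (ENNReal × ℝ) × (Fin d → ℝ) => v₂ ⬝ᵥ q.2 :=
        hdot2.comp measurable_snd
      exact measurable_fst.fst.mul (((measurable_fst.snd.add this).pow_const 2).const_mul (-l)
        |>.exp.ennreal_ofReal)
    have := (r.ν_law (s + 1)).lintegral_comp hm'le hU hφ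
    simp only [hY]
    refine this.trans (lintegral_congr fun ω => ?_)
    rw [lintegral_const_mul _ (by
      exact (((hdot2.const_add _).pow_const 2).const_mul (-l)).exp.ennreal_ofReal)]
    rw [lintegral_exp_neg_mul_sq_isoGaussian l _ s₂ hl v₂]
  rw [step1]
  set l' := l / c₁ with hl'
  have hl'0 : 0 ≤ l' := by positivity
  set y : Ω → ℝ := fun ω => k ω ⬝ᵥ P.Θsᵀ *ᵥ regressor (r.x s ω) (r.a s ω) with hy
  -- integrate out the process noise
  have step2 : ∫⁻ ω, Z ω * (ENNReal.ofReal (√c₁)⁻¹ *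
        ENNReal.ofReal (Real.exp (-l' * (k ω ⬝ᵥ r.x (s + 1) ω) ^ 2))) ∂pr =
      ∫⁻ ω, Z ω * (ENNReal.ofReal (√c₁)⁻¹ *
        (ENNReal.ofReal (√(1 + 2 * l' * ((k ω ⬝ᵥ k ω) * P.σ ^ 2)))⁻¹ *
        ENNReal.ofReal (Real.exp (-(l' / (1 + 2 * l' * ((k ω ⬝ᵥ k ω) * P.σ ^ 2))) *
          y ω ^ 2)))) ∂pr := by
    have hreg : Measurable[r.F s] fun ω => P.Θsᵀ *ᵥ regressor (r.x s ω) (r.a s ω) := by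
      refine @measurable_pi_lambda _ _ _ (r.F s) _ _ fun i => ?_
      exact r.measurable_linear_regressor (fun q => P.Θsᵀ i q) s
    have hU : Measurable[r.F s] fun ω => (Z ω, k ω, y ω) :=
      hZ.prodMk (hkm.prodMk (hdot.comp (hkm.prodMk hreg)))
    have hφ : Measurable fun q : (ENNReal × (Fin n → ℝ) × ℝ) × (Fin n → ℝ) =>
        q.1.1 * (ENNReal.ofReal (√c₁)⁻¹ *
          ENNReal.ofReal (Real.exp (-l' * (q.1.2.2 + q.1.2.1 ⬝ᵥ q.2) ^ 2))) := by
      have h1 : Measurable fun q : (ENNReal × (Fin n → ℝ) × ℝ) × (Fin n → ℝ) =>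
          q.1.2.1 ⬝ᵥ q.2 := hdot.comp (measurable_fst.snd.fst.prodMk measurable_snd)
      exact measurable_fst.fst.mul (((((measurable_fst.snd.snd.add h1).pow_const 2).const_mul
        (-l')).exp.ennreal_ofReal).const_mul _)
    have := (r.w_law s).lintegral_comp (r.F.le s) hU hφ
    simp only [r.x_succ, dotProduct_add]
    refine this.trans (lintegral_congr fun ω => ?_)
    have h1 : Measurable fun q : Fin n → ℝ =>
        ENNReal.ofReal (Real.exp (-l' * (y ω + k ω ⬝ᵥ q) ^ 2)) :=
      ((((hdot.comp (measurable_const.prodMk measurable_id)).const_add _).pow_const 2).const_mul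
        (-l')).exp.ennreal_ofReal
    rw [lintegral_const_mul _ (h1.const_mul _), lintegral_const_mul _ h1,
      lintegral_exp_neg_mul_sq_isoGaussian l' _ P.σ hl'0 (k ω)]
  rw [step2, ← lintegral_const_mul _ (hZ.mono (r.F.le s) le_rfl)]
  refine lintegral_mono_ae ?_
  filter_upwards [r.ae_sample_mem hP] with ω hω
  rw [mul_comm (ENNReal.ofReal _) (Z ω)]
  refine mul_le_mul_right ?_ (Z ω)
  have hkk := dotProduct_self_nonneg' (k ω)
  set c₂ := 1 + 2 * l' * ((k ω ⬝ᵥ k ω) * P.σ ^ 2) with hc₂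
  have hc₂pos : 0 < c₂ := by positivity
  calc _ ≤ ENNReal.ofReal (√c₁)⁻¹ * (ENNReal.ofReal (√c₂)⁻¹ * 1) := by
        gcongr
        rw [← ENNReal.ofReal_one]
        refine ENNReal.ofReal_le_ofReal ?_
        rw [Real.exp_le_one_iff, neg_mul, neg_nonpos]
        positivity
    _ = ENNReal.ofReal (√(c₁ * c₂))⁻¹ := by
        rw [mul_one, ← ENNReal.ofReal_mul (by positivity), Real.sqrt_mul hc₁pos.le, mul_inv]
    _ ≤ _ := by
        refine ENNReal.ofReal_le_ofReal (inv_anti₀ ?_ (Real.sqrt_le_sqrt ?_))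
        · have := dotProduct_self_nonneg' v
          positivity
        · have h1 := excitation_ge hP.one_le_κ v₁ v₂ _ (hP.params_subset (hω j)).1.1
          have h2 : v ⬝ᵥ v = v₁ ⬝ᵥ v₁ + v₂ ⬝ᵥ v₂ := by
            simp [dotProduct, Fintype.sum_sum_type, hv₁, hv₂]
          -- Since `l' = l / c₁`, the two factors combine into one containing the total variance of
          -- the component along `v`.
          have h3 : c₁ * c₂ = 1 + 2 * l * P.σ ^ 2 *
              (k ω ⬝ᵥ k ω + 2 * P.κ ^ 2 * (v₂ ⬝ᵥ v₂)) := by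
            rw [hc₂, hl']
            have : s₂ ^ 2 = 2 * P.κ ^ 2 * P.σ ^ 2 := by
              rw [hs₂, mul_pow, mul_pow, Real.sq_sqrt (by norm_num)]
            have h4 : c₁ * (1 + 2 * (l / c₁) * ((k ω ⬝ᵥ k ω) * P.σ ^ 2)) =
                c₁ + 2 * l * ((k ω ⬝ᵥ k ω) * P.σ ^ 2) := by field_simp
            rw [h4, hc₁, this]
            ring
          rw [h3, h2]
          have h4 := mul_le_mul_of_nonneg_left h1 (show 0 ≤ l * P.σ ^ 2 by positivity)
          linarith

/-- The exponential supermartingale bound for the excitation along `v`. -/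
lemma lintegral_exp_sum_le [IsProbabilityMeasure pr] (hP : P.Standing) (v : Fin n ⊕ Fin d → ℝ)
    {l : ℝ} (hl : 0 ≤ l) (t : ℕ) (ht : ∀ i < t, (i : ℝ) ≤ Tw) :
    ∫⁻ ω, ENNReal.ofReal (Real.exp (-l * ∑ i ∈ Finset.range t,
      (v ⬝ᵥ regressor (r.x i ω) (r.a i ω)) ^ 2)) ∂pr ≤
      ENNReal.ofReal (√(1 + l * (P.σ ^ 2 * (v ⬝ᵥ v))))⁻¹ ^
        ((Finset.range t).filter fun i => ¬ P.τ₀ ∣ i).card := by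
  induction t with
  | zero => simp
  | succ t ih =>
    have ih' := ih fun i hi => ht i (by omega)
    set q := ENNReal.ofReal (√(1 + l * (P.σ ^ 2 * (v ⬝ᵥ v))))⁻¹
    have hsplit : ∀ ω, ENNReal.ofReal (Real.exp (-l * ∑ i ∈ Finset.range (t + 1),
        (v ⬝ᵥ regressor (r.x i ω) (r.a i ω)) ^ 2)) =
        ENNReal.ofReal (Real.exp (-l * ∑ i ∈ Finset.range t,
          (v ⬝ᵥ regressor (r.x i ω) (r.a i ω)) ^ 2)) *
        ENNReal.ofReal (Real.exp (-l * (v ⬝ᵥ regressor (r.x t ω) (r.a t ω)) ^ 2)) := by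
      intro ω
      rw [← ENNReal.ofReal_mul (Real.exp_nonneg _), ← Real.exp_add, Finset.sum_range_succ,
        mul_add]
    simp_rw [hsplit]
    -- At redraw times the factor is only bounded by one. This includes `t = 0`, so otherwise `t`
    -- has a predecessor.
    by_cases hd : P.τ₀ ∣ t
    · rw [Finset.range_add_one, Finset.filter_insert, if_neg (not_not.2 hd)]
      refine le_trans (lintegral_mono fun ω => ?_) ih'
      refine mul_le_of_le_one_right zero_le ?_
      rw [← ENNReal.ofReal_one]
      refine ENNReal.ofReal_le_ofReal ?_
      rw [Real.exp_le_one_iff, neg_mul, neg_nonpos]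
      positivity
    · rw [Finset.range_add_one, Finset.filter_insert, if_pos hd, Finset.card_insert_of_notMem
        (by simp), pow_succ']
      obtain ⟨s, rfl⟩ : ∃ s, t = s + 1 := ⟨t - 1, by
        have : t ≠ 0 := fun h => hd (by simp [h])
        omega⟩
      have hZ : Measurable[r.F s] fun ω => ENNReal.ofReal (Real.exp (-l * ∑ i ∈ Finset.range (s + 1),
          (v ⬝ᵥ regressor (r.x i ω) (r.a i ω)) ^ 2)) := by
        have : Measurable[r.F s] fun ω => ∑ i ∈ Finset.range (s + 1),
          (v ⬝ᵥ regressor (r.x i ω) (r.a i ω)) ^ 2 :=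
          Finset.measurable_fun_sum _ fun i hi =>
            ((r.measurable_linear_regressor v i).mono
              (r.F.mono (Nat.lt_succ_iff.1 (Finset.mem_range.1 hi))) le_rfl).pow_const 2
        exact (this.const_mul (-l)).exp.ennreal_ofReal
      exact (r.lintegral_exp_step hP v hl (ht (s + 1) (by omega)) hd hZ).trans
        (mul_le_mul_right ih' _)

end Run

/-! ### From a grid of directions to all directions. -/

/-- The grid of mesh `1 / k` in the unit cube. -/
def gridPoint {ι : Type*} (k : ℕ) (j : ι → ℤ) : ι → ℝ := fun i => (j i : ℝ) / k

/-- A quadratic form that is large on a fine grid is large on the unit sphere. -/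
lemma le_sum_sq_of_grid {ι : Type*} [Fintype ι] [DecidableEq ι] {z : ℕ → ι → ℝ} {t k : ℕ}
    {B c : ℝ} (hk0 : 0 < k) (hk : 14 * (Fintype.card ι : ℝ) ≤ (k : ℝ) ^ 2)
    (hB : ∑ s ∈ Finset.range t, z s ⬝ᵥ z s ≤ B) (hBc : Fintype.card ι * B ≤ c * (k : ℝ) ^ 2)
    (hgrid : ∀ j ∈ Fintype.piFinset fun _ : ι => Finset.Icc (-(k : ℤ)) k,
      1 / 2 ≤ gridPoint k j ⬝ᵥ gridPoint k j →
      4 * c ≤ ∑ s ∈ Finset.range t, (gridPoint k j ⬝ᵥ z s) ^ 2) (y : ι → ℝ) :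
    c * (y ⬝ᵥ y) ≤ ∑ s ∈ Finset.range t, (y ⬝ᵥ z s) ^ 2 := by
  have hk' : (0 : ℝ) < k := by exact_mod_cast hk0
  have key : ∀ u : ι → ℝ, u ⬝ᵥ u = 1 → c ≤ ∑ s ∈ Finset.range t, (u ⬝ᵥ z s) ^ 2 := by
    intro u hu
    set j : ι → ℤ := fun i => ⌊k * u i⌋ with hj
    set v := gridPoint k j with hv
    have hu1 : ∀ i, |u i| ≤ 1 := by
      intro i
      rw [← sq_le_one_iff_abs_le_one, ← hu, sq]
      exact Finset.single_le_sum (f := fun i => u i * u i) (fun i _ => mul_self_nonneg _)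
        (Finset.mem_univ i)
    have hjm : j ∈ Fintype.piFinset fun _ : ι => Finset.Icc (-(k : ℤ)) k := by
      rw [Fintype.mem_piFinset]
      intro i
      have h1 := abs_le.1 (hu1 i)
      rw [Finset.mem_Icc]
      constructor
      · rw [Int.le_floor]; push_cast; nlinarith [h1.1]
      · have : (⌊k * u i⌋ : ℝ) ≤ k := (Int.floor_le _).trans (by nlinarith [h1.2])
        exact_mod_cast this
    have hdiff : ∀ i, (u i - v i) ^ 2 ≤ 1 / (k : ℝ) ^ 2 := by
      intro i
      have h1 := Int.floor_le (k * u i)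
      have h2 := Int.lt_floor_add_one (k * u i)
      have e1 : u i - v i = (k * u i - ⌊k * u i⌋) / k := by
        simp only [hv, gridPoint, hj]; field_simp
      rw [e1, div_pow]
      gcongr
      nlinarith
    have hdd : (u - v) ⬝ᵥ (u - v) ≤ Fintype.card ι / (k : ℝ) ^ 2 := by
      calc (u - v) ⬝ᵥ (u - v) = ∑ i, (u i - v i) ^ 2 := by simp [dotProduct, sq]
        _ ≤ ∑ _i : ι, 1 / (k : ℝ) ^ 2 := Finset.sum_le_sum fun i _ => hdiff i
        _ = _ := by simp [div_eq_mul_inv]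
    have hdd14 : (u - v) ⬝ᵥ (u - v) ≤ 1 / 14 := by
      refine hdd.trans ?_
      rw [div_le_div_iff₀ (by positivity) (by norm_num)]
      linarith
    have hvv : 1 / 2 ≤ v ⬝ᵥ v := by
      -- This yields `1 = |u|² ≤ (5/4) |v|² + 5 |u - v|²`; with `|u - v|² ≤ 1/14` it follows that
      -- `|v|² ≥ 18/35 > 1/2`.
      have h1 := dotProduct_self_nonneg' ((1 / 2 : ℝ) • v - (2 : ℝ) • (u - v))
      have h2 : u ⬝ᵥ u = v ⬝ᵥ v + 2 * (v ⬝ᵥ (u - v)) + (u - v) ⬝ᵥ (u - v) := by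
        simp only [dotProduct_sub, sub_dotProduct, dotProduct_comm u v]; ring
      simp only [dotProduct_sub, sub_dotProduct, smul_dotProduct, dotProduct_smul,
        smul_eq_mul] at h1 h2 hdd14 ⊢
      have h3 := dotProduct_comm u v
      linarith
    have h4 := hgrid j hjm hvv
    -- The grid bound `4 c` loses a factor `2` here and then `2 c` to the discretization error,
    -- which leaves `c` after division by `2`.
    have h5 : ∀ s, (v ⬝ᵥ z s) ^ 2 ≤
        2 * (u ⬝ᵥ z s) ^ 2 + 2 * (((u - v) ⬝ᵥ (u - v)) * (z s ⬝ᵥ z s)) := by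
      intro s
      have h6 : ((u - v) ⬝ᵥ z s) ^ 2 ≤ ((u - v) ⬝ᵥ (u - v)) * (z s ⬝ᵥ z s) := by
        rw [← euclNorm_sq, ← euclNorm_sq, ← mul_pow]
        exact sq_le_sq.2 ((abs_dotProduct_le _ _).trans (le_abs_self _))
      have h7 : v ⬝ᵥ z s = u ⬝ᵥ z s - (u - v) ⬝ᵥ z s := by rw [sub_dotProduct]; ring
      rw [h7]
      nlinarith [sq_nonneg (u ⬝ᵥ z s + (u - v) ⬝ᵥ z s)]
    have h8 : ∑ s ∈ Finset.range t, (v ⬝ᵥ z s) ^ 2 ≤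
        2 * ∑ s ∈ Finset.range t, (u ⬝ᵥ z s) ^ 2 +
          2 * (((u - v) ⬝ᵥ (u - v)) * ∑ s ∈ Finset.range t, z s ⬝ᵥ z s) := by
      refine (Finset.sum_le_sum fun s _ => h5 s).trans_eq ?_
      rw [Finset.sum_add_distrib, Finset.mul_sum, Finset.mul_sum, Finset.mul_sum]
    have hS0 : 0 ≤ ∑ s ∈ Finset.range t, z s ⬝ᵥ z s :=
      Finset.sum_nonneg fun s _ => dotProduct_self_nonneg' _
    have h9 : ((u - v) ⬝ᵥ (u - v)) * ∑ s ∈ Finset.range t, z s ⬝ᵥ z s ≤ c := by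
      calc _ ≤ Fintype.card ι / (k : ℝ) ^ 2 * B :=
            mul_le_mul hdd hB hS0 (by positivity)
        _ = Fintype.card ι * B / (k : ℝ) ^ 2 := by ring
        _ ≤ c := by rw [div_le_iff₀ (by positivity)]; exact hBc
    linarith
  rcases eq_or_ne y 0 with rfl | hy
  · simp
  · have hpos : 0 < euclNorm y := by
      rw [euclNorm_eq_norm, norm_pos_iff]
      simpa using hy
    have h1 := key ((euclNorm y)⁻¹ • y) (by
      rw [smul_dotProduct, dotProduct_smul, ← euclNorm_sq, smul_eq_mul, smul_eq_mul]
      field_simp)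
    have h2 : ∑ s ∈ Finset.range t, (((euclNorm y)⁻¹ • y) ⬝ᵥ z s) ^ 2 =
        (euclNorm y ^ 2)⁻¹ * ∑ s ∈ Finset.range t, (y ⬝ᵥ z s) ^ 2 := by
      rw [Finset.mul_sum]
      refine Finset.sum_congr rfl fun s _ => ?_
      rw [smul_dotProduct, smul_eq_mul, mul_pow, inv_pow]
    rw [h2, le_inv_mul_iff₀ (by positivity), mul_comm, euclNorm_sq] at h1
    exact h1

lemma regressor_dotProduct_self {n d : ℕ} (x : Fin n → ℝ) (a : Fin d → ℝ) :
    regressor x a ⬝ᵥ regressor x a = x ⬝ᵥ x + a ⬝ᵥ a := by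
  rw [dotProduct_regressor]; rfl

lemma regressor_sq_le {n d : ℕ} {κ X b : ℝ} (hκ : 1 ≤ κ) {x : Fin n → ℝ} {ν : Fin d → ℝ}
    {K : Matrix (Fin d) (Fin n) ℝ} (hK : specNorm K ≤ κ) (hx : euclNorm x ≤ X)
    (hν : euclNorm ν ≤ b) :
    regressor x (K *ᵥ x + ν) ⬝ᵥ regressor x (K *ᵥ x + ν) ≤ 3 * κ ^ 2 * X ^ 2 + 2 * b ^ 2 := by
  rw [regressor_dotProduct_self]
  have hx2 : x ⬝ᵥ x ≤ X ^ 2 := by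
    rw [← euclNorm_sq]; exact pow_le_pow_left₀ (euclNorm_nonneg _) hx 2
  have hν2 : ν ⬝ᵥ ν ≤ b ^ 2 := by
    rw [← euclNorm_sq]; exact pow_le_pow_left₀ (euclNorm_nonneg _) hν 2
  have hKx : (K *ᵥ x) ⬝ᵥ (K *ᵥ x) ≤ κ ^ 2 * X ^ 2 := by
    rw [← euclNorm_sq, ← mul_pow]
    refine pow_le_pow_left₀ (euclNorm_nonneg _) ?_ 2
    exact (euclNorm_mulVec_le_specNorm _ _).trans
      (mul_le_mul hK hx (euclNorm_nonneg _) (by linarith))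
  have h1 := dotProduct_self_nonneg' (K *ᵥ x - ν)
  simp only [dotProduct_sub, sub_dotProduct, dotProduct_add, add_dotProduct] at h1 ⊢
  have h2 : X ^ 2 ≤ κ ^ 2 * X ^ 2 := le_mul_of_one_le_left (sq_nonneg _) (by nlinarith)
  linarith

lemma dotProduct_design_mulVec {n d : ℕ} (reg : ℝ) (x : ℕ → Fin n → ℝ) (a : ℕ → Fin d → ℝ)
    (t : ℕ) (y : Fin n ⊕ Fin d → ℝ) :
    y ⬝ᵥ design reg x a t *ᵥ y =
      reg * (y ⬝ᵥ y) + ∑ s ∈ Finset.range t, (y ⬝ᵥ regressor (x s) (a s)) ^ 2 := by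
  rw [design, Matrix.add_mulVec, dotProduct_add, Matrix.sum_mulVec, dotProduct_sum,
    Matrix.smul_mulVec, Matrix.one_mulVec, dotProduct_smul, smul_eq_mul]
  congr 1
  refine Finset.sum_congr rfl fun s _ => ?_
  rw [Matrix.vecMulVec_mulVec, sq]
  simp [dotProduct_comm]

lemma design_transpose {n d : ℕ} (reg : ℝ) (x : ℕ → Fin n → ℝ) (a : ℕ → Fin d → ℝ) (t : ℕ) :
    (design reg x a t)ᵀ = design reg x a t := by
  simp [design, Matrix.transpose_add, Matrix.transpose_sum, Matrix.transpose_vecMulVec]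

/-! ### The exploration is typical with high probability on the good event. -/

namespace Run

variable {n d : ℕ} {P : Setting n d} {reg Tw : ℝ} {Ω : Type u} [mΩ : MeasurableSpace Ω]
  {pr : Measure Ω} (r : Run P reg Tw Ω pr)

lemma card_filter_not_dvd_ge {p N : ℕ} (hp : 3 ≤ p) :
    N - N / 3 ≤ ((Finset.range (N + 1)).filter fun i => ¬ p ∣ i).card := by
  have h1 : ((Finset.Ioc 0 N).filter fun i => p ∣ i).card = N / p :=
    Nat.Ioc_filter_dvd_card_eq_div N p
  have h2 := Finset.card_filter_add_card_filter_not (s := Finset.Ioc 0 N) (p := fun i => p ∣ i)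
  rw [h1, Nat.card_Ioc, Nat.sub_zero] at h2
  have h3 : N / p ≤ N / 3 := Nat.div_le_div_left hp (by norm_num)
  have h4 : ((Finset.Ioc 0 N).filter fun i => ¬ p ∣ i).card ≤
      ((Finset.range (N + 1)).filter fun i => ¬ p ∣ i).card := by
    refine Finset.card_le_card (Finset.filter_subset_filter _ fun i hi => ?_)
    rw [Finset.mem_Ioc] at hi
    rw [Finset.mem_range]
    omega
  omega

/-- The lower tail of the excitation along a fixed direction. -/
lemma measure_excitation_lt_le [IsProbabilityMeasure pr] (hP : P.Standing) (hTw : 1 ≤ Tw)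
    (v : Fin n ⊕ Fin d → ℝ) (hv : 1 / 2 ≤ v ⬝ᵥ v) :
    pr {ω | ∑ i ∈ Finset.range (⌊Tw⌋₊ + 1), (v ⬝ᵥ regressor (r.x i ω) (r.a i ω)) ^ 2 <
      Tw * P.σ ^ 2 / 20} ≤ ENNReal.ofReal (2 * Real.exp (-(Tw / 10))) := by
  have hσ := hP.σ_pos
  set N := ⌊Tw⌋₊ with hN
  -- With this `l`, each of the at least `(2/3)(Tw - 1)` useful steps contributes a factor at most
  -- `1/√2 ≤ exp(-3/10)`, in total at most `2 exp(-Tw/5)`. The threshold costs `exp(Tw/10)` in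
  -- Markov's inequality, leaving `2 exp(-Tw/10)`.
  set l := 2 / P.σ ^ 2 with hl
  have hl0 : 0 ≤ l := by positivity
  have hsum := r.lintegral_exp_sum_le hP v hl0 (N + 1) (fun i hi =>
    (Nat.le_floor_iff (by linarith)).1 (Nat.lt_succ_iff.1 hi))
  set S : Ω → ℝ := fun ω => ∑ i ∈ Finset.range (N + 1), (v ⬝ᵥ regressor (r.x i ω) (r.a i ω)) ^ 2
    with hS
  have hSm : Measurable S := Finset.measurable_fun_sum _ fun i _ =>
    ((r.measurable_linear_regressor v i).mono (r.F.le i) le_rfl).pow_const 2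
  have hmarkov := mul_meas_ge_le_lintegral (μ := pr)
    (f := fun ω => ENNReal.ofReal (Real.exp (-l * S ω))) ((hSm.const_mul _).exp.ennreal_ofReal)
    (ENNReal.ofReal (Real.exp (-(Tw / 10))))
  have hsub : {ω | S ω < Tw * P.σ ^ 2 / 20} ⊆ {ω | ENNReal.ofReal (Real.exp (-(Tw / 10))) ≤
      ENNReal.ofReal (Real.exp (-l * S ω))} := by
    intro ω hω
    have hω' : S ω < Tw * P.σ ^ 2 / 20 := hω
    refine ENNReal.ofReal_le_ofReal (Real.exp_le_exp.2 ?_)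
    have h1 : l * S ω ≤ l * (Tw * P.σ ^ 2 / 20) := mul_le_mul_of_nonneg_left hω'.le hl0
    have h2 : l * (Tw * P.σ ^ 2 / 20) = Tw / 10 := by rw [hl]; field_simp; norm_num
    linarith
  set card := ((Finset.range (N + 1)).filter fun i => ¬ P.τ₀ ∣ i).card with hcard
  have hcard_ge : 2 / 3 * (Tw - 1) ≤ card := by
    have h1 := card_filter_not_dvd_ge (N := N) (Setting.three_le_tau hP)
    have h2 : 2 * N ≤ 3 * card := by omega
    have h3 : Tw < N + 1 := Nat.lt_floor_add_one Tw
    have h4 : 2 * (N : ℝ) ≤ 3 * card := by exact_mod_cast h2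
    linarith
  have hq : (√(1 + l * (P.σ ^ 2 * (v ⬝ᵥ v))))⁻¹ ≤ Real.exp (-(3 / 10)) := by
    have h1 : l * (P.σ ^ 2 * (v ⬝ᵥ v)) = 2 * (v ⬝ᵥ v) := by rw [hl]; field_simp
    have h2 : √2 ≤ √(1 + l * (P.σ ^ 2 * (v ⬝ᵥ v))) := by
      rw [h1]; exact Real.sqrt_le_sqrt (by linarith)
    have h3 : Real.exp (3 / 10) ≤ √2 := by
      refine Real.le_sqrt_of_sq_le ?_
      rw [← Real.exp_nat_mul, ← Real.le_log_iff_exp_le (by norm_num)]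
      have := Real.log_two_gt_d9
      push_cast
      linarith
    rw [Real.exp_neg]
    exact inv_anti₀ (Real.exp_pos _) (h3.trans h2)
  have hpow : ENNReal.ofReal (√(1 + l * (P.σ ^ 2 * (v ⬝ᵥ v))))⁻¹ ^ card ≤
      ENNReal.ofReal (2 * Real.exp (-(Tw / 5))) := by
    rw [← ENNReal.ofReal_pow (by positivity)]
    refine ENNReal.ofReal_le_ofReal ?_
    calc _ ≤ Real.exp (-(3 / 10)) ^ card := pow_le_pow_left₀ (by positivity) hq _
      _ = Real.exp (-(3 / 10) * card) := by rw [← Real.exp_nat_mul, mul_comm]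
      _ ≤ Real.exp (1 / 5 + -(Tw / 5)) := Real.exp_le_exp.2 (by linarith)
      _ = Real.exp (1 / 5) * Real.exp (-(Tw / 5)) := Real.exp_add _ _
      _ ≤ _ := by
        refine mul_le_mul_of_nonneg_right ?_ (Real.exp_nonneg _)
        rw [← Real.le_log_iff_exp_le (by norm_num)]
        linarith [Real.log_two_gt_d9]
  have h1 : ENNReal.ofReal (Real.exp (-(Tw / 10))) * pr {ω | S ω < Tw * P.σ ^ 2 / 20} ≤
      ENNReal.ofReal (2 * Real.exp (-(Tw / 5))) :=
    (mul_le_mul_right (measure_mono hsub) _).trans (hmarkov.trans (hsum.trans hpow))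
  have h2 : ENNReal.ofReal (2 * Real.exp (-(Tw / 5))) =
      ENNReal.ofReal (Real.exp (-(Tw / 10))) * ENNReal.ofReal (2 * Real.exp (-(Tw / 10))) := by
    rw [← ENNReal.ofReal_mul (Real.exp_nonneg _)]
    congr 1
    have : -(Tw / 5) = -(Tw / 10) + -(Tw / 10) := by ring
    rw [this, Real.exp_add]; ring
  rw [h2] at h1
  exact (ENNReal.mul_le_mul_iff_right (by simpa using Real.exp_pos _) ENNReal.ofReal_ne_top).1 h1

/-- The tail of the exploration noise. -/
lemma measure_noise_gt_le [IsProbabilityMeasure pr] (hP : P.Standing) (hd : 0 < d)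
    (hTw : 1 ≤ Tw) (s : ℕ) :
    pr {ω | P.κ * P.σ * √(8 * d * Real.log (d * Tw / P.δ)) < euclNorm (r.ν s ω)} ≤
      ENNReal.ofReal (2 * d * Real.exp (-(2 * Real.log (d * Tw / P.δ)))) := by
  have hσ := hP.σ_pos
  have hκ : 0 < P.κ := by linarith [hP.one_le_κ]
  have hd1 : (1 : ℝ) ≤ d := by exact_mod_cast hd
  set L := Real.log (d * Tw / P.δ) with hL
  have hL0 : 0 ≤ L := by
    refine Real.log_nonneg ?_
    rw [one_le_div hP.δ_pos]
    nlinarith [hP.δ_lt_one]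
  have hm : controllerInfo r.F r.x s ⊔ MeasurableSpace.comap (r.sample s) inferInstance ≤ mΩ :=
    sup_le (r.controllerInfo_le _) ((r.measurable_sample s).mono (r.F.le _) le_rfl).comap_le
  have hmap := (r.ν_law s).map_eq hm
  have hν : Measurable (r.ν s) := (r.ν_law s).1
  -- The constant `8` makes the exponent `-2 L`, so the tail decays like `Tw⁻²` and survives a union
  -- over about `Tw` steps.
  have htail := isoGaussian_tail (k := d) (√2 * P.κ * P.σ) (P.κ * P.σ * √(8 * L)) (by positivity)
  have e1 : P.κ * P.σ * √(8 * d * L) = P.κ * P.σ * √(8 * L) * √d := by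
    rw [mul_assoc (P.κ * P.σ), ← Real.sqrt_mul (by positivity)]
    congr 2; ring
  have e2 : -(P.κ * P.σ * √(8 * L)) ^ 2 / (2 * (√2 * P.κ * P.σ) ^ 2) = -(2 * L) := by
    rw [mul_pow (P.κ * P.σ), Real.sq_sqrt (by positivity), mul_pow (√2 * P.κ), mul_pow √2,
      Real.sq_sqrt (by norm_num)]
    field_simp; norm_num; ring
  have hms : MeasurableSet {x : Fin d → ℝ | P.κ * P.σ * √(8 * L) * √d < euclNorm x} := by
    have : Continuous fun x : Fin d → ℝ => euclNorm x := by unfold euclNorm; fun_prop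
    exact (isOpen_lt continuous_const this).measurableSet
  rw [e2, ← hmap, measureReal_def, Measure.map_apply hν hms] at htail
  rw [e1]
  refine (ENNReal.le_ofReal_iff_toReal_le (measure_ne_top _ _) (by positivity)).2 ?_
  refine (le_of_eq ?_).trans (htail.trans_eq (by ring))
  rfl

lemma natCast_mul_ofReal_le {m : ℕ} {a x : ℝ} (h : (m : ℝ) ≤ a) (hx : 0 ≤ x) :
    (m : ENNReal) * ENNReal.ofReal x ≤ ENNReal.ofReal (a * x) := by
  rw [← ENNReal.ofReal_natCast, ← ENNReal.ofReal_mul (by positivity)]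
  exact ENNReal.ofReal_le_ofReal (mul_le_mul_of_nonneg_right h hx)

/-- On the good event the exploration is typical up to a small probability. -/
theorem measure_goodEvent_diff_le [IsProbabilityMeasure pr] (hP : P.Standing) (hn : 0 < n)
    (hd : 0 < d) (hTw : 1 ≤ Tw) (ρ c : ℝ) (T k : ℕ) (hk0 : 0 < k)
    (hk : 14 * ((n : ℝ) + d) ≤ (k : ℝ) ^ 2)
    (hBk : ((n : ℝ) + d) * ((Tw + 1) * (3 * P.κ ^ 2 * (c * ((n : ℝ) + d) ^ (n + d)) ^ 2 +
      2 * (P.κ * P.σ * √(8 * d * Real.log (d * Tw / P.δ))) ^ 2)) ≤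
      Tw * P.σ ^ 2 / 80 * (k : ℝ) ^ 2) :
    pr (r.goodEvent ρ c T \ r.explorationEvent T) ≤
      ENNReal.ofReal ((Tw + 1) * (2 * d * Real.exp (-(2 * Real.log (d * Tw / P.δ)))) +
        (2 * k + 1) ^ (n + d) * (2 * Real.exp (-(Tw / 10)))) := by
  set b := P.κ * P.σ * √(8 * d * Real.log (d * Tw / P.δ)) with hb
  set X := c * ((n : ℝ) + d) ^ (n + d) with hX
  set N := ⌊Tw⌋₊ with hN
  have hNTw : (N : ℝ) ≤ Tw := Nat.floor_le (by linarith)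
  set J := (Fintype.piFinset fun _ : Fin n ⊕ Fin d => Finset.Icc (-(k : ℤ)) k).filter
    fun j => 1 / 2 ≤ gridPoint k j ⬝ᵥ gridPoint k j with hJ
  set A₁ := ⋃ s ∈ Finset.range (N + 1), {ω | b < euclNorm (r.ν s ω)} with hA₁
  set A₂ := ⋃ j ∈ J, {ω | ∑ i ∈ Finset.range (N + 1),
    (gridPoint k j ⬝ᵥ regressor (r.x i ω) (r.a i ω)) ^ 2 < Tw * P.σ ^ 2 / 20} with hA₂
  set A₃ := {ω | ¬ ∀ t, r.sample t ω ∈ P.params} with hA₃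
  have h3 : pr A₃ = 0 := r.ae_sample_mem hP
  have h1 : pr A₁ ≤ ENNReal.ofReal ((Tw + 1) *
      (2 * d * Real.exp (-(2 * Real.log (d * Tw / P.δ))))) := by
    refine (measure_biUnion_finset_le _ _).trans ?_
    refine (Finset.sum_le_sum fun s _ => r.measure_noise_gt_le hP hd hTw s).trans ?_
    rw [Finset.sum_const, Finset.card_range, nsmul_eq_mul]
    refine natCast_mul_ofReal_le ?_ (by positivity)
    push_cast
    linarith
  have h2 : pr A₂ ≤ ENNReal.ofReal ((2 * k + 1) ^ (n + d) * (2 * Real.exp (-(Tw / 10)))) := by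
    refine (measure_biUnion_finset_le _ _).trans ?_
    refine (Finset.sum_le_sum fun j hj => r.measure_excitation_lt_le hP hTw _
      (Finset.mem_filter.1 hj).2).trans ?_
    rw [Finset.sum_const, nsmul_eq_mul]
    refine natCast_mul_ofReal_le ?_ (by positivity)
    have hc : J.card ≤ (2 * k + 1) ^ (n + d) := by
      refine (Finset.card_filter_le _ _).trans_eq ?_
      rw [Fintype.card_piFinset]
      simp only [Int.card_Icc, Finset.prod_const, Finset.card_univ, Fintype.card_sum,
        Fintype.card_fin]
      congr 1
      omega
    exact_mod_cast hc
  -- The state bound of the good event controls the regressors, hence the error of passing from the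
  -- grid to the sphere. The grid threshold `Tw σ² / 20` is four times the constant `Tw σ² / 80`
  -- obtained.
  have hsub : r.goodEvent ρ c T \ r.explorationEvent T ⊆ A₁ ∪ A₂ ∪ A₃ := by
    rintro ω ⟨⟨-, hst⟩, hnot⟩
    by_contra hω
    simp only [Set.mem_union, not_or] at hω
    obtain ⟨⟨hω1, hω2⟩, hω3⟩ := hω
    have hω3' : ∀ t, r.sample t ω ∈ P.params := not_not.1 hω3
    have hν : ∀ s : ℕ, (s : ℝ) ≤ Tw → euclNorm (r.ν s ω) ≤ b := by
      intro s hs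
      by_contra hlt
      refine hω1 (Set.mem_biUnion (x := s) ?_ (not_le.1 hlt))
      have := (Nat.le_floor_iff (by linarith)).2 hs
      simp only [Finset.coe_range, Set.mem_Iio]
      omega
    have hTr : Tw ≤ P.Tr Tw := by
      have h1 : (1 : ℝ) ≤ n := by exact_mod_cast hn
      have : 0 ≤ Real.log ((n : ℝ) + d) := Real.log_nonneg (by
        have : (0 : ℝ) ≤ d := by positivity
        linarith)
      have h2 : 0 ≤ ((n : ℝ) + d) * P.τ₀ * Real.log ((n : ℝ) + d) := by positivity
      rw [Setting.Tr]; linarith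
    refine hnot ⟨hν, fun t htT htw => ?_⟩
    have hNt : N + 1 ≤ t := by
      have : (N : ℝ) < t := hNTw.trans_lt htw
      exact_mod_cast this
    set z : ℕ → Fin n ⊕ Fin d → ℝ := fun s => regressor (r.x s ω) (r.a s ω) with hz
    have hzb : ∀ s ∈ Finset.range (N + 1), z s ⬝ᵥ z s ≤ 3 * P.κ ^ 2 * X ^ 2 + 2 * b ^ 2 := by
      intro s hs
      have hsN : s ≤ N := Nat.lt_succ_iff.1 (Finset.mem_range.1 hs)
      have hsTw : (s : ℝ) ≤ Tw := (Nat.le_floor_iff (by linarith)).1 hsN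
      change regressor (r.x s ω) (r.a s ω) ⬝ᵥ regressor (r.x s ω) (r.a s ω) ≤ _
      rw [r.a_explore s ω hsTw]
      exact regressor_sq_le hP.one_le_κ (hP.params_subset (hω3' _)).1.1
        ((hst s (by omega)).1 (hsTw.trans hTr)) (hν s hsTw)
    have hcrd : (Fintype.card (Fin n ⊕ Fin d) : ℝ) = (n : ℝ) + d := by simp
    have hquad := le_sum_sq_of_grid (z := z) (t := N + 1) (k := k)
      (B := (Tw + 1) * (3 * P.κ ^ 2 * X ^ 2 + 2 * b ^ 2)) (c := Tw * P.σ ^ 2 / 80) hk0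
      (by rw [hcrd]; exact hk) (by
        refine (Finset.sum_le_sum hzb).trans ?_
        rw [Finset.sum_const, Finset.card_range, nsmul_eq_mul]
        refine mul_le_mul_of_nonneg_right ?_ (by positivity)
        push_cast; linarith) (by rw [hcrd]; exact hBk) (by
        intro j hj hjj
        by_contra hlt
        refine hω2 (Set.mem_biUnion (x := j) (Finset.mem_filter.2 ⟨hj, hjj⟩) ?_)
        have h1 : ∑ i ∈ Finset.range (N + 1),
            (gridPoint k j ⬝ᵥ regressor (r.x i ω) (r.a i ω)) ^ 2 < Tw * P.σ ^ 2 / 20 := by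
          have := not_le.1 hlt
          linarith
        exact h1)
    have h := le_of_dotProduct_mulVec (X := (reg + Tw * P.σ ^ 2 / 80) •
      (1 : Matrix (Fin n ⊕ Fin d) (Fin n ⊕ Fin d) ℝ)) (Y := r.V t ω) (by simp)
      (design_transpose _ _ _ _) (fun y => by
        rw [Run.V, dotProduct_design_mulVec, Matrix.smul_mulVec, Matrix.one_mulVec,
          dotProduct_smul, smul_eq_mul]
        have h1 := hquad y
        -- Rounds after the exploration phase only increase the design matrix.
        have h2 : ∑ s ∈ Finset.range (N + 1), (y ⬝ᵥ z s) ^ 2 ≤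
            ∑ s ∈ Finset.range t, (y ⬝ᵥ z s) ^ 2 :=
          Finset.sum_le_sum_of_subset_of_nonneg (Finset.range_subset_range.2 hNt)
            fun _ _ _ => sq_nonneg _
        linarith)
    exact h
  refine (measure_mono hsub).trans ((measure_union_le _ _).trans ?_)
  rw [h3, add_zero, ENNReal.ofReal_add (by positivity) (by positivity)]
  exact (measure_union_le _ _).trans (add_le_add h1 h2)

end Run

/-! ### Conditioning on the estimation event. -/

section CondExp

/-- On an event of `m`, the conditioned measure is a constant multiple of the original one, so the
defining set integrals of both conditional expectations agree. A null event makes the claim vacuous.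
-/
lemma condExp_cond_ae_eq {Ω : Type*} {m mΩ : MeasurableSpace Ω} {pr : Measure Ω}
    [IsProbabilityMeasure pr] (hm : m ≤ mΩ) {E : Set Ω} (hE : MeasurableSet[m] E)
    {f : Ω → ℝ} (hf : Integrable f pr) :
    ∀ᵐ ω ∂pr, ω ∈ E → condExp m (ProbabilityTheory.cond pr E) f ω = condExp m pr f ω := by
  by_cases h0 : pr E = 0
  · have : ∀ᵐ ω ∂pr, ω ∉ E := measure_eq_zero_iff_ae_notMem.1 h0
    filter_upwards [this] with ω h1 h2 using absurd h2 h1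
  have hEm : MeasurableSet E := hm _ hE
  have hc : (pr E)⁻¹ ≠ ⊤ := ENNReal.inv_ne_top.2 h0
  have hc0 : (pr E)⁻¹ ≠ 0 := ENNReal.inv_ne_zero.2 (measure_ne_top _ _)
  have := cond_isProbabilityMeasure h0
  have hint : ∀ {g : Ω → ℝ}, Integrable g pr → Integrable g (ProbabilityTheory.cond pr E) :=
    fun hg => hg.restrict.smul_measure hc
  have hset : ∀ (s : Set Ω), MeasurableSet[m] s → ∀ g : Ω → ℝ,
      ∫ ω in s, g ω ∂(ProbabilityTheory.cond pr E) = (pr E)⁻¹.toReal • ∫ ω in s ∩ E, g ω ∂pr := by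
    intro s hs g
    rw [ProbabilityTheory.cond, Measure.restrict_smul, integral_smul_measure,
      Measure.restrict_restrict (hm _ hs)]
  have h := ae_eq_condExp_of_forall_setIntegral_eq (μ := ProbabilityTheory.cond pr E) hm
    (f := f) (g := condExp m pr f) (hint hf)
    (fun s _ _ => (hint integrable_condExp).integrableOn)
    (fun s hs _ => by
      rw [hset s hs, hset s hs, setIntegral_condExp hm hf (hs.inter hE)])
    stronglyMeasurable_condExp.aestronglyMeasurable
  have h' : ∀ᵐ ω ∂(pr.restrict E), condExp m pr f ω =
      condExp m (ProbabilityTheory.cond pr E) f ω := by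
    rw [ProbabilityTheory.cond] at h
    exact (Measure.ae_ennreal_smul_measure_iff hc0).1 h
  rw [ae_restrict_iff' hEm] at h'
  filter_upwards [h'] with ω h1 h2 using (h1 h2).symm

end CondExp

/-! ### Upper bounds and measurability for the design matrix and the estimates. -/

section Design

variable {n d : ℕ}

open scoped MatrixOrder in
lemma det_le_pow {p : Type*} [Fintype p] [DecidableEq p] {V : Matrix p p ℝ} (hV : V.PosSemidef)
    {u : ℝ} (hu : V ≤ u • (1 : Matrix p p ℝ)) : V.det ≤ u ^ Fintype.card p := by
  have h : ∀ i, hV.isHermitian.eigenvalues i ≤ u := by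
    intro i
    rw [← Algebra.algebraMap_eq_smul_one,
      le_algebraMap_iff_spectrum_le (R := ℝ) (A := Matrix p p ℝ) hV.isHermitian] at hu
    refine hu _ ?_
    rw [hV.isHermitian.spectrum_real_eq_range_eigenvalues]
    exact ⟨i, rfl⟩
  rw [hV.isHermitian.det_eq_prod_eigenvalues]
  refine (Finset.prod_le_prod (fun i _ => hV.eigenvalues_nonneg i) (fun i _ => h i)).trans_eq ?_
  simp

open scoped MatrixOrder in
lemma design_le (reg : ℝ) (x : ℕ → Fin n → ℝ) (a : ℕ → Fin d → ℝ) (t : ℕ) {u : ℝ}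
    (hu : reg + ∑ s ∈ Finset.range t, regressor (x s) (a s) ⬝ᵥ regressor (x s) (a s) ≤ u) :
    design reg x a t ≤ u • (1 : Matrix (Fin n ⊕ Fin d) (Fin n ⊕ Fin d) ℝ) := by
  refine le_of_dotProduct_mulVec (design_transpose _ _ _ _) (by simp) fun y => ?_
  rw [dotProduct_design_mulVec, Matrix.smul_mulVec, Matrix.one_mulVec, dotProduct_smul,
    smul_eq_mul]
  have h1 : ∑ s ∈ Finset.range t, (y ⬝ᵥ regressor (x s) (a s)) ^ 2 ≤
      (y ⬝ᵥ y) * ∑ s ∈ Finset.range t, regressor (x s) (a s) ⬝ᵥ regressor (x s) (a s) := by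
    rw [Finset.mul_sum]
    refine Finset.sum_le_sum fun s _ => ?_
    rw [← euclNorm_sq, ← euclNorm_sq, ← mul_pow]
    exact sq_le_sq.2 ((abs_dotProduct_le _ _).trans (le_abs_self _))
  have h2 := mul_le_mul_of_nonneg_right hu (dotProduct_self_nonneg' y)
  linarith

lemma measurable_vecMulVec {α p q : Type*} {m : MeasurableSpace α} [Finite p] [Finite q]
    {f : α → p → ℝ} {g : α → q → ℝ} (hf : Measurable f) (hg : Measurable g) :
    Measurable fun a => Matrix.vecMulVec (f a) (g a) := by
  have : Continuous fun x : (p → ℝ) × (q → ℝ) => Matrix.vecMulVec x.1 x.2 := by fun_prop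
  exact this.measurable.comp (hf.prodMk hg)

lemma measurable_matrix_sum {α p q ι : Type*} {m : MeasurableSpace α}
    {f : ι → α → Matrix p q ℝ} {s : Finset ι} (hf : ∀ i ∈ s, Measurable (f i)) :
    Measurable fun a => ∑ i ∈ s, f i a := by
  refine measurable_pi_lambda _ fun i => measurable_pi_lambda _ fun j => ?_
  simp only [Matrix.sum_apply]
  exact Finset.measurable_fun_sum _ fun k hk =>
    (measurable_pi_apply j).comp ((measurable_pi_apply i).comp (hf k hk))

lemma measurable_regressor {α : Type*} {m : MeasurableSpace α} {f : α → Fin n → ℝ}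
    {g : α → Fin d → ℝ} (hf : Measurable f) (hg : Measurable g) :
    Measurable fun a => regressor (f a) (g a) := by
  refine measurable_pi_lambda _ fun i => ?_
  rcases i with i | i
  · exact (measurable_pi_apply i).comp hf
  · exact (measurable_pi_apply i).comp hg

lemma measurable_weightedNorm {α p q : Type*} {m : MeasurableSpace α} [Fintype p] [Fintype q]
    {f : α → Matrix p p ℝ} {g : α → Matrix p q ℝ} (hf : Measurable f) (hg : Measurable g) :
    Measurable fun a => weightedNorm (f a) (g a) := by
  have ht : Measurable fun a => (g a)ᵀ :=
    (continuous_id.matrix_transpose (X := Matrix p q ℝ)).measurable.comp hg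
  have htr : Measurable (Matrix.trace : Matrix q q ℝ → ℝ) :=
    (continuous_id.matrix_trace (X := Matrix q q ℝ)).measurable
  exact Real.continuous_sqrt.measurable.comp (htr.comp ((ht.matrix_mul hf).matrix_mul hg))

lemma measurableSet_forall_le {α : Type*} {m : MeasurableSpace α} {t : ℕ} {f g : ℕ → α → ℝ}
    (hf : ∀ s ≤ t, Measurable (f s)) (hg : ∀ s ≤ t, Measurable (g s)) :
    MeasurableSet {a | ∀ s ≤ t, f s a ≤ g s a} := by
  have h : {a | ∀ s ≤ t, f s a ≤ g s a} = ⋂ s ∈ Finset.range (t + 1), {a | f s a ≤ g s a} := by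
    ext a
    simp
  rw [h]
  refine Finset.measurableSet_biInter _ fun s hs => ?_
  have hst : s ≤ t := Nat.lt_succ_iff.1 (Finset.mem_range.1 hs)
  exact measurableSet_le (hf s hst) (hg s hst)

lemma measurable_radius (P : Setting n d) (reg : ℝ) : Measurable (radius P reg) := by
  have hdet : Measurable fun V : Matrix (Fin n ⊕ Fin d) (Fin n ⊕ Fin d) ℝ => V.det :=
    (continuous_id.matrix_det).measurable
  have hs : Measurable Real.sqrt := Real.continuous_sqrt.measurable
  exact ((hs.comp ((Real.measurable_log.comp ((hs.comp hdet).div_const _)).const_mul _)).const_mul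
    _).add_const _

end Design

lemma Setting.le_Tr {n d : ℕ} (P : Setting n d) (hn : 0 < n) (Tw : ℝ) : Tw ≤ P.Tr Tw := by
  have h1 : (1 : ℝ) ≤ n := by exact_mod_cast hn
  have h2 : (0 : ℝ) ≤ d := by positivity
  have h3 : 0 ≤ Real.log ((n : ℝ) + d) := Real.log_nonneg (by linarith)
  have h4 : 0 ≤ ((n : ℝ) + d) * P.τ₀ * Real.log ((n : ℝ) + d) := by positivity
  rw [Setting.Tr]
  linarith

namespace Run

variable {n d : ℕ} {P : Setting n d} {reg Tw : ℝ} {Ω : Type u} [mΩ : MeasurableSpace Ω]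
  {pr : Measure Ω} (r : Run P reg Tw Ω pr)

lemma measurable_past {t j : ℕ} (hj : j < t) :
    Measurable[controllerInfo r.F r.x t] (r.x j) ∧
      Measurable[controllerInfo r.F r.x t] (r.a j) := by
  obtain ⟨s, rfl⟩ : ∃ s, t = s + 1 := ⟨t - 1, by omega⟩
  have h : r.F j ≤ controllerInfo r.F r.x (s + 1) :=
    (r.F.mono (by omega)).trans (r.filtration_le_controllerInfo s)
  exact ⟨(r.measurable_x j).mono h le_rfl, (r.measurable_a j).mono h le_rfl⟩

lemma measurable_state {t j : ℕ} (hj : j ≤ t) : Measurable[controllerInfo r.F r.x t] (r.x j) := by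
  rcases hj.lt_or_eq with h | rfl
  · exact (r.measurable_past h).1
  · exact r.measurable_state_controllerInfo j

lemma measurable_V {t s : ℕ} (hs : s ≤ t) : Measurable[controllerInfo r.F r.x t] (r.V s) := by
  have h : Measurable[controllerInfo r.F r.x t] fun ω => ∑ j ∈ Finset.range s,
      Matrix.vecMulVec (regressor (r.x j ω) (r.a j ω)) (regressor (r.x j ω) (r.a j ω)) :=
    measurable_matrix_sum fun j hj => by
      have hz := r.measurable_past (lt_of_lt_of_le (Finset.mem_range.1 hj) hs)
      exact measurable_vecMulVec (measurable_regressor hz.1 hz.2) (measurable_regressor hz.1 hz.2)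
  have hc : Continuous fun M : Matrix (Fin n ⊕ Fin d) (Fin n ⊕ Fin d) ℝ =>
    reg • (1 : Matrix (Fin n ⊕ Fin d) (Fin n ⊕ Fin d) ℝ) + M := by fun_prop
  exact hc.measurable.comp h

/-- The last term of the estimate contains `x s`, which for `s = t` is not in the past filtration;
this is why the controller information includes `x t`. -/
lemma measurable_Θhat {t s : ℕ} (hs : s ≤ t) :
    Measurable[controllerInfo r.F r.x t] (r.Θhat s) := by
  have h : Measurable[controllerInfo r.F r.x t] fun ω => ∑ j ∈ Finset.range s,
      Matrix.vecMulVec (regressor (r.x j ω) (r.a j ω)) (r.x (j + 1) ω) :=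
    measurable_matrix_sum fun j hj => by
      have hjs := Finset.mem_range.1 hj
      have hz := r.measurable_past (lt_of_lt_of_le hjs hs)
      exact measurable_vecMulVec (measurable_regressor hz.1 hz.2)
        (r.measurable_state (by omega))
  exact Measurable.matrix_mul (m := controllerInfo r.F r.x t)
    (measurable_matrix_inv.comp (r.measurable_V hs)) h

lemma measurableSet_estimationEvent (t : ℕ) :
    MeasurableSet[controllerInfo r.F r.x t] (r.estimationEvent t) := by
  have hc : Continuous fun M : Param n d => P.Θs - M := by fun_prop
  exact measurableSet_forall_le (m := controllerInfo r.F r.x t)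
    (fun s hs => measurable_weightedNorm (r.measurable_V hs)
    (hc.measurable.comp (r.measurable_Θhat hs)))
    fun s hs => (measurable_radius P reg).comp (r.measurable_V hs)

/-- On accurate estimates the optimism probability is given by the sampling law. -/
lemma optimismProb_eq [IsProbabilityMeasure pr] (hP : P.Standing) (t : ℕ) :
    ∀ᵐ ω ∂pr, ω ∈ r.estimationEvent t → r.optimismProb t ω =
      (samplingLaw P (r.Θhat t ω) (r.β t ω) (r.V t ω)).real P.optimisticSet := by
  have hopt : MeasurableSet P.optimisticSet := (Setting.isClosed_optimisticSet hP).measurableSet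
  have hms : MeasurableSet (r.sample t ⁻¹' P.optimisticSet) := (r.sample_law t).1 hopt
  filter_upwards [condExp_cond_ae_eq (r.controllerInfo_le t) (r.measurableSet_estimationEvent t)
    ((integrable_const (1 : ℝ)).indicator hms), (r.sample_law t).2 _ hopt] with ω h1 h2 hω
  exact (h1 hω).trans h2

/-- The trace of the data part of `V` is split at `T_r`: few terms with a crude state bound, and at
most `T` terms of size `X_s²`. Exploitation steps are the case of zero exploration noise. -/
lemma stateEvent_sum_le (hP : P.Standing) (hn : 0 < n) (hTw : 0 ≤ Tw) {c : ℝ} {T : ℕ} {ω : Ω}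
    (hsam : ∀ t, r.sample t ω ∈ P.params) (hst : ω ∈ r.stateEvent c T)
    (hex : ω ∈ r.explorationEvent T) {t : ℕ} (ht : t ≤ T) :
    ∑ s ∈ Finset.range t, regressor (r.x s ω) (r.a s ω) ⬝ᵥ regressor (r.x s ω) (r.a s ω) ≤
      (P.Tr Tw + 1) * (3 * P.κ ^ 2 * (c * ((n : ℝ) + d) ^ (n + d)) ^ 2 +
        2 * (P.κ * P.σ * √(8 * d * Real.log (d * Tw / P.δ))) ^ 2) +
      T * (3 * P.κ ^ 2 * P.Xs Tw T ^ 2) := by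
  set b := P.κ * P.σ * √(8 * d * Real.log (d * Tw / P.δ)) with hb
  set X := c * ((n : ℝ) + d) ^ (n + d) with hX
  have hTr := P.le_Tr hn Tw
  have hgain : ∀ s, specNorm (P.gain (r.sample s ω)) ≤ P.κ := fun s =>
    (hP.params_subset (hsam s)).1.1
  have hexploit : ∀ (s : ℕ) (Y : ℝ), Tw < (s : ℝ) → euclNorm (r.x s ω) ≤ Y →
      regressor (r.x s ω) (r.a s ω) ⬝ᵥ regressor (r.x s ω) (r.a s ω) ≤ 3 * P.κ ^ 2 * Y ^ 2 := by
    intro s Y hs hY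
    have h0 : euclNorm (0 : Fin d → ℝ) ≤ 0 := by simp [euclNorm]
    have := regressor_sq_le hP.one_le_κ (hgain (s / P.τ₀ * P.τ₀)) hY h0
    rw [r.a_exploit s ω hs]
    simpa using this
  have hterm : ∀ s ∈ Finset.range t,
      regressor (r.x s ω) (r.a s ω) ⬝ᵥ regressor (r.x s ω) (r.a s ω) ≤
        (if (s : ℝ) ≤ P.Tr Tw then 3 * P.κ ^ 2 * X ^ 2 + 2 * b ^ 2 else 0) +
          3 * P.κ ^ 2 * P.Xs Tw T ^ 2 := by
    intro s hs
    have hsT : s ≤ T := by have := Finset.mem_range.1 hs; omega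
    have hXs : 0 ≤ 3 * P.κ ^ 2 * P.Xs Tw T ^ 2 := by positivity
    split_ifs with h
    · rcases le_or_gt (s : ℝ) Tw with h' | h'
      · have := regressor_sq_le hP.one_le_κ (hgain (s / P.τ₀ * P.τ₀)) ((hst s hsT).1 h)
          (hex.1 s h')
        rw [r.a_explore s ω h']
        linarith
      · have := hexploit s X h' ((hst s hsT).1 h)
        have hb2 : 0 ≤ b ^ 2 := sq_nonneg b
        linarith
    · have := hexploit s _ (by linarith [not_le.1 h]) ((hst s hsT).2 (not_le.1 h))
      linarith
  refine (Finset.sum_le_sum hterm).trans ?_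
  rw [Finset.sum_add_distrib]
  refine add_le_add ?_ ?_
  · rw [← Finset.sum_filter, Finset.sum_const, nsmul_eq_mul]
    refine mul_le_mul_of_nonneg_right ?_ (by positivity)
    have hsub : ((Finset.range t).filter fun s : ℕ => (s : ℝ) ≤ P.Tr Tw) ⊆
        Finset.range (⌊P.Tr Tw⌋₊ + 1) := by
      intro s hs
      have := Nat.le_floor (Finset.mem_filter.1 hs).2
      rw [Finset.mem_range]; omega
    have h1 := Finset.card_le_card hsub
    rw [Finset.card_range] at h1
    have h2 : (((Finset.range t).filter fun s : ℕ => (s : ℝ) ≤ P.Tr Tw).card : ℝ) ≤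
        ⌊P.Tr Tw⌋₊ + 1 := by exact_mod_cast h1
    have h3 := Nat.floor_le (hTw.trans hTr)
    linarith
  · rw [Finset.sum_const, Finset.card_range, nsmul_eq_mul]
    refine mul_le_mul_of_nonneg_right ?_ (by positivity)
    exact_mod_cast ht

end Run

lemma Setting.Standing.S_nonneg {n d : ℕ} {P : Setting n d} (hP : P.Standing) : 0 ≤ P.S :=
  (frobNorm_nonneg _).trans (hP.params_subset (interior_subset hP.mem_interior)).2

lemma radius_nonneg {n d : ℕ} {P : Setting n d} (hP : P.Standing) (reg : ℝ)
    (V : Matrix (Fin n ⊕ Fin d) (Fin n ⊕ Fin d) ℝ) : 0 ≤ radius P reg V := by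
  have := hP.σ_pos
  have := hP.S_nonneg
  unfold radius
  positivity

-- `V ≤ T²` gives `√(det V) ≤ T ^ (n + d)`; the additional `1` in `n + d + 1` absorbs the constants
-- from `δ` and the regularizer.
open scoped MatrixOrder in
lemma radius_le {n d : ℕ} {P : Setting n d} (hP : P.Standing) {reg m C T : ℝ} (hm : 0 < m)
    (hmreg : m ≤ reg) (hT : 1 ≤ T) (hreg : reg ≤ C * Real.log T) (hC : 0 ≤ C)
    (hlog : -Real.log (P.δ * √(m ^ (n + d))) ≤ Real.log T)
    {V : Matrix (Fin n ⊕ Fin d) (Fin n ⊕ Fin d) ℝ} (hV : V.PosDef)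
    (hVu : V ≤ (T ^ 2) • (1 : Matrix (Fin n ⊕ Fin d) (Fin n ⊕ Fin d) ℝ)) :
    radius P reg V ≤ (P.σ * √(2 * n * (n + d + 1)) + √C * P.S) * √(Real.log T) := by
  have hσ := hP.σ_pos
  have hδ := hP.δ_pos
  have hdet := hV.det_pos
  have hdetle := det_le_pow hV.posSemidef hVu
  have hcard : Fintype.card (Fin n ⊕ Fin d) = n + d := by simp
  rw [hcard] at hdetle
  have hL : 0 ≤ Real.log T := Real.log_nonneg hT
  have hdet1 : (reg • (1 : Matrix (Fin n ⊕ Fin d) (Fin n ⊕ Fin d) ℝ)).det = reg ^ (n + d) := by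
    rw [Matrix.det_smul, Matrix.det_one, mul_one, hcard]
  have hratio : √V.det / (P.δ * √(reg ^ (n + d))) ≤ T ^ (n + d) / (P.δ * √(m ^ (n + d))) := by
    have h1 : √V.det ≤ T ^ (n + d) := by
      refine (Real.sqrt_le_sqrt hdetle).trans_eq ?_
      rw [← pow_mul, mul_comm 2, pow_mul, Real.sqrt_sq (by positivity)]
    have h2 : 0 < m ^ (n + d) := by positivity
    gcongr
  have hpos : 0 < √V.det / (P.δ * √(reg ^ (n + d))) := by
    have : 0 < reg := hm.trans_le hmreg
    have := Real.sqrt_pos.2 hdet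
    positivity
  have hlogle : Real.log (√V.det / (P.δ * √(reg ^ (n + d)))) ≤ (n + d + 1) * Real.log T := by
    refine (Real.log_le_log hpos hratio).trans ?_
    have h2 : 0 < P.δ * √(m ^ (n + d)) := by positivity
    rw [Real.log_div (by positivity) h2.ne', Real.log_pow]
    push_cast
    linarith
  rw [radius, hdet1, add_mul]
  refine add_le_add ?_ ?_
  · rw [mul_assoc P.σ]
    refine mul_le_mul_of_nonneg_left ?_ hσ.le
    rw [← Real.sqrt_mul (by positivity)]
    refine Real.sqrt_le_sqrt ?_
    rw [mul_assoc (2 * (n : ℝ))]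
    exact mul_le_mul_of_nonneg_left hlogle (by positivity)
  · have h1 : √reg ≤ √C * √(Real.log T) := by
      rw [← Real.sqrt_mul hC]; exact Real.sqrt_le_sqrt hreg
    have := mul_le_mul_of_nonneg_right h1 hP.S_nonneg
    linarith

/-- Diagonalization: `e T` is the infimum of the admissible `ε` plus `1 / (T + 1)`. The increment is
needed because the infimum may not be attained. -/
lemma exists_tendsto_zero_of_forall_eventually {p : ℝ → ℕ → Prop}
    (hmono : ∀ T ε ε', 0 < ε → ε ≤ ε' → p ε T → p ε' T)
    (h : ∀ ε, 0 < ε → ∀ᶠ T in atTop, p ε T) :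
    ∃ e : ℕ → ℝ, Tendsto e atTop (𝓝 0) ∧ ∀ᶠ T in atTop, p (e T) T := by
  have hbdd : ∀ T, BddBelow {ε | 0 < ε ∧ p ε T} := fun T => ⟨0, fun ε hε => hε.1.le⟩
  refine ⟨fun T => sInf {ε | 0 < ε ∧ p ε T} + 1 / ((T : ℝ) + 1), ?_, ?_⟩
  · suffices h0 : Tendsto (fun T => sInf {ε | 0 < ε ∧ p ε T}) atTop (𝓝 0) by
      simpa using h0.add (tendsto_one_div_add_atTop_nhds_zero_nat (𝕜 := ℝ))
    rw [Metric.tendsto_nhds]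
    intro ε hε
    filter_upwards [h (ε / 2) (by positivity)] with T hT
    have h1 : sInf {ε | 0 < ε ∧ p ε T} ≤ ε / 2 := csInf_le (hbdd T) ⟨by positivity, hT⟩
    have h2 : 0 ≤ sInf {ε | 0 < ε ∧ p ε T} := Real.sInf_nonneg fun x hx => hx.1.le
    rw [Real.dist_eq, sub_zero, abs_of_nonneg h2]
    linarith
  · filter_upwards [h 1 one_pos] with T hT
    have hlt : sInf {ε | 0 < ε ∧ p ε T} < sInf {ε | 0 < ε ∧ p ε T} + 1 / ((T : ℝ) + 1) := by
      have : (0 : ℝ) < 1 / ((T : ℝ) + 1) := by positivity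
      linarith
    obtain ⟨x, hx, hxlt⟩ := exists_lt_of_csInf_lt (s := {ε | 0 < ε ∧ p ε T}) ⟨1, one_pos, hT⟩ hlt
    exact hmono T x _ hx.1 hxlt.le hx.2

lemma gaussianQ_pos (x : ℝ) : 0 < gaussianQ x := by
  have h : gaussianReal 0 1 (Set.Ioi x) ≠ 0 := fun h0 => by
    have := gaussianReal_absolutelyContinuous' 0 (one_ne_zero (α := NNReal)) h0
    simp at this
  exact ENNReal.toReal_pos h (measure_ne_top _ _)

namespace Run

variable {n d : ℕ} {P : Setting n d} {reg Tw : ℝ} {Ω : Type u} [mΩ : MeasurableSpace Ω]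
  {pr : Measure Ω} (r : Run P reg Tw Ω pr)

open scoped MatrixOrder in
/-- The optimism probability on the good event, for a horizon at which the confidence radius is
small compared with the excitation of the exploration phase. -/
lemma ae_le_optimismProb [IsProbabilityMeasure pr] (hP : P.Standing) (hn : 0 < n) {q ζ : ℝ}
    (hζ : ∀ (V : Matrix (Fin n ⊕ Fin d) (Fin n ⊕ Fin d) ℝ) (Θhat : Param n d) (b l u : ℝ), 0 < l →
      (V - l • (1 : Matrix (Fin n ⊕ Fin d) (Fin n ⊕ Fin d) ℝ)).PosSemidef →
      (u • (1 : Matrix (Fin n ⊕ Fin d) (Fin n ⊕ Fin d) ℝ) - V).PosSemidef → 0 ≤ b →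
      weightedNorm V (P.Θs - Θhat) ≤ b → b ≤ ζ * √l →
      (b * √u ≤ ζ * l ∨ IsUnit P.closedLoop) →
      q ≤ (samplingLaw P Θhat b V).real P.optimisticSet)
    {m C U ρ c : ℝ} {T : ℕ} (hTw : 0 < Tw) (hm : 0 < m) (hmreg : m ≤ reg) (hT : 1 ≤ (T : ℝ))
    (hreg : reg ≤ C * Real.log T) (hC : 0 ≤ C)
    (hlog : -Real.log (P.δ * √(m ^ (n + d))) ≤ Real.log T)
    (hU : reg + ((P.Tr Tw + 1) * (3 * P.κ ^ 2 * (c * ((n : ℝ) + d) ^ (n + d)) ^ 2 +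
        2 * (P.κ * P.σ * √(8 * d * Real.log (d * Tw / P.δ))) ^ 2) +
      T * (3 * P.κ ^ 2 * P.Xs Tw T ^ 2)) ≤ U) (hUT : U ≤ (T : ℝ) ^ 2)
    (hl : (P.σ * √(2 * n * (n + d + 1)) + √C * P.S) * √(Real.log T) ≤
      ζ * √(Tw * P.σ ^ 2 / 80))
    (hlu : (P.σ * √(2 * n * (n + d + 1)) + √C * P.S) * √(Real.log T) * √U ≤
      ζ * (Tw * P.σ ^ 2 / 80) ∨ IsUnit P.closedLoop) :
    ∀ᵐ ω ∂pr, ω ∈ r.goodEvent ρ c T ∩ r.explorationEvent T →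
      ∀ t : ℕ, P.Tr Tw < t → t ≤ T → q ≤ r.optimismProb t ω := by
  have hsam : ∀ᵐ ω ∂pr, ∀ t, r.sample t ω ∈ P.params :=
    r.ae_sample_mem hP
  have hopt := ae_all_iff.2 fun t => r.optimismProb_eq hP t
  filter_upwards [hsam, hopt] with ω hsamω hoptω hω t hTr ht
  obtain ⟨⟨⟨hest, _⟩, hstate⟩, hexp⟩ := hω
  have hest' : ω ∈ r.estimationEvent t := fun s hs => hest s (hs.trans ht)
  rw [hoptω t hest']
  have hTwTr := P.le_Tr hn Tw
  have hσ := hP.σ_pos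
  have hl0 : 0 < Tw * P.σ ^ 2 / 80 := by positivity
  have hregpos : 0 < reg := hm.trans_le hmreg
  have hlow := hexp.2 t ht (hTwTr.trans_lt hTr)
  have hlow' : (r.V t ω - (Tw * P.σ ^ 2 / 80) •
      (1 : Matrix (Fin n ⊕ Fin d) (Fin n ⊕ Fin d) ℝ)).PosSemidef := by
    have h1 := hlow.add (Matrix.PosSemidef.one.smul hregpos.le)
    have h2 : r.V t ω - (reg + Tw * P.σ ^ 2 / 80) •
        (1 : Matrix (Fin n ⊕ Fin d) (Fin n ⊕ Fin d) ℝ) + reg • 1 =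
        r.V t ω - (Tw * P.σ ^ 2 / 80) • 1 := by
      rw [add_smul]; abel
    rwa [h2] at h1
  have hVpd : (r.V t ω).PosDef := by
    have h1 := (Matrix.PosDef.one (n := Fin n ⊕ Fin d) (R := ℝ)).smul hl0 |>.add_posSemidef hlow'
    rwa [add_sub_cancel] at h1
  have hup : r.V t ω ≤ U • (1 : Matrix (Fin n ⊕ Fin d) (Fin n ⊕ Fin d) ℝ) :=
    design_le reg _ _ t (le_trans (by
      have := r.stateEvent_sum_le hP hn hTw.le hsamω hstate hexp ht
      linarith) hU)
  have hup' : r.V t ω ≤ ((T : ℝ) ^ 2) • (1 : Matrix (Fin n ⊕ Fin d) (Fin n ⊕ Fin d) ℝ) :=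
    design_le reg _ _ t (le_trans (by
      have := r.stateEvent_sum_le hP hn hTw.le hsamω hstate hexp ht
      linarith) (hU.trans hUT))
  have hb := radius_le hP hm hmreg hT hreg hC hlog hVpd hup'
  refine hζ (r.V t ω) (r.Θhat t ω) (r.β t ω) _ U hl0 hlow' (Matrix.le_iff.1 hup)
    (radius_nonneg hP _ _) (hest t ht) (hb.trans hl) ?_
  exact hlu.imp_left fun h => (mul_le_mul_of_nonneg_right hb (Real.sqrt_nonneg _)).trans h

end Run

/-! ### Growth of the exploration length, the state bounds and the failure probability. -/

section Asymptotics

lemma isLittleO_log_natCast_rpow {a : ℝ} (ha : 0 < a) :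
    (fun T : ℕ => Real.log T) =o[atTop] fun T : ℕ => (T : ℝ) ^ a :=
  (isLittleO_log_rpow_atTop ha).comp_tendsto tendsto_natCast_atTop_atTop

lemma tendsto_log_natCast : Tendsto (fun T : ℕ => Real.log T) atTop atTop :=
  Real.tendsto_log_atTop.comp tendsto_natCast_atTop_atTop

lemma eventually_le_of_isLittleO {f g : ℕ → ℝ} (h : f =o[atTop] g) (hg : ∀ᶠ T in atTop, 0 ≤ g T)
    {ε : ℝ} (hε : 0 < ε) : ∀ᶠ T in atTop, f T ≤ ε * g T := by
  filter_upwards [h.bound hε, hg] with T h1 h2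
  rw [Real.norm_of_nonneg h2] at h1
  exact (Real.le_norm_self _).trans h1

lemma tendsto_natCast_rpow_atTop {a : ℝ} (ha : 0 < a) :
    Tendsto (fun T : ℕ => (T : ℝ) ^ a) atTop atTop :=
  (tendsto_rpow_atTop ha).comp tendsto_natCast_atTop_atTop

/-- The exponents add up: `(3/5)(11/10) + 9/100 = 3/4`, where `11/10` bounds `1 + e T` and `T ^
(9/100)` absorbs `C`. -/
lemma eventually_le_rpow_of_eq {b e Tw : ℕ → ℝ} {C : ℝ} (hC : 0 < C)
    (he : Tendsto e atTop (𝓝 0)) (hTw : ∀ᶠ T in atTop, Tw T = C * b T ^ (1 + e T))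
    (h1 : ∀ᶠ T in atTop, 1 ≤ b T) (h2 : ∀ᶠ T : ℕ in atTop, b T ≤ (T : ℝ) ^ (3 / 5 : ℝ)) :
    ∀ᶠ T : ℕ in atTop, 0 ≤ Tw T ∧ Tw T ≤ (T : ℝ) ^ (3 / 4 : ℝ) := by
  have he' : ∀ᶠ T in atTop, e T < 1 / 10 := he.eventually_lt_const (by norm_num)
  filter_upwards [hTw, h1, h2, he', eventually_ge_atTop 1,
    (tendsto_natCast_rpow_atTop (a := 9 / 100) (by norm_num)).eventually_ge_atTop C]
    with T hT h1 h2 he hT1 hCT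
  have hT0 : (0 : ℝ) < T := by exact_mod_cast hT1
  have hb0 : 0 ≤ b T := by linarith
  rw [hT]
  refine ⟨by positivity, ?_⟩
  have h3 : b T ^ (1 + e T) ≤ (T : ℝ) ^ (33 / 50 : ℝ) := by
    calc b T ^ (1 + e T) ≤ b T ^ (11 / 10 : ℝ) :=
          Real.rpow_le_rpow_of_exponent_le h1 (by linarith)
      _ ≤ ((T : ℝ) ^ (3 / 5 : ℝ)) ^ (11 / 10 : ℝ) := Real.rpow_le_rpow hb0 h2 (by norm_num)
      _ = (T : ℝ) ^ (33 / 50 : ℝ) := by rw [← Real.rpow_mul hT0.le]; norm_num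
  calc C * b T ^ (1 + e T) ≤ (T : ℝ) ^ (9 / 100 : ℝ) * (T : ℝ) ^ (33 / 50 : ℝ) :=
        mul_le_mul hCT h3 (by positivity) (by positivity)
    _ = (T : ℝ) ^ (3 / 4 : ℝ) := by rw [← Real.rpow_add hT0]; norm_num

variable {n d : ℕ} {P : Setting n d}

lemma eventually_log_exploration (hP : P.Standing) (hd : 0 < d) {Tw : ℕ → ℝ}
    (h1 : ∀ᶠ T in atTop, 1 ≤ Tw T) (h2 : ∀ᶠ T : ℕ in atTop, Tw T ≤ (T : ℝ) ^ (3 / 4 : ℝ)) :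
    ∀ᶠ T : ℕ in atTop, 0 ≤ Real.log (d * Tw T / P.δ) ∧
      Real.log (d * Tw T / P.δ) ≤ 2 * Real.log T := by
  have hδ := hP.δ_pos
  have hδ1 := hP.δ_lt_one
  have hd1 : (1 : ℝ) ≤ d := by exact_mod_cast hd
  filter_upwards [h1, h2, eventually_ge_atTop 1,
    tendsto_natCast_atTop_atTop.eventually_ge_atTop ((d : ℝ) / P.δ)] with T h1 h2 hT hTd
  have hT1 : (1 : ℝ) ≤ T := by exact_mod_cast hT
  have hTwT : Tw T ≤ T := h2.trans (by
    simpa using Real.rpow_le_rpow_of_exponent_le hT1 (by norm_num : (3 / 4 : ℝ) ≤ 1))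
  constructor
  · refine Real.log_nonneg ?_
    rw [le_div_iff₀ hδ]
    nlinarith
  · rw [← Real.log_rpow (by linarith)]
    refine Real.log_le_log (by positivity) ?_
    have h3 : (d : ℝ) / P.δ * Tw T ≤ T * T := mul_le_mul hTd hTwT (by linarith) (by linarith)
    calc (d : ℝ) * Tw T / P.δ = d / P.δ * Tw T := by ring
      _ ≤ T * T := h3
      _ = (T : ℝ) ^ (2 : ℝ) := by norm_num [sq]

lemma eventually_Xs_sq_le (hP : P.Standing) (hn : 0 < n) {Tw : ℕ → ℝ}
    (h1 : ∀ᶠ T in atTop, 1 ≤ Tw T) (h2 : ∀ᶠ T : ℕ in atTop, Tw T ≤ (T : ℝ) ^ (3 / 4 : ℝ)) :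
    ∀ᶠ T : ℕ in atTop, P.Xs (Tw T) T ^ 2 ≤
      ((12 * P.κ ^ 2 + 2 * P.κ * √2) / P.γ * P.σ) ^ 2 * (4 * n) * Real.log T := by
  have hδ := hP.δ_pos
  have hn0 : (0 : ℝ) < n := by exact_mod_cast hn
  filter_upwards [h1, h2, eventually_gt_atTop 1,
    tendsto_natCast_atTop_atTop.eventually_ge_atTop ((n : ℝ) / P.δ)] with T h1 h2 hT hTd
  have hT1 : (1 : ℝ) < T := by exact_mod_cast hT
  have hTwT : Tw T < T := h2.trans_lt (by
    simpa using Real.rpow_lt_rpow_of_exponent_lt hT1 (by norm_num : (3 / 4 : ℝ) < 1))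
  have hlog : Real.log (n * (T - Tw T) / P.δ) ≤ 2 * Real.log T := by
    rw [← Real.log_rpow (by linarith)]
    have h0 : 0 < (T : ℝ) - Tw T := by linarith
    refine Real.log_le_log (by positivity) ?_
    have h3 : (n : ℝ) / P.δ * (T - Tw T) ≤ T * T :=
      mul_le_mul hTd (by linarith) (by linarith) (by linarith)
    calc (n : ℝ) * (T - Tw T) / P.δ = n / P.δ * (T - Tw T) := by ring
      _ ≤ T * T := h3
      _ = (T : ℝ) ^ (2 : ℝ) := by norm_num [sq]
  have hL : 0 ≤ Real.log T := Real.log_nonneg hT1.le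
  have h4 : √(2 * n * Real.log (n * (T - Tw T) / P.δ)) ≤ √(4 * n * Real.log T) := by
    refine Real.sqrt_le_sqrt ?_
    nlinarith
  have h5 : √(2 * n * Real.log (n * (T - Tw T) / P.δ)) ^ 2 ≤ 4 * n * Real.log T :=
    (pow_le_pow_left₀ (Real.sqrt_nonneg _) h4 2).trans_eq (Real.sq_sqrt (by positivity))
  calc P.Xs (Tw T) T ^ 2 = ((12 * P.κ ^ 2 + 2 * P.κ * √2) / P.γ * P.σ) ^ 2 *
        √(2 * n * Real.log (n * (T - Tw T) / P.δ)) ^ 2 := by rw [Setting.Xs, mul_pow]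
    _ ≤ ((12 * P.κ ^ 2 + 2 * P.κ * √2) / P.γ * P.σ) ^ 2 * (4 * n * Real.log T) :=
        mul_le_mul_of_nonneg_left h5 (sq_nonneg _)
    _ = _ := by ring

lemma isBigO_initial_bound (hP : P.Standing) (hd : 0 < d) {Tw c : ℕ → ℝ}
    (h1 : ∀ᶠ T in atTop, 1 ≤ Tw T) (h2 : ∀ᶠ T : ℕ in atTop, Tw T ≤ (T : ℝ) ^ (3 / 4 : ℝ))
    (hc : ∀ a : ℝ, 0 < a → c =O[atTop] fun T : ℕ => (T : ℝ) ^ a) :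
    (fun T : ℕ => 3 * P.κ ^ 2 * (c T * ((n : ℝ) + d) ^ (n + d)) ^ 2 +
      2 * (P.κ * P.σ * √(8 * d * Real.log (d * Tw T / P.δ))) ^ 2) =O[atTop]
      fun T : ℕ => (T : ℝ) ^ (1 / 8 : ℝ) := by
  refine IsBigO.add ?_ ?_
  · have h := (hc (1 / 16) (by norm_num)).pow 2
    have hpow : (fun T : ℕ => ((T : ℝ) ^ (1 / 16 : ℝ)) ^ 2) =
        fun T : ℕ => (T : ℝ) ^ (1 / 8 : ℝ) := by
      ext T
      rw [← Real.rpow_natCast, ← Real.rpow_mul (by positivity)]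
      norm_num
    rw [hpow] at h
    refine (h.const_mul_left (3 * P.κ ^ 2 * (((n : ℝ) + d) ^ (n + d)) ^ 2)).congr_left fun T => ?_
    ring
  · refine IsBigO.trans ?_ (isLittleO_log_natCast_rpow (by norm_num : (0 : ℝ) < 1 / 8)).isBigO
    refine IsBigO.of_bound (2 * (P.κ * P.σ) ^ 2 * (16 * d)) ?_
    filter_upwards [eventually_log_exploration hP hd h1 h2] with T hT
    have hL : 0 ≤ Real.log T := by
      have := hT.1.trans hT.2
      linarith
    rw [mul_pow, Real.sq_sqrt (mul_nonneg (by positivity) hT.1), Real.norm_of_nonneg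
      (mul_nonneg two_pos.le (mul_nonneg (sq_nonneg _) (mul_nonneg (by positivity) hT.1))),
      Real.norm_of_nonneg hL]
    have h3 := mul_le_mul_of_nonneg_left hT.2
      (by positivity : 0 ≤ 2 * (P.κ * P.σ) ^ 2 * (8 * (d : ℝ)))
    linarith

/-- The initial phase contributes `T^{3/4} T^{1/8} ≤ T` up to constants, so the exploitation phase,
of order `T log T`, dominates. -/
lemma exists_eventually_design_bound (hP : P.Standing) (hn : 0 < n) (hd : 0 < d)
    {Tw reg c : ℕ → ℝ}
    (h1 : ∀ᶠ T in atTop, 1 ≤ Tw T) (h2 : ∀ᶠ T : ℕ in atTop, Tw T ≤ (T : ℝ) ^ (3 / 4 : ℝ))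
    (hreg : reg =O[atTop] fun T : ℕ => Real.log T)
    (hc : ∀ a : ℝ, 0 < a → c =O[atTop] fun T : ℕ => (T : ℝ) ^ a) :
    ∃ D, 0 < D ∧ ∀ᶠ T : ℕ in atTop, reg T + ((P.Tr (Tw T) + 1) *
        (3 * P.κ ^ 2 * (c T * ((n : ℝ) + d) ^ (n + d)) ^ 2 +
          2 * (P.κ * P.σ * √(8 * d * Real.log (d * Tw T / P.δ))) ^ 2) +
      T * (3 * P.κ ^ 2 * P.Xs (Tw T) T ^ 2)) ≤ D * (T * Real.log T) := by
  have hone : (fun _ : ℕ => (1 : ℝ)) =O[atTop] fun T : ℕ => (T : ℝ) ^ (3 / 4 : ℝ) :=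
    IsBigO.of_bound 1 (by
      filter_upwards [(tendsto_natCast_rpow_atTop (a := 3 / 4)
        (by norm_num)).eventually_ge_atTop 1] with T hT
      rw [norm_one, one_mul]; exact hT.trans (Real.le_norm_self _))
  have hlog1 : (fun _ : ℕ => (1 : ℝ)) =O[atTop] fun T : ℕ => Real.log T :=
    IsBigO.of_bound 1 (by
      filter_upwards [tendsto_log_natCast.eventually_ge_atTop 1] with T hT
      rw [norm_one, one_mul]; exact hT.trans (Real.le_norm_self _))
  have hTone : (fun _ : ℕ => (1 : ℝ)) =O[atTop] fun T : ℕ => (T : ℝ) :=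
    IsBigO.of_bound 1 (by
      filter_upwards [tendsto_natCast_atTop_atTop.eventually_ge_atTop (1 : ℝ)] with T hT
      rw [norm_one, one_mul]; exact hT.trans (Real.le_norm_self _))
  have hTwO : Tw =O[atTop] fun T : ℕ => (T : ℝ) ^ (3 / 4 : ℝ) := IsBigO.of_bound 1 (by
    filter_upwards [h1, h2] with T h1 h2
    rw [one_mul, Real.norm_of_nonneg (by linarith)]
    exact h2.trans (Real.le_norm_self _))
  have hTr : (fun T : ℕ => P.Tr (Tw T) + 1) =O[atTop] fun T : ℕ => (T : ℝ) ^ (3 / 4 : ℝ) :=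
    (hTwO.add ((hone.const_mul_left (((n : ℝ) + d) * P.τ₀ * Real.log ((n : ℝ) + d))).congr_left
      fun T => mul_one _)).add hone
  have hA := hTr.mul (isBigO_initial_bound (n := n) hP hd h1 h2 hc)
  have hA' : (fun T : ℕ => (T : ℝ) ^ (3 / 4 : ℝ) * (T : ℝ) ^ (1 / 8 : ℝ)) =O[atTop]
      fun T : ℕ => (T : ℝ) := IsBigO.of_bound 1 (by
    filter_upwards [eventually_ge_atTop 1] with T hT
    have hT1 : (1 : ℝ) ≤ T := by exact_mod_cast hT
    rw [one_mul, ← Real.rpow_add (by linarith), Real.norm_of_nonneg (by positivity),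
      Real.norm_of_nonneg (by positivity)]
    simpa using Real.rpow_le_rpow_of_exponent_le hT1 (by norm_num : (3 / 4 + 1 / 8 : ℝ) ≤ 1))
  have hB : (fun T : ℕ => P.Xs (Tw T) T ^ 2) =O[atTop] fun T : ℕ => Real.log T :=
    IsBigO.of_bound _ (by
      filter_upwards [eventually_Xs_sq_le hP hn h1 h2, eventually_ge_atTop 1] with T h hT
      rw [Real.norm_of_nonneg (sq_nonneg _),
        Real.norm_of_nonneg (Real.log_nonneg (by exact_mod_cast hT))]
      exact h)
  have hmain := ((hTone.mul hreg).congr_left fun T => one_mul _).add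
    (((((hA.trans hA').mul hlog1).congr_left fun T => mul_one _)).add
      ((isBigO_refl (fun T : ℕ => (T : ℝ)) atTop).mul (hB.const_mul_left (3 * P.κ ^ 2))))
  obtain ⟨D, hD, hbound⟩ := hmain.exists_pos
  refine ⟨D, hD, ?_⟩
  filter_upwards [hbound.bound, eventually_ge_atTop 1] with T hT hT1
  have hT1' : (1 : ℝ) ≤ T := by exact_mod_cast hT1
  rw [Real.norm_of_nonneg (mul_nonneg (by linarith) (Real.log_nonneg hT1'))] at hT
  exact (Real.le_norm_self _).trans hT

/-- The noise term is `O(1 / Tw)`. As `log T = o(Tw)`, `exp(-Tw/10)` is eventually below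
`T^{-(n+d+1)}`, which beats the roughly `(2T)^{n+d}` directions of a grid of mesh `1 / T`. -/
lemma tendsto_exploration_failure (hP : P.Standing) (hd : 0 < d) {Tw : ℕ → ℝ}
    (h0 : ∀ᶠ T in atTop, 0 ≤ Tw T) (hlog : (fun T : ℕ => Real.log T) =o[atTop] Tw)
    (hTw : Tendsto Tw atTop atTop) :
    Tendsto (fun T : ℕ => (Tw T + 1) * (2 * d * Real.exp (-(2 * Real.log (d * Tw T / P.δ)))) +
      (2 * (T : ℝ) + 1) ^ (n + d) * (2 * Real.exp (-(Tw T / 10)))) atTop (𝓝 0) := by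
  have hδ := hP.δ_pos
  have hd0 : (0 : ℝ) < d := by exact_mod_cast hd
  have hlim : Tendsto (fun T : ℕ => 4 * P.δ ^ 2 / d * (Tw T)⁻¹ +
      2 * 3 ^ (n + d) * ((T : ℝ))⁻¹) atTop (𝓝 0) := by
    have := ((tendsto_inv_atTop_zero.comp hTw).const_mul (4 * P.δ ^ 2 / (d : ℝ))).add
      ((tendsto_inv_atTop_zero.comp (tendsto_natCast_atTop_atTop (R := ℝ))).const_mul
        (2 * 3 ^ (n + d) : ℝ))
    simpa using this
  refine squeeze_zero' ?_ ?_ hlim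
  · filter_upwards [h0] with T h0
    positivity
  · filter_upwards [hTw.eventually_ge_atTop 1, eventually_ge_atTop 1,
      eventually_le_of_isLittleO hlog h0 (by positivity : 0 < 1 / (10 * ((n : ℝ) + d + 1)))]
      with T h1 hT hle
    have hT1 : (1 : ℝ) ≤ T := by exact_mod_cast hT
    have hT0 : (0 : ℝ) < T := by linarith
    have hTw0 : 0 < Tw T := by linarith
    refine add_le_add ?_ ?_
    · have hpos : 0 < (d : ℝ) * Tw T / P.δ := by positivity
      have hexp : Real.exp (-(2 * Real.log (d * Tw T / P.δ))) =
          ((d * Tw T / P.δ) ^ 2)⁻¹ := by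
        rw [Real.exp_neg, mul_comm, Real.exp_mul, Real.exp_log hpos]
        norm_num
      rw [hexp]
      calc (Tw T + 1) * (2 * d * ((d * Tw T / P.δ) ^ 2)⁻¹)
          ≤ (2 * Tw T) * (2 * d * ((d * Tw T / P.δ) ^ 2)⁻¹) :=
            mul_le_mul_of_nonneg_right (by linarith) (by positivity)
        _ = 4 * P.δ ^ 2 / d * (Tw T)⁻¹ := by field_simp; ring
    · have hexp : Real.exp (-(Tw T / 10)) ≤ ((T : ℝ) ^ (n + d + 1))⁻¹ := by
        rw [← Real.exp_log (by positivity : 0 < (T : ℝ) ^ (n + d + 1)), ← Real.exp_neg,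
          Real.log_pow]
        refine Real.exp_le_exp.2 (neg_le_neg ?_)
        rw [div_mul_eq_mul_div, one_mul, le_div_iff₀ (by positivity)] at hle
        push_cast
        linarith
      have hpow : (2 * (T : ℝ) + 1) ^ (n + d) ≤ 3 ^ (n + d) * (T : ℝ) ^ (n + d) := by
        rw [← mul_pow]
        exact pow_le_pow_left₀ (by positivity) (by linarith) _
      calc (2 * (T : ℝ) + 1) ^ (n + d) * (2 * Real.exp (-(Tw T / 10)))
          ≤ (3 ^ (n + d) * (T : ℝ) ^ (n + d)) * (2 * ((T : ℝ) ^ (n + d + 1))⁻¹) := by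
            gcongr
        _ = 2 * 3 ^ (n + d) * ((T : ℝ))⁻¹ := by rw [pow_succ]; field_simp

lemma eventually_grid_conditions (hP : P.Standing) (hd : 0 < d) {Tw c : ℕ → ℝ}
    (h1 : ∀ᶠ T in atTop, 1 ≤ Tw T) (h2 : ∀ᶠ T : ℕ in atTop, Tw T ≤ (T : ℝ) ^ (3 / 4 : ℝ))
    (hc : ∀ a : ℝ, 0 < a → c =O[atTop] fun T : ℕ => (T : ℝ) ^ a) :
    ∀ᶠ T : ℕ in atTop, 14 * ((n : ℝ) + d) ≤ (T : ℝ) ^ 2 ∧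
      ((n : ℝ) + d) * ((Tw T + 1) * (3 * P.κ ^ 2 * (c T * ((n : ℝ) + d) ^ (n + d)) ^ 2 +
        2 * (P.κ * P.σ * √(8 * d * Real.log (d * Tw T / P.δ))) ^ 2)) ≤
      Tw T * P.σ ^ 2 / 80 * (T : ℝ) ^ 2 := by
  have hσ := hP.σ_pos
  have ho : (fun T : ℕ => (T : ℝ) ^ (1 / 8 : ℝ)) =o[atTop] fun T : ℕ => (T : ℝ) ^ (2 : ℝ) := by
    have h3 : (fun _ : ℕ => (1 : ℝ)) =o[atTop] fun T : ℕ => (T : ℝ) ^ (15 / 8 : ℝ) :=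
      (isLittleO_one_left_iff ℝ).2
        (tendsto_norm_atTop_atTop.comp (tendsto_natCast_rpow_atTop (by norm_num)))
    refine (h3.mul_isBigO (isBigO_refl (fun T : ℕ => (T : ℝ) ^ (1 / 8 : ℝ)) atTop)).congr
      (fun T => one_mul _) fun T => ?_
    rw [← Real.rpow_add_of_nonneg (by positivity) (by norm_num) (by norm_num)]
    norm_num
  have hI := eventually_le_of_isLittleO
    ((isBigO_initial_bound (n := n) hP hd h1 h2 hc).trans_isLittleO ho)
    (Eventually.of_forall fun T => by positivity)
    (by positivity : 0 < P.σ ^ 2 / (160 * ((n : ℝ) + d + 1)))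
  filter_upwards [hI, h1, (tendsto_natCast_rpow_atTop (a := 2) two_pos).eventually_ge_atTop
    (14 * ((n : ℝ) + d))] with T hI h1 hT
  rw [Real.rpow_two] at hI hT
  refine ⟨hT, ?_⟩
  set I := 3 * P.κ ^ 2 * (c T * ((n : ℝ) + d) ^ (n + d)) ^ 2 +
    2 * (P.κ * P.σ * √(8 * d * Real.log (d * Tw T / P.δ))) ^ 2 with hIdef
  have hI0 : 0 ≤ I := by positivity
  rw [div_mul_eq_mul_div, le_div_iff₀ (by positivity)] at hI
  have h3 : ((n : ℝ) + d) * ((Tw T + 1) * I) ≤ ((n : ℝ) + d + 1) * ((2 * Tw T) * I) := by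
    refine mul_le_mul (by linarith) (mul_le_mul_of_nonneg_right (by linarith) hI0)
      (mul_nonneg (by linarith) hI0) (by positivity)
  have h4 := mul_le_mul_of_nonneg_left hI (by linarith : 0 ≤ Tw T)
  have h5 : Tw T * (P.σ ^ 2 * (T : ℝ) ^ 2) / 80 = Tw T * P.σ ^ 2 / 80 * (T : ℝ) ^ 2 := by ring
  rw [← h5]
  linarith

end Asymptotics

/-- Optimistic sampling for exploration phases that are long compared with `log T` and, unless
the optimal closed-loop matrix is non-singular, with `√T log T`. -/
theorem optimisticSampling_of_isLittleO {n d : ℕ} (hn : 0 < n) (hd : 0 < d) {P : Setting n d}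
    (hP : P.Standing) (hne : P.closedLoop ≠ 0) {reg ρ c Tw : ℕ → ℝ}
    (hreg_pos : ∃ m > 0, ∀ᶠ T in atTop, m ≤ reg T)
    (hreg_le : reg =O[atTop] fun T : ℕ => Real.log T)
    (hc : ∀ a : ℝ, 0 < a → c =O[atTop] fun T : ℕ => (T : ℝ) ^ a)
    (hTw : ∀ᶠ T : ℕ in atTop, 0 ≤ Tw T ∧ Tw T ≤ (T : ℝ) ^ (3 / 4 : ℝ))
    (hlog : (fun T : ℕ => Real.log T) =o[atTop] Tw)
    (hsqrt : ((fun T : ℕ => √(T : ℝ) * Real.log T) =o[atTop] Tw) ∨ IsUnit P.closedLoop) :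
    OptimisticSampling.{u} P Tw reg ρ c := by
  have hσ := hP.σ_pos
  have h0 : ∀ᶠ T in atTop, 0 ≤ Tw T := hTw.mono fun T h => h.1
  have h2 : ∀ᶠ T : ℕ in atTop, Tw T ≤ (T : ℝ) ^ (3 / 4 : ℝ) := hTw.mono fun T h => h.2
  have hTwtop : Tendsto Tw atTop atTop :=
    tendsto_atTop_mono' _ ((eventually_le_of_isLittleO hlog h0 one_pos).mono fun T h => by
      rwa [one_mul] at h) tendsto_log_natCast
  have h1 : ∀ᶠ T in atTop, 1 ≤ Tw T := hTwtop.eventually_ge_atTop 1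
  obtain ⟨m, hm, hmreg⟩ := hreg_pos
  obtain ⟨C, hC, hCreg⟩ := hreg_le.exists_pos
  obtain ⟨D, hD, hDU⟩ := exists_eventually_design_bound hP hn hd h1 h2 hreg_le hc
  have hS := hP.S_nonneg
  set M := P.σ * √(2 * n * (n + d + 1)) + √C * P.S with hM
  have hM0 : 0 ≤ M := by positivity
  have hq := gaussianQ_pos 1
  have key : ∀ ε : ℝ, 0 < ε → ∀ᶠ T : ℕ in atTop, ∀ (Ω : Type u) [MeasurableSpace Ω]
      (pr : Measure Ω) [IsProbabilityMeasure pr] (r : Run P (reg T) (Tw T) Ω pr),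
      ∀ᵐ ω ∂pr, ω ∈ r.goodEvent (ρ T) (c T) T ∩ r.explorationEvent T →
        ∀ t : ℕ, P.Tr (Tw T) < t → t ≤ T → gaussianQ 1 / (1 + ε) ≤ r.optimismProb t ω := by
    intro ε hε
    -- This additive loss is the one for which `Q(1)` minus the loss equals `Q(1) / (1 + ε)`.
    obtain ⟨ζ, hζ0, hζ⟩ := exists_samplingLaw_ge hP hne
      (by positivity : 0 < gaussianQ 1 * ε / (1 + ε))
    have hqε : gaussianQ 1 - gaussianQ 1 * ε / (1 + ε) = gaussianQ 1 / (1 + ε) := by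
      field_simp; ring
    rw [hqε] at hζ
    have hl : ∀ᶠ T : ℕ in atTop, M * √(Real.log T) ≤ ζ * √(Tw T * P.σ ^ 2 / 80) := by
      filter_upwards [eventually_le_of_isLittleO hlog h0
        (by positivity : 0 < (ζ ^ 2 * P.σ ^ 2 / 80) / (M ^ 2 + 1)), h0,
        tendsto_log_natCast.eventually_ge_atTop 0] with T hT hT0 hL
      rw [div_mul_eq_mul_div, le_div_iff₀ (by positivity)] at hT
      refine abs_le_of_sq_le_sq' ?_ (by positivity) |>.2
      rw [mul_pow, mul_pow, Real.sq_sqrt hL, Real.sq_sqrt (by positivity)]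
      linarith
    -- The radius, of order `√(log T)`, times the root of the upper bound on `V`, of order `√(T log
    -- T)`, is the critical scale `√T log T`.
    have hlu : ∀ᶠ T : ℕ in atTop, M * √(Real.log T) * √(D * (T * Real.log T)) ≤
        ζ * (Tw T * P.σ ^ 2 / 80) ∨ IsUnit P.closedLoop := by
      rcases hsqrt with hs | hs
      · filter_upwards [eventually_le_of_isLittleO hs h0
          (by positivity : 0 < (ζ * P.σ ^ 2 / 80) / (M * √D + 1)), h0,
          tendsto_log_natCast.eventually_ge_atTop 0] with T hT hT0 hL
        left
        rw [div_mul_eq_mul_div, le_div_iff₀ (by positivity)] at hT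
        have h3 : M * √(Real.log T) * √(D * (T * Real.log T)) =
            (√(T : ℝ) * Real.log T) * (M * √D) := by
          rw [Real.sqrt_mul hD.le, Real.sqrt_mul (by positivity)]
          linear_combination (M * √D * √(T : ℝ)) * Real.mul_self_sqrt hL
        have h4 : 0 ≤ √(T : ℝ) * Real.log T := by positivity
        rw [h3]
        linarith
      · exact Eventually.of_forall fun T => Or.inr hs
    have hUT : ∀ᶠ T : ℕ in atTop, D * (T * Real.log T) ≤ (T : ℝ) ^ 2 := by
      filter_upwards [eventually_le_of_isLittleO (isLittleO_log_natCast_rpow one_pos)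
        (Eventually.of_forall fun T => by positivity) (by positivity : 0 < 1 / D)] with T hT
      rw [Real.rpow_one, div_mul_eq_mul_div, one_mul, le_div_iff₀ hD] at hT
      have := mul_le_mul_of_nonneg_left hT (by positivity : (0 : ℝ) ≤ T)
      linarith
    filter_upwards [hl, hlu, hUT, h1, hmreg, hCreg.bound, hDU, eventually_ge_atTop 1,
      tendsto_log_natCast.eventually_ge_atTop (-Real.log (P.δ * √(m ^ (n + d))))]
      with T hl hlu hUT h1 hmreg hCreg hDU hT hlogm Ω _ pr _ r
    have hT1 : (1 : ℝ) ≤ T := by exact_mod_cast hT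
    rw [Real.norm_of_nonneg (Real.log_nonneg hT1)] at hCreg
    exact r.ae_le_optimismProb hP hn hζ (by linarith) hm hmreg hT1
      ((Real.le_norm_self _).trans hCreg) hC.le hlogm hDU hUT hl hlu
  obtain ⟨ε, hε0, hε⟩ := exists_tendsto_zero_of_forall_eventually
    (p := fun ε T => ∀ (Ω : Type u) [MeasurableSpace Ω]
      (pr : Measure Ω) [IsProbabilityMeasure pr] (r : Run P (reg T) (Tw T) Ω pr),
      ∀ᵐ ω ∂pr, ω ∈ r.goodEvent (ρ T) (c T) T ∩ r.explorationEvent T →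
        ∀ t : ℕ, P.Tr (Tw T) < t → t ≤ T → gaussianQ 1 / (1 + ε) ≤ r.optimismProb t ω)
    (fun T ε ε' hε hle h Ω _ pr _ r => by
      filter_upwards [h Ω pr r] with ω hω hmem t ht1 ht2
      exact (div_le_div_of_nonneg_left hq.le (by linarith) (by linarith)).trans
        (hω hmem t ht1 ht2)) key
  refine ⟨ε, _, hε0, tendsto_exploration_failure (n := n) hP hd h0 hlog hTwtop, ?_⟩
  filter_upwards [hε, h1, eventually_grid_conditions (n := n) hP hd h1 h2 hc,
    eventually_ge_atTop 1] with T hT h1 hgrid hT1 Ω _ pr _ r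
  exact ⟨r.measure_goodEvent_diff_le hP hn hd h1 (ρ T) (c T) T T hT1 hgrid.1 hgrid.2, hT Ω pr r⟩

lemma eventually_sqrt_mul_log_le :
    ∀ᶠ T : ℕ in atTop, √(T : ℝ) * Real.log T ≤ (T : ℝ) ^ (3 / 5 : ℝ) := by
  filter_upwards [eventually_le_of_isLittleO
    (isLittleO_log_natCast_rpow (by norm_num : (0 : ℝ) < 1 / 10))
    (Eventually.of_forall fun T => by positivity) one_pos, eventually_ge_atTop 1] with T h hT
  have hT0 : (0 : ℝ) < T := by exact_mod_cast hT
  rw [one_mul] at h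
  calc √(T : ℝ) * Real.log T ≤ (T : ℝ) ^ (1 / 2 : ℝ) * (T : ℝ) ^ (1 / 10 : ℝ) := by
        rw [Real.sqrt_eq_rpow]; gcongr
    _ = (T : ℝ) ^ (3 / 5 : ℝ) := by rw [← Real.rpow_add hT0]; norm_num

end TSAC

end

theorem theorem2 {n d : ℕ} (hn : 0 < n) (hd : 0 < d) (P : TSAC.Setting n d) (hP : P.Standing)
    (reg : ℕ → ℝ) (hreg_pos : ∃ m > 0, ∀ᶠ T in atTop, m ≤ reg T)
    (hreg_le : reg =O[atTop] fun T : ℕ => Real.log T)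
    (ρ : ℕ → ℝ)
    (c' : ℕ → ℝ) (hc' : ∀ a : ℝ, 0 < a → c' =O[atTop] fun T : ℕ => (T : ℝ) ^ a) :
    (P.closedLoop ≠ 0 →
      ∀ (c : ℝ) (e Tw : ℕ → ℝ), 0 < c → Tendsto e atTop (𝓝 0) →
        (∀ᶠ T : ℕ in atTop, Tw T = c * n ^ 2 * (√(T : ℝ) * Real.log T) ^ (1 + e T)) →
        (fun T : ℕ => √(T : ℝ) * Real.log T) =o[atTop] Tw →
        TSAC.OptimisticSampling.{u} P Tw reg ρ c') ∧
    (IsUnit P.closedLoop →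
      ∀ (c : ℝ) (e Tw : ℕ → ℝ), 0 < c → Tendsto e atTop (𝓝 0) →
        (∀ᶠ T : ℕ in atTop, Tw T = c * Real.log T ^ (1 + e T)) →
        (fun T : ℕ => Real.log T) =o[atTop] Tw →
        TSAC.OptimisticSampling.{u} P Tw reg ρ c') := by
  have hlog_le : ∀ᶠ T : ℕ in atTop, 1 ≤ Real.log T ∧ Real.log T ≤ √(T : ℝ) * Real.log T := by
    filter_upwards [TSAC.tendsto_log_natCast.eventually_ge_atTop 1, eventually_ge_atTop 1]
      with T hL hT
    have hT1 : (1 : ℝ) ≤ √(T : ℝ) := Real.one_le_sqrt.2 (by exact_mod_cast hT)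
    exact ⟨hL, le_mul_of_one_le_left (by linarith) hT1⟩
  refine ⟨fun hne c e Tw hc he hTw ho => ?_, fun hu c e Tw hc he hTw ho => ?_⟩
  · have hn0 : (0 : ℝ) < n := by exact_mod_cast hn
    have hlog : (fun T : ℕ => Real.log T) =o[atTop] Tw :=
      IsBigO.trans_isLittleO (IsBigO.of_bound 1 (by
        filter_upwards [hlog_le] with T hT
        rw [one_mul, Real.norm_of_nonneg (by linarith)]
        exact hT.2.trans (Real.le_norm_self _))) ho
    exact TSAC.optimisticSampling_of_isLittleO hn hd hP hne hreg_pos hreg_le hc'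
      (TSAC.eventually_le_rpow_of_eq (by positivity) he hTw
        (hlog_le.mono fun T h => h.1.trans h.2) TSAC.eventually_sqrt_mul_log_le)
      hlog (Or.inl ho)
  -- A positive dimension makes the matrix ring nontrivial, so that an invertible closed loop is
  -- nonzero.
  · have : Nonempty (Fin n) := ⟨⟨0, hn⟩⟩
    exact TSAC.optimisticSampling_of_isLittleO hn hd hP hu.ne_zero hreg_pos hreg_le hc'
      (TSAC.eventually_le_rpow_of_eq hc he hTw (hlog_le.mono fun T h => h.1)
        ((hlog_le.and TSAC.eventually_sqrt_mul_log_le).mono fun T h => h.1.2.trans h.2))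
      ho (Or.inr hu)
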